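/- **Setting.** Let $\theta>0$ and let $F_X$ be the law of a random variable $X\ge 0$ with $\psi_{F_X}(\lambda)=\mathbb E[\log(1+\lambda X)]<\infty$ for all $\lambda>0$. For $0<\sigma\le 1$ let $F_{XY_\sigma}=\sigma F_X+(1-\sigma)\delta_0$ be the law of $XY_\sigma$, where $Y_\sigma$ is a Bernoulli($\sigma$) variable independent of $X$; write $F_{XY_\sigma}(x)$ for its distribution function, and put $\Phi_{F_X}(t)=\mathbb E[\log|t-X|\,\mathbf 1(t\neq X)]$. For $\tau>0$ and a probability law $F$ on $[0,\infty)$, $M_\tau(F)=\int x\,P(\mathrm dx)$ denotes the mean of a Dirichlet process $P$ with parameters $(\tau,F)$, that is, a random probability measure such that for every finite measurable partition $(B_1,\dots,B_n)$ the vector $(P(B_1),\dots,P(B_n))$ has the Dirichlet distribution with parameters $(\tau F(B_1),\dots,\tau F(B_n))$. $G_1$ is a standard exponential variable, $\beta_{a,b}$ a beta$(a,b)$ variable with $\beta_{a,0}:=1$, and the factors of a product are independent. A GGC$(\theta,F_X)$ subordinator on $[0,1/\theta]$ is a process $(\zeta_\theta(t);0\le t\le 1/\theta)$ started at $0$, with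 nondecreasing right-continuous paths and independent stationary increments, such that $\mathbb E[e^{-\lambda\zeta_\theta(t)}]=e^{-t\theta\psi_{F_X}(\lambda)}$ for $\lambda\ge0$. For a Borel set $C\subseteq[0,1/\theta]$ write $\zeta_\theta(C)=\int \mathbf 1(s\in C)\,\zeta_\theta(\mathrm ds)$. **Proposition 2.1.** Let $\zeta_\theta$ be a GGC$(\theta,F_X)$ subordinator on $[0,1/\theta]$, let $(C_1,\dots,C_k)$ be a partition of $[0,1/\theta]$ into disjoint Borel sets, and suppose that $\sigma_i:=\theta|C_i|>0$ for every $i$, where $|\cdot|$ is Lebesgue measure. Then $\sum_{i=1}^k\sigma_i=1$, the variables $\zeta_\theta(C_1),\dots,\zeta_\theta(C_k)$ are independent, and for each $i$ the means $M_1(F_{XY_{\sigma_i}})$ and $M_{\sigma_i}(F_X)$ are almost surely finite and $$\zeta_\theta(C_i)\overset{d}{=}G_1\,M_1(F_{XY_{\sigma_i}}),\qquad M_1(F_{XY_{\sigma_i}})\overset{d}{=}\beta_{\sigma_i,1-\sigma_i}\,M_{\sigma_i}(F_X).$$ Suppose moreover that no $F_{XY_{\sigma_i}}$ is concentrated at a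 single point (that is, $X$ is not almost surely $0$ and, if $k=1$, $X$ is not almost surely constant). Then $(\zeta_\theta(C_1),\dots,\zeta_\theta(C_k))$ has the joint density $\prod_{i=1}^k g_{\sigma_i,F_X}(x_i)$ on $(0,\infty)^k$, where each $\zeta_\theta(C_i)$ has the density $$g_{\sigma_i,F_X}(x)=\frac1\pi\int_0^\infty e^{-x/y}\,y^{\sigma_i-2}\sin\bigl(\pi F_{XY_{\sigma_i}}(y)\bigr)e^{-\sigma_i\Phi_{F_X}(y)}\,\mathrm dy,\qquad x>0,$$ and each $M_1(F_{XY_{\sigma_i}})$ has the density $$\frac1\pi\,x^{\sigma_i-1}\sin\bigl(\pi F_{XY_{\sigma_i}}(x)\bigr)e^{-\sigma_i\Phi_{F_X}(x)},\qquad x>0.$$ -/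

import Mathlib

open MeasureTheory ProbabilityTheory Set

open scoped ENNReal

noncomputable section

/-! ### The law of `X Y_σ` and the functions that enter the densities -/

/-- The law `σ F + (1 - σ) δ₀` of `X Y_σ`, where `X` has law `F` and `Y_σ` is an independent
Bernoulli variable with success probability `σ ∈ (0, 1]`. -/
def bernoulliScaled (F : Measure ℝ) (σ : ℝ) : Measure ℝ :=
  ENNReal.ofReal σ • F + ENNReal.ofReal (1 - σ) • Measure.dirac 0

/-- `Φ_F(t) = E[log |t - X| 1(t ≠ X)]`, where `X` has law `F`. -/
def logPotential (F : Measure ℝ) (t : ℝ) : ℝ :=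
  ∫ x, ({t}ᶜ : Set ℝ).indicator (fun x => Real.log |t - x|) x ∂F

/-- `ψ_F(lam) = E[log (1 + lam X)]`, where `X` has law `F`. -/
def levyExponent (F : Measure ℝ) (lam : ℝ) : ℝ :=
  ∫ x, Real.log (1 + lam * x) ∂F

/-- `x ↦ π⁻¹ x ^ (σ - 1) sin (π F_{X Y_σ}(x)) exp (-σ Φ_F(x))` on `(0, ∞)`, extended by `0`. -/
def meanDensity (F : Measure ℝ) (σ x : ℝ) : ℝ :=
  if 0 < x then
    1 / Real.pi * x ^ (σ - 1) * Real.sin (Real.pi * cdf (bernoulliScaled F σ) x) *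
      Real.exp (-σ * logPotential F x)
  else 0

/-- `g_{σ,F}(x) = π⁻¹ ∫₀^∞ exp (-x / y) y ^ (σ - 2) sin (π F_{X Y_σ}(y)) exp (-σ Φ_F(y)) dy`
for `x > 0`, extended by `0`. -/
def ggcDensity (F : Measure ℝ) (σ x : ℝ) : ℝ :=
  if 0 < x then
    1 / Real.pi * ∫ y in Ioi (0 : ℝ), Real.exp (-x / y) * y ^ (σ - 2) *
      Real.sin (Real.pi * cdf (bernoulliScaled F σ) y) * Real.exp (-σ * logPotential F y)
  else 0

/-! ### Dirichlet processes and their means -/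

/-- The gamma law with shape `a ≥ 0` and scale `1`; for `a = 0` it is the point mass at `0`. -/
def gammaLaw (a : ℝ) : Measure ℝ :=
  if a = 0 then Measure.dirac 0 else gammaMeasure a 1

/-- The beta law with parameters `a > 0` and `b ≥ 0`, with the convention that a
beta variable with second parameter `0` is the constant `1`. -/
def betaLaw (a b : ℝ) : Measure ℝ :=
  if b = 0 then Measure.dirac 1 else betaMeasure a b

/-- The Dirichlet distribution with parameters `a i ≥ 0`, not all zero: the law of
`(G i / ∑ j, G j)_i`, where the `G i` are independent gamma variables with shapes `a i`. -/
def dirichletLaw {n : ℕ} (a : Fin n → ℝ) : Measure (Fin n → ℝ) :=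
  (Measure.pi fun i => gammaLaw (a i)).map fun g i => g i / ∑ j, g j

/-- `D` is the law `Π_{θ,F}` of a Dirichlet process with parameters `(θ, F)`, as a probability
measure on the space of measures on `ℝ`: the values on every finite measurable partition
`B` have the Dirichlet distribution with parameters `θ F(B i)`. -/
structure IsDirichletProcessLaw (θ : ℝ) (F : Measure ℝ) (D : Measure (Measure ℝ)) : Prop where
  isProbabilityMeasure : IsProbabilityMeasure D
  ae_isProbabilityMeasure : ∀ᵐ p ∂D, IsProbabilityMeasure p
  map_partition : ∀ (n : ℕ) (B : Fin n → Set ℝ), (∀ i, MeasurableSet (B i)) →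
    Pairwise (fun i j => Disjoint (B i) (B j)) → ⋃ i, B i = univ →
    D.map (fun p i => p.real (B i)) = dirichletLaw (fun i => θ * F.real (B i))

/-- The law of the mean `∫ x P(dx)` of a random measure `P` with law `D`. -/
def meanLaw (D : Measure (Measure ℝ)) : Measure ℝ :=
  D.map fun p => ∫ x, x ∂p

/-! ### Subordinators -/

/-- `(ζ t)`, `0 ≤ t ≤ T`, is a GGC`(θ, F)` subordinator on `[0, T]`: a process started at `0`
with nondecreasing right-continuous paths and with independent stationary increments, such that
`E[exp (-lam ζ(t))] = exp (-t θ ψ_F(lam))`. Only the values `ζ t` with `t ∈ [0, T]` matter. -/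
structure IsGGCSubordinator {Ω : Type*} [MeasurableSpace Ω] (P : Measure Ω) (T θ : ℝ)
    (F : Measure ℝ) (ζ : ℝ → Ω → ℝ) : Prop where
  measurable : ∀ t ∈ Icc 0 T, Measurable (ζ t)
  zero : ∀ᵐ ω ∂P, ζ 0 ω = 0
  monotone : ∀ᵐ ω ∂P, MonotoneOn (fun t => ζ t ω) (Icc 0 T)
  rightContinuous : ∀ᵐ ω ∂P, ∀ t ∈ Icc 0 T,
    ContinuousWithinAt (fun t => ζ t ω) (Icc t T) t
  indepIncrements : HasIndepIncrements (fun (t : Icc (0 : ℝ) T) ω => ζ t ω) P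
  stationaryIncrements : ∀ s t, 0 ≤ s → s ≤ t → t ≤ T →
    IdentDistrib (fun ω => ζ t ω - ζ s ω) (ζ (t - s)) P P
  laplace : ∀ t ∈ Icc 0 T, ∀ lam : ℝ, 0 ≤ lam →
    ∫ ω, Real.exp (-lam * ζ t ω) ∂P = Real.exp (-t * θ * levyExponent F lam)

/-- A function on `[0, T]`, extended to `ℝ` by its values at the end points. -/
def clampExtend (T : ℝ) (f : ℝ → ℝ) (t : ℝ) : ℝ := f (max 0 (min t T))

open scoped Classical in
/-- The Lebesgue–Stieltjes measure of a nondecreasing right-continuous function on `[0, T]`;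
it has mass `f t - f s` on `(s, t]`, no mass at `0`, and no mass off `[0, T]`. For any other
function it is `0` (the paths of a subordinator are such functions only almost surely). -/
def stieltjesOn (T : ℝ) (f : ℝ → ℝ) : Measure ℝ :=
  if h : Monotone (clampExtend T f) ∧
      ∀ x, ContinuousWithinAt (clampExtend T f) (Ici x) x then
    (StieltjesFunction.mk (clampExtend T f) h.1 h.2).measure
  else 0

/-- `ζ(C) = ∫ 1(s ∈ C) ζ(ds)`, for a process `ζ` on `[0, T]` with nondecreasing
right-continuous paths. -/
def processMass {Ω : Type*} (T : ℝ) (ζ : ℝ → Ω → ℝ) (C : Set ℝ) (ω : Ω) : ℝ :=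
  (stieltjesOn T fun t => ζ t ω).real C

end

/-! Every law is identified through a transform.

Masses of the subordinator. Independent stationary increments give `E exp(-∫ g dζ) = exp(-θ ∫
ψ_F(g(s)) ds)` for step functions on a grid, and limits extend this to bounded measurable `g ≥ 0`
(`IsStieltjesVersion.laplace_measurable`). For `g = ∑ u i 1_{C i}` the right side factorises over
`i`, which yields independence and the transform `exp(-σ_i ψ_F(u))` of `ζ(C i)`. Since `log(1 + u *
0) = 0`, this is `exp(-ψ(u))` for the exponent `ψ` of the law of `X Y_σ`.

Dirichlet means. The total of independent gamma variables is independent of their proportions,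
whence the Markov–Krein identity `E(1 + λM)^(-τ) = exp(-τ ψ_F(λ))`, for finite Dirichlet vectors
(`integral_dirichletLaw`) and then for the mean of a process
(`IsDirichletProcessLaw.hasMarkovKrein`). At order one the left side is the Laplace transform of `G₁
M`, which identifies `ζ(C i)`. Because `E(1 + sβ)⁻¹ = (1 + s)^(-σ)` for `β` of law beta`(σ, 1 - σ)`,
a beta factor turns order `σ` for `F` into order one for `X Y_σ`, and order one determines the law
(`HasMarkovKrein.unique`).

Densities. At order one the transform is an ordinary Stieltjes transform; it continues to the slit
plane as `exp(-∫ log(w + x) dF)`. Near `-t - i0` the integral of the logarithm tends to `Φ(t) -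
iπF(t)`, so the Poisson integrals converge to `π⁻¹ sin(πF(t)) exp(-Φ(t))`. No singular part appears
because `exp(-Φ)` is locally integrable when no atom has mass one
(`locallyIntegrable_exp_neg_logPotential`). Mixing exponentials over this density gives the density
of `ζ(C i)`. That claim presupposes no Dirichlet process, so a law with the order-one transform is
built by compactness (`exists_hasMarkovKrein_one`). -/

open Filter Topology
open scoped NNReal BoundedContinuousFunction

noncomputable section

/-! ### Uniqueness of multivariate Laplace transforms -/

/-- The function `x ↦ exp (-∑ u i * x i)` on the nonnegative orthant. -/
def expNegDot {ι : Type*} [Fintype ι] (u : ι → ℝ≥0) : (ι → ℝ≥0) →ᵇ ℝ :=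
  BoundedContinuousFunction.ofNormedAddCommGroup
    (fun x => Real.exp (-∑ i, (u i : ℝ) * x i)) (by fun_prop) 1 (fun x => by
      rw [Real.norm_eq_abs, abs_of_pos (Real.exp_pos _), Real.exp_le_one_iff]
      exact neg_nonpos.2 (Finset.sum_nonneg fun i _ => by positivity))

lemma expNegDot_apply {ι : Type*} [Fintype ι] (u x : ι → ℝ≥0) :
    expNegDot u x = Real.exp (-∑ i, (u i : ℝ) * x i) := rfl

lemma expNegDot_mul {ι : Type*} [Fintype ι] (u v : ι → ℝ≥0) :
    expNegDot u * expNegDot v = expNegDot (u + v) := by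
  ext x
  simp [expNegDot_apply, ← Real.exp_add, add_mul, Finset.sum_add_distrib]
  ring

/-- The real star algebra spanned by the functions `x ↦ exp (-∑ u i * x i)`. -/
def expNegAlgebra (ι : Type*) [Fintype ι] : StarSubalgebra ℝ ((ι → ℝ≥0) →ᵇ ℝ) :=
  { Algebra.adjoin ℝ (range (expNegDot (ι := ι))) with
    star_mem' := by
      intro a ha
      have : star a = a := by ext x; simp
      rwa [this] }

/-- Stone–Weierstrass: the exponentials are closed under products, so their linear span is an
algebra, and it separates points. The orthant of `ℝ≥0` is used because there the exponentials are
bounded. -/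
lemma ext_of_laplace_nnreal {ι : Type*} [Fintype ι] {μ ν : Measure (ι → ℝ≥0)}
    [IsFiniteMeasure μ] [IsFiniteMeasure ν]
    (h : ∀ u : ι → ℝ≥0, ∫ x, Real.exp (-∑ i, (u i : ℝ) * x i) ∂μ =
      ∫ x, Real.exp (-∑ i, (u i : ℝ) * x i) ∂ν) : μ = ν := by
  classical
  refine ext_of_forall_mem_subalgebra_integral_eq_of_polish (𝕜 := ℝ) (A := expNegAlgebra ι) ?_ ?_
  · intro x y hxy
    obtain ⟨i, hi⟩ : ∃ i, x i ≠ y i := by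
      by_contra hcon
      push Not at hcon
      exact hxy (funext hcon)
    have hm : expNegDot (Pi.single i (1 : ℝ≥0)) ∈ expNegAlgebra ι :=
      Algebra.subset_adjoin (mem_range_self _)
    refine ⟨_, ⟨_, ⟨_, hm, rfl⟩, rfl⟩, ?_⟩
    have hs : ∀ z : ι → ℝ≥0,
        expNegDot (Pi.single i (1 : ℝ≥0)) z = Real.exp (-(z i : ℝ)) := by
      intro z
      rw [expNegDot_apply, Finset.sum_eq_single i] <;> simp +contextual
    change expNegDot (Pi.single i (1 : ℝ≥0)) x ≠ expNegDot (Pi.single i (1 : ℝ≥0)) y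
    rw [hs, hs]
    intro he
    apply hi
    have := Real.exp_injective he
    exact_mod_cast neg_injective this
  · intro g hgA
    -- The generated algebra is the span of the monoid of exponentials, so only exponentials and
    -- linear combinations need checking.
    have hg' : g ∈ Submodule.span ℝ
        (Submonoid.closure (range (expNegDot (ι := ι))) : Set ((ι → ℝ≥0) →ᵇ ℝ)) := by
      rw [← Algebra.adjoin_eq_span]
      exact hgA
    clear hgA
    induction hg' using Submodule.span_induction with
    | mem g hg =>
      obtain ⟨u, rfl⟩ : ∃ u, g = expNegDot u := by
        induction hg using Submonoid.closure_induction with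
        | mem x hx => obtain ⟨u, rfl⟩ := hx; exact ⟨u, rfl⟩
        | one => exact ⟨0, by ext x; simp [expNegDot_apply]⟩
        | mul x y _ _ hx hy =>
          obtain ⟨u, rfl⟩ := hx
          obtain ⟨v, rfl⟩ := hy
          exact ⟨u + v, expNegDot_mul u v⟩
      exact h u
    | zero => simp
    | add x y _ _ hx hy =>
      simp only [BoundedContinuousFunction.coe_add, Pi.add_apply]
      rw [integral_add (x.integrable μ) (y.integrable μ),
        integral_add (x.integrable ν) (y.integrable ν), hx, hy]
    | smul a x _ hx =>
      simp only [BoundedContinuousFunction.coe_smul, integral_smul]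
      rw [hx]

/-- Finite measures on `ℝ^ι` that are carried by the nonnegative orthant and have the same
Laplace transform are equal. -/
theorem ext_of_laplace_pi {ι : Type*} [Fintype ι] {μ ν : Measure (ι → ℝ)}
    [IsFiniteMeasure μ] [IsFiniteMeasure ν]
    (hμ : ∀ᵐ x ∂μ, ∀ i, 0 ≤ x i) (hν : ∀ᵐ x ∂ν, ∀ i, 0 ≤ x i)
    (h : ∀ u : ι → ℝ, (∀ i, 0 ≤ u i) → ∫ x, Real.exp (-∑ i, u i * x i) ∂μ =
      ∫ x, Real.exp (-∑ i, u i * x i) ∂ν) : μ = ν := by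
  let T : (ι → ℝ) → (ι → ℝ≥0) := fun x i => (x i).toNNReal
  let S : (ι → ℝ≥0) → (ι → ℝ) := fun x i => x i
  have hT : Measurable T := by fun_prop
  have hS : Measurable S := by fun_prop
  -- Truncating at zero loses nothing on the orthant, so it suffices to compare the truncated laws.
  have key : ∀ ρ : Measure (ι → ℝ), (∀ᵐ x ∂ρ, ∀ i, 0 ≤ x i) → (ρ.map T).map S = ρ := by
    intro ρ hρ
    rw [Measure.map_map hS hT]
    conv_rhs => rw [← Measure.map_id (μ := ρ)]
    refine Measure.map_congr ?_
    filter_upwards [hρ] with x hx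
    ext i
    simp [S, T, hx i]
  have hT' : ∀ ρ : Measure (ι → ℝ), (∀ᵐ x ∂ρ, ∀ i, 0 ≤ x i) → ∀ u : ι → ℝ≥0,
      ∫ x, Real.exp (-∑ i, (u i : ℝ) * x i) ∂(ρ.map T) =
        ∫ x, Real.exp (-∑ i, (u i : ℝ) * x i) ∂ρ := by
    intro ρ hρ u
    rw [integral_map hT.aemeasurable (by
      refine Measurable.aestronglyMeasurable ?_; fun_prop)]
    refine integral_congr_ae ?_
    filter_upwards [hρ] with x hx
    simp [T, hx]
  rw [← key μ hμ, ← key ν hν]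
  congr 1
  refine ext_of_laplace_nnreal fun u => ?_
  rw [hT' μ hμ, hT' ν hν]
  exact h (fun i => u i) fun i => (u i).2

/-- Finite measures on `[0, ∞)` with the same Laplace transform are equal. -/
theorem ext_of_laplace {μ ν : Measure ℝ} [IsFiniteMeasure μ] [IsFiniteMeasure ν]
    (hμ : ∀ᵐ x ∂μ, 0 ≤ x) (hν : ∀ᵐ x ∂ν, 0 ≤ x)
    (h : ∀ u : ℝ, 0 ≤ u → ∫ x, Real.exp (-u * x) ∂μ = ∫ x, Real.exp (-u * x) ∂ν) :
    μ = ν := by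
  let J : ℝ → (Unit → ℝ) := fun x _ => x
  have hJ : Measurable J := by fun_prop
  have hE : Measurable (fun x : Unit → ℝ => x ()) := by fun_prop
  have key : ∀ ρ : Measure ℝ, (ρ.map J).map (fun x => x ()) = ρ := by
    intro ρ
    rw [Measure.map_map hE hJ]
    exact Measure.map_id
  rw [← key μ, ← key ν]
  congr 1
  have hpos : ∀ ρ : Measure ℝ, (∀ᵐ x ∂ρ, 0 ≤ x) → ∀ᵐ x ∂(ρ.map J), ∀ i, 0 ≤ x i := by
    intro ρ hρ
    rw [ae_map_iff hJ.aemeasurable (by measurability)]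
    filter_upwards [hρ] with x hx i using hx
  refine ext_of_laplace_pi (hpos μ hμ) (hpos ν hν) fun u hu => ?_
  rw [integral_map hJ.aemeasurable (by
      refine Measurable.aestronglyMeasurable ?_; fun_prop),
    integral_map hJ.aemeasurable (by
      refine Measurable.aestronglyMeasurable ?_; fun_prop)]
  simpa [J] using h (u ()) (hu ())

/-! ### Gamma laws -/

instance isProbabilityMeasure_gammaMeasure_one : IsProbabilityMeasure (gammaMeasure 1 1) :=
  isProbabilityMeasure_gammaMeasure one_pos one_pos

lemma isProbabilityMeasure_gammaLaw {a : ℝ} (ha : 0 ≤ a) : IsProbabilityMeasure (gammaLaw a) := by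
  unfold gammaLaw
  split_ifs with h
  · infer_instance
  · exact isProbabilityMeasure_gammaMeasure (lt_of_le_of_ne ha (Ne.symm h)) one_pos

lemma ae_nonneg_gammaMeasure (a r : ℝ) : ∀ᵐ x ∂(gammaMeasure a r), 0 ≤ x := by
  rw [gammaMeasure, ae_withDensity_iff (by unfold gammaPDF; fun_prop)]
  refine ae_of_all _ fun x hx => ?_
  by_contra hneg
  exact hx (gammaPDF_of_neg (not_le.1 hneg))

lemma ae_nonneg_gammaLaw (a : ℝ) : ∀ᵐ x ∂(gammaLaw a), 0 ≤ x := by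
  unfold gammaLaw
  split_ifs with h
  · rw [ae_dirac_iff measurableSet_Ici]
  · exact ae_nonneg_gammaMeasure a 1

lemma integral_exp_neg_gammaMeasure {a : ℝ} (ha : 0 < a) {u : ℝ} (hu : 0 ≤ u) :
    ∫ x, Real.exp (-u * x) ∂(gammaMeasure a 1) = (1 + u) ^ (-a) := by
  have hmeas : Measurable (gammaPDF a 1) := by unfold gammaPDF; fun_prop
  rw [gammaMeasure, integral_withDensity_eq_integral_toReal_smul hmeas
    (ae_of_all _ fun x => by simp [gammaPDF])]
  have h1 : ∀ x, (gammaPDF a 1 x).toReal • Real.exp (-u * x) =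
      (Ici (0 : ℝ)).indicator
        (fun x => 1 / Real.Gamma a * (x ^ (a - 1) * Real.exp (-((1 + u) * x)))) x := by
    intro x
    by_cases hx : 0 ≤ x
    · rw [gammaPDF, ENNReal.toReal_ofReal (gammaPDFReal_nonneg ha one_pos x), gammaPDFReal,
        if_pos hx, indicator_of_mem (mem_Ici.2 hx), smul_eq_mul]
      have : Real.exp (-((1 + u) * x)) = Real.exp (-(1 * x)) * Real.exp (-u * x) := by
        rw [← Real.exp_add]; ring_nf
      rw [this, Real.one_rpow]
      ring
    · rw [gammaPDF_of_neg (not_le.1 hx), indicator_of_notMem (by simpa using hx)]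
      simp
  simp_rw [h1]
  rw [integral_indicator measurableSet_Ici, integral_const_mul, integral_Ici_eq_integral_Ioi,
    Real.integral_rpow_mul_exp_neg_mul_Ioi ha (by linarith),
    one_div, one_div, Real.rpow_neg (by linarith), Real.inv_rpow (by linarith)]
  have := (Real.Gamma_pos_of_pos ha).ne'
  field_simp

lemma integral_exp_neg_gammaLaw {a : ℝ} (ha : 0 ≤ a) {u : ℝ} (hu : 0 ≤ u) :
    ∫ x, Real.exp (-u * x) ∂(gammaLaw a) = (1 + u) ^ (-a) := by
  unfold gammaLaw
  split_ifs with h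
  · simp [h]
  · exact integral_exp_neg_gammaMeasure (lt_of_le_of_ne ha (Ne.symm h)) hu

/-! ### Independence of the total and the proportions of gamma variables -/

lemma integral_exp_neg_pi {ι : Type*} [Fintype ι] (μ : ι → Measure ℝ)
    [∀ i, IsProbabilityMeasure (μ i)] (u : ι → ℝ) :
    ∫ x, Real.exp (-∑ i, u i * x i) ∂(Measure.pi μ) =
      ∏ i, ∫ x, Real.exp (-u i * x) ∂(μ i) := by
  rw [← integral_fintype_prod_eq_prod]
  congr 1 with x
  rw [← Real.exp_sum, ← Finset.sum_neg_distrib]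
  simp_rw [neg_mul]

lemma ae_nonneg_pi {ι : Type*} [Fintype ι] (μ : ι → Measure ℝ)
    [∀ i, IsProbabilityMeasure (μ i)] (h : ∀ i, ∀ᵐ x ∂(μ i), 0 ≤ x) :
    ∀ᵐ x ∂(Measure.pi μ), ∀ i, 0 ≤ x i := by
  rw [ae_all_iff]
  exact fun i => (Measure.quasiMeasurePreserving_eval μ i).ae (h i)

section Dirichlet

variable {n : ℕ} {a : Fin n → ℝ}

/-- Exponential tilting of independent gamma variables by their total is a rescaling. -/
lemma withDensity_exp_neg_sum_pi_gammaLaw (ha : ∀ i, 0 ≤ a i) {s : ℝ} (hs : 0 ≤ s) :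
    (Measure.pi fun i => gammaLaw (a i)).withDensity
        (fun g => ENNReal.ofReal (Real.exp (-(s * ∑ i, g i)))) =
      ENNReal.ofReal ((1 + s) ^ (-∑ i, a i)) •
        (Measure.pi fun i => gammaLaw (a i)).map (fun g => (1 + s)⁻¹ • g) := by
  have : ∀ i, IsProbabilityMeasure (gammaLaw (a i)) := fun i =>
    isProbabilityMeasure_gammaLaw (ha i)
  set π := Measure.pi fun i => gammaLaw (a i) with hπ
  have hpos : ∀ᵐ x ∂π, ∀ i, 0 ≤ x i := ae_nonneg_pi _ fun i => ae_nonneg_gammaLaw _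
  have hs1 : 0 < 1 + s := by linarith
  have hscale : Measurable (fun g : Fin n → ℝ => (1 + s)⁻¹ • g) := by fun_prop
  have hdens : Measurable
      (fun g : Fin n → ℝ => ENNReal.ofReal (Real.exp (-(s * ∑ i, g i)))) := by fun_prop
  have : IsFiniteMeasure (π.withDensity
      (fun g => ENNReal.ofReal (Real.exp (-(s * ∑ i, g i))))) := by
    refine isFiniteMeasure_withDensity ?_
    refine ne_top_of_le_ne_top (b := ∫⁻ _, 1 ∂π) (by simp) (lintegral_mono_ae ?_)
    filter_upwards [hpos] with x hx
    rw [ENNReal.ofReal_le_one, Real.exp_le_one_iff]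
    exact neg_nonpos.2 (mul_nonneg hs (Finset.sum_nonneg fun i _ => hx i))
  have : IsFiniteMeasure (ENNReal.ofReal ((1 + s) ^ (-∑ i, a i)) •
      π.map (fun g => (1 + s)⁻¹ • g)) := by
    have := Measure.isFiniteMeasure_map π (fun g => (1 + s)⁻¹ • g)
    exact Measure.smul_finite _ ENNReal.ofReal_ne_top
  -- Both sides have the Laplace transform `∏ (1 + s + u i) ^ (-a i)`.
  refine ext_of_laplace_pi ?_ ?_ fun u hu => ?_
  · exact (withDensity_absolutelyContinuous _ _).ae_le hpos
  · refine Measure.ae_smul_measure ?_ _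
    rw [ae_map_iff hscale.aemeasurable (by measurability)]
    filter_upwards [hpos] with x hx i
    exact mul_nonneg (by positivity) (hx i)
  · rw [integral_withDensity_eq_integral_toReal_smul hdens (ae_of_all _ fun _ => by simp),
      integral_smul_measure, integral_map hscale.aemeasurable
        (by refine Measurable.aestronglyMeasurable ?_; fun_prop),
      ENNReal.toReal_ofReal (by positivity)]
    have h1 : ∀ g : Fin n → ℝ, (ENNReal.ofReal (Real.exp (-(s * ∑ i, g i)))).toReal •
        Real.exp (-∑ i, u i * g i) = Real.exp (-∑ i, (s + u i) * g i) := by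
      intro g
      rw [ENNReal.toReal_ofReal (Real.exp_pos _).le, smul_eq_mul, ← Real.exp_add, Finset.mul_sum,
        ← neg_add, ← Finset.sum_add_distrib]
      simp_rw [add_mul]
    have h2 : ∀ g : Fin n → ℝ, Real.exp (-∑ i, u i * ((1 + s)⁻¹ • g) i) =
        Real.exp (-∑ i, (u i / (1 + s)) * g i) := by
      intro g
      congr 2
      refine Finset.sum_congr rfl fun i _ => ?_
      simp only [Pi.smul_apply, smul_eq_mul]
      ring
    simp_rw [h1, h2]
    rw [integral_exp_neg_pi, integral_exp_neg_pi, ← Finset.sum_neg_distrib,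
      Real.rpow_sum_of_pos hs1, smul_eq_mul, ← Finset.prod_mul_distrib]
    refine Finset.prod_congr rfl fun i _ => ?_
    rw [integral_exp_neg_gammaLaw (ha i) (add_nonneg hs (hu i)),
      integral_exp_neg_gammaLaw (ha i) (div_nonneg (hu i) hs1.le),
      ← Real.mul_rpow hs1.le (by have := hu i; positivity)]
    congr 1
    field_simp
    ring

/-- The Markov–Krein identity for a finite Dirichlet distribution. -/
lemma integral_dirichletLaw (ha : ∀ i, 0 ≤ a i) {c : Fin n → ℝ} (hc : ∀ i, 0 ≤ c i)
    {lam : ℝ} (hlam : 0 ≤ lam) :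
    ∫ r, (1 + lam * ∑ i, c i * r i) ^ (-∑ i, a i) ∂(dirichletLaw a) =
      ∏ i, (1 + lam * c i) ^ (-a i) := by
  have : ∀ i, IsProbabilityMeasure (gammaLaw (a i)) := fun i =>
    isProbabilityMeasure_gammaLaw (ha i)
  set τ := ∑ i, a i with hτ
  have hτ0 : 0 ≤ τ := Finset.sum_nonneg fun i _ => ha i
  have := isProbabilityMeasure_gammaLaw hτ0
  set π := Measure.pi fun i => gammaLaw (a i) with hπ
  have hpos : ∀ᵐ x ∂π, ∀ i, 0 ≤ x i := ae_nonneg_pi _ fun i => ae_nonneg_gammaLaw _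
  let S : (Fin n → ℝ) → ℝ := fun g => ∑ i, g i
  let Y : (Fin n → ℝ) → ℝ := fun g => ∑ i, c i * (g i / S g)
  have hS : Measurable S := by fun_prop
  have hY : Measurable Y := by fun_prop
  have hYpos : ∀ᵐ x ∂π, 0 ≤ Y x := by
    filter_upwards [hpos] with x hx
    exact Finset.sum_nonneg fun i _ => mul_nonneg (hc i)
      (div_nonneg (hx i) (Finset.sum_nonneg fun i _ => hx i))
  have hSpos : ∀ᵐ x ∂π, 0 ≤ S x := by
    filter_upwards [hpos] with x hx
    exact Finset.sum_nonneg fun i _ => hx i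
  have hYscale : ∀ (t : ℝ) (g : Fin n → ℝ), 0 < t → Y (t • g) = Y g := by
    intro t g ht
    refine Finset.sum_congr rfl fun i _ => ?_
    simp only [S, Pi.smul_apply, smul_eq_mul, ← Finset.mul_sum]
    rw [mul_div_mul_left _ _ ht.ne']
  have hYS : ∀ᵐ x ∂π, S x * Y x = ∑ i, c i * x i := by
    filter_upwards [hpos] with x hx
    rw [Finset.mul_sum]
    refine Finset.sum_congr rfl fun i _ => ?_
    -- When the total vanishes every coordinate does, so the convention `x / 0 = 0` is harmless.
    by_cases h0 : S x = 0
    · have : x i = 0 :=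
        (Finset.sum_eq_zero_iff_of_nonneg fun i _ => hx i).1 h0 i (Finset.mem_univ i)
      simp [this]
    · field_simp
  have : IsProbabilityMeasure (π.map Y) := Measure.isProbabilityMeasure_map hY.aemeasurable
  -- Independence of `Y` and `S`: tilting by `exp(-u S)` amounts to a rescaling, and `Y` is
  -- homogeneous of degree zero, so the joint transform factorises.
  have hjoint : π.map (fun g => ![Y g, S g]) = Measure.pi ![π.map Y, gammaLaw τ] := by
    have hp : ∀ i : Fin 2, IsProbabilityMeasure ((![π.map Y, gammaLaw τ] : Fin 2 → Measure ℝ) i) := by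
      intro i; fin_cases i <;> simpa
    have hVm : Measurable (fun g => ![Y g, S g]) := by
      rw [measurable_pi_iff]; intro i; fin_cases i <;> simpa
    have := Measure.isFiniteMeasure_map π (fun g => ![Y g, S g])
    have hYpos' : ∀ᵐ x ∂(π.map Y), 0 ≤ x := by
      rwa [ae_map_iff hY.aemeasurable measurableSet_Ici]
    refine ext_of_laplace_pi ?_ ?_ fun u hu => ?_
    · rw [ae_map_iff hVm.aemeasurable (by measurability)]
      filter_upwards [hYpos, hSpos] with x h1 h2 i
      fin_cases i <;> simpa
    · refine ae_nonneg_pi _ fun i => ?_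
      fin_cases i
      · simpa using hYpos'
      · simpa using ae_nonneg_gammaLaw τ
    · rw [integral_exp_neg_pi, integral_map hVm.aemeasurable
        (by refine Measurable.aestronglyMeasurable ?_; fun_prop)]
      simp only [Fin.sum_univ_two, Fin.prod_univ_two, Matrix.cons_val_zero, Matrix.cons_val_one]
      rw [integral_exp_neg_gammaLaw hτ0 (hu 1), integral_map hY.aemeasurable
        (by refine Measurable.aestronglyMeasurable ?_; fun_prop)]
      have hdens : Measurable
        (fun g : Fin n → ℝ => ENNReal.ofReal (Real.exp (-(u 1 * ∑ i, g i)))) := by fun_prop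
      have h1 : ∀ g : Fin n → ℝ, Real.exp (-(u 0 * Y g + u 1 * S g)) =
          (ENNReal.ofReal (Real.exp (-(u 1 * ∑ i, g i)))).toReal • Real.exp (-u 0 * Y g) := by
        intro g
        rw [ENNReal.toReal_ofReal (Real.exp_pos _).le, smul_eq_mul, ← Real.exp_add]
        congr 1
        ring
      simp_rw [h1]
      have h1u : 0 < 1 + u 1 := by have := hu 1; linarith
      rw [← integral_withDensity_eq_integral_toReal_smul hdens (ae_of_all _ fun _ => by simp),
        withDensity_exp_neg_sum_pi_gammaLaw ha (hu 1), integral_smul_measure,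
        integral_map (by fun_prop) (by refine Measurable.aestronglyMeasurable ?_; fun_prop),
        ENNReal.toReal_ofReal (by positivity), smul_eq_mul, mul_comm]
      congr 1
      refine integral_congr_ae (ae_of_all _ fun g => ?_)
      simp only
      rw [hYscale _ _ (by positivity)]
  have hmp := measurePreserving_finTwoArrow_vec (π.map Y) (gammaLaw τ)
  have hjoint2 : π.map (fun g => (Y g, S g)) = (π.map Y).prod (gammaLaw τ) := by
    rw [← hmp.map_eq, ← hjoint, Measure.map_map (by fun_prop)
      (by rw [measurable_pi_iff]; intro i; fin_cases i <;> simpa)]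
    rfl
  have hbd : Integrable (fun p : ℝ × ℝ => Real.exp (-(lam * p.1) * p.2))
      ((π.map Y).prod (gammaLaw τ)) := by
    rw [← hjoint2, integrable_map_measure
      (by refine Measurable.aestronglyMeasurable ?_; fun_prop) (by fun_prop)]
    refine Integrable.of_bound (by refine Measurable.aestronglyMeasurable ?_; fun_prop) 1 ?_
    filter_upwards [hYpos, hSpos] with x h1 h2
    rw [Function.comp_apply, Real.norm_eq_abs, abs_of_pos (Real.exp_pos _), Real.exp_le_one_iff]
    have := mul_nonneg (mul_nonneg hlam h1) h2
    simpa using this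
  -- Since `S Y = ∑ c i g i`, integrating out the independent gamma variable `S` of shape `τ` gives
  -- the generalized Stieltjes transform of `Y`.
  have hE : ∫ g, Real.exp (-∑ i, (lam * c i) * g i) ∂π = ∫ g, (1 + lam * Y g) ^ (-τ) ∂π := by
    calc ∫ g, Real.exp (-∑ i, (lam * c i) * g i) ∂π
        = ∫ g, Real.exp (-(lam * Y g) * S g) ∂π := by
          refine integral_congr_ae ?_
          filter_upwards [hYS] with g hg
          congr 1
          simp_rw [mul_assoc]
          rw [← Finset.mul_sum, ← hg]
          ring
      _ = ∫ p, Real.exp (-(lam * p.1) * p.2) ∂(π.map (fun g => (Y g, S g))) := by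
          rw [integral_map (by fun_prop) (by refine Measurable.aestronglyMeasurable ?_; fun_prop)]
      _ = ∫ g, (1 + lam * Y g) ^ (-τ) ∂π := by
          rw [hjoint2, integral_prod _ hbd, integral_map hY.aemeasurable
            hbd.integral_prod_left.aestronglyMeasurable]
          refine integral_congr_ae ?_
          filter_upwards [hYpos] with g hg
          exact integral_exp_neg_gammaLaw hτ0 (mul_nonneg hlam hg)
  rw [dirichletLaw, integral_map (by fun_prop)
    (by refine Measurable.aestronglyMeasurable ?_; fun_prop)]
  refine hE.symm.trans ?_
  rw [integral_exp_neg_pi]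
  refine Finset.prod_congr rfl fun i _ => ?_
  exact integral_exp_neg_gammaLaw (ha i) (mul_nonneg hlam (hc i))

end Dirichlet

/-! ### Means of Dirichlet processes -/

/-- A simple function with finite values, written along the partition into its level sets. -/
lemma exists_partition_of_simpleFunc (g : SimpleFunc ℝ ℝ≥0∞) (hg : ∀ x, g x < ∞) :
    ∃ (n : ℕ) (B : Fin n → Set ℝ) (c : Fin n → ℝ), (∀ i, MeasurableSet (B i)) ∧
      Pairwise (fun i j => Disjoint (B i) (B j)) ∧ ⋃ i, B i = univ ∧ (∀ i, 0 ≤ c i) ∧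
      (∀ i, ∀ x ∈ B i, (g x).toReal = c i) ∧
      ∀ p : Measure ℝ, IsProbabilityMeasure p →
        (∫⁻ x, g x ∂p).toReal = ∑ i, c i * p.real (B i) := by
  let e := g.range.equivFin
  refine ⟨g.range.card, fun i => g ⁻¹' {(e.symm i : ℝ≥0∞)}, fun i => (e.symm i : ℝ≥0∞).toReal,
    fun i => g.measurableSet_fiber _, ?_, ?_, fun i => ENNReal.toReal_nonneg, ?_, ?_⟩
  · intro i j hij
    refine Disjoint.preimage _ ?_
    rw [Set.disjoint_singleton]
    intro h
    exact hij (e.symm.injective (Subtype.ext h))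
  · refine eq_univ_of_forall fun x => mem_iUnion.2 ⟨e ⟨g x, g.mem_range_self x⟩, ?_⟩
    simp
  · rintro i x hx
    rw [mem_preimage, mem_singleton_iff] at hx
    rw [hx]
  · intro p hp
    rw [SimpleFunc.lintegral_eq_lintegral, SimpleFunc.lintegral, ENNReal.toReal_sum]
    · rw [← Finset.sum_coe_sort, ← e.symm.sum_comp]
      refine Finset.sum_congr rfl fun i _ => ?_
      rw [ENNReal.toReal_mul]
      rfl
    · intro y hy
      obtain ⟨x, rfl⟩ := SimpleFunc.mem_range.1 hy
      exact ENNReal.mul_ne_top (hg x).ne (measure_ne_top p _)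

lemma integral_log_partition {F : Measure ℝ} [IsProbabilityMeasure F] {n : ℕ}
    {B : Fin n → Set ℝ} (hB : ∀ i, MeasurableSet (B i))
    (hd : Pairwise fun i j => Disjoint (B i) (B j)) (hU : ⋃ i, B i = univ)
    {f : ℝ → ℝ} {c : Fin n → ℝ} (hf : ∀ i, ∀ x ∈ B i, f x = c i) :
    ∫ x, f x ∂F = ∑ i, F.real (B i) * c i := by
  have hc : ∀ i, IntegrableOn f (B i) F := fun i =>
    (integrableOn_const (measure_ne_top F _) (C := c i)).congr_fun
      (fun x hx => (hf i x hx).symm) (hB i)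
  rw [← setIntegral_univ, ← hU, integral_iUnion_fintype hB hd hc]
  refine Finset.sum_congr rfl fun i _ => ?_
  rw [setIntegral_congr_fun (hB i) (hf i), setIntegral_const, smul_eq_mul]

lemma prod_rpow_eq_exp {n : ℕ} {c : Fin n → ℝ} (hc : ∀ i, 0 ≤ c i) {lam : ℝ} (hlam : 0 ≤ lam)
    (w : Fin n → ℝ) :
    ∏ i, (1 + lam * c i) ^ (-w i) = Real.exp (-∑ i, w i * Real.log (1 + lam * c i)) := by
  rw [← Finset.sum_neg_distrib, Real.exp_sum]
  refine Finset.prod_congr rfl fun i _ => ?_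
  have : 0 < 1 + lam * c i := by have := mul_nonneg hlam (hc i); linarith
  rw [Real.rpow_def_of_pos this]
  ring_nf

lemma sum_real_partition {F : Measure ℝ} [IsProbabilityMeasure F] {n : ℕ}
    {B : Fin n → Set ℝ} (hB : ∀ i, MeasurableSet (B i))
    (hd : Pairwise fun i j => Disjoint (B i) (B j)) (hU : ⋃ i, B i = univ) :
    ∑ i, F.real (B i) = 1 := by
  have := integral_log_partition (F := F) hB hd hU (f := fun _ => 1) (c := fun _ => 1)
    (fun _ _ _ => rfl)
  simpa using this.symm

/-- On the level sets of `g` the random measure is a finite Dirichlet vector whose parameters sum to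
`τ`, so `integral_dirichletLaw` applies. -/
lemma IsDirichletProcessLaw.integral_simpleFunc {τ : ℝ} (hτ : 0 < τ) {F : Measure ℝ}
    [IsProbabilityMeasure F] {D : Measure (Measure ℝ)} (hD : IsDirichletProcessLaw τ F D)
    (g : SimpleFunc ℝ ℝ≥0∞) (hg : ∀ x, g x < ∞) {lam : ℝ} (hlam : 0 ≤ lam) :
    ∫ p, (1 + lam * (∫⁻ x, g x ∂p).toReal) ^ (-τ) ∂D =
      Real.exp (-τ * ∫ x, Real.log (1 + lam * (g x).toReal) ∂F) := by
  obtain ⟨n, B, c, hB, hd, hU, hc, hgc, hsum⟩ := exists_partition_of_simpleFunc g hg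
  have hs := sum_real_partition (F := F) hB hd hU
  have hm : Measurable (fun (p : Measure ℝ) i => p.real (B i)) := by
    rw [measurable_pi_iff]
    exact fun i => (Measure.measurable_coe (hB i)).ennreal_toReal
  have h1 : ∫ p, (1 + lam * (∫⁻ x, g x ∂p).toReal) ^ (-τ) ∂D =
      ∫ r, (1 + lam * ∑ i, c i * r i) ^ (-τ) ∂(D.map fun p i => p.real (B i)) := by
    rw [integral_map hm.aemeasurable (by refine Measurable.aestronglyMeasurable ?_; fun_prop)]
    refine integral_congr_ae ?_
    filter_upwards [hD.ae_isProbabilityMeasure] with p hp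
    rw [hsum p hp]
  have h2 : τ = ∑ i, τ * F.real (B i) := by rw [← Finset.mul_sum, hs, mul_one]
  rw [h1, hD.map_partition n B hB hd hU]
  have h3 := integral_dirichletLaw (a := fun i => τ * F.real (B i)) (fun i => by positivity) hc hlam
  rw [← h2] at h3
  rw [h3, prod_rpow_eq_exp hc hlam,
    integral_log_partition hB hd hU (c := fun i => Real.log (1 + lam * c i))
      (fun i x hx => by rw [hgc i x hx])]
  congr 1
  rw [Finset.mul_sum, ← Finset.sum_neg_distrib]
  refine Finset.sum_congr rfl fun i _ => ?_
  ring

/-! ### Simple approximation of the identity and limits of the exponent. -/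

/-- The monotone simple approximations of `x ↦ x` on `[0, ∞)`. -/
def idApprox (n : ℕ) : SimpleFunc ℝ ℝ≥0∞ := SimpleFunc.eapprox ENNReal.ofReal n

lemma idApprox_lt_top (n : ℕ) (x : ℝ) : idApprox n x < ∞ := SimpleFunc.eapprox_lt_top _ _ _

lemma idApprox_le (n : ℕ) (x : ℝ) : idApprox n x ≤ ENNReal.ofReal x := by
  have := SimpleFunc.iSup_eapprox_apply ENNReal.measurable_ofReal x
  rw [← this]
  exact le_iSup (fun k => SimpleFunc.eapprox ENNReal.ofReal k x) n

lemma tendsto_idApprox (x : ℝ) :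
    Tendsto (fun n => idApprox n x) atTop (𝓝 (ENNReal.ofReal x)) := by
  have := SimpleFunc.iSup_eapprox_apply ENNReal.measurable_ofReal x
  rw [← this]
  exact tendsto_atTop_iSup fun i j hij => SimpleFunc.monotone_eapprox _ hij x

lemma tendsto_lintegral_idApprox (p : Measure ℝ) :
    Tendsto (fun n => ∫⁻ x, idApprox n x ∂p) atTop (𝓝 (∫⁻ x, ENNReal.ofReal x ∂p)) :=
  lintegral_tendsto_of_tendsto_of_monotone (fun n => (idApprox n).measurable.aemeasurable)
    (ae_of_all _ fun x _ _ hij => SimpleFunc.monotone_eapprox _ hij x)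
    (ae_of_all _ tendsto_idApprox)

lemma toReal_idApprox_le (n : ℕ) {x : ℝ} (hx : 0 ≤ x) : (idApprox n x).toReal ≤ x := by
  have := ENNReal.toReal_mono ENNReal.ofReal_ne_top (idApprox_le n x)
  rwa [ENNReal.toReal_ofReal hx] at this

lemma ae_nonneg_of_Iio {F : Measure ℝ} (h : F (Iio 0) = 0) : ∀ᵐ x ∂F, 0 ≤ x := by
  rw [ae_iff]
  simpa [Iio_def] using h

lemma levyExponent_nonneg {F : Measure ℝ} (h0 : ∀ᵐ x ∂F, 0 ≤ x) {lam : ℝ} (hlam : 0 ≤ lam) :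
    0 ≤ levyExponent F lam := by
  refine integral_nonneg_of_ae ?_
  filter_upwards [h0] with x hx
  exact Real.log_nonneg (by have := mul_nonneg hlam hx; linarith)

lemma log_one_add_idApprox_nonneg {lam : ℝ} (hlam : 0 ≤ lam) (n : ℕ) (x : ℝ) :
    0 ≤ Real.log (1 + lam * (idApprox n x).toReal) :=
  Real.log_nonneg (by have := mul_nonneg hlam (ENNReal.toReal_nonneg (a := idApprox n x)); linarith)

lemma log_one_add_idApprox_le {lam : ℝ} (hlam : 0 ≤ lam) (n : ℕ) {x : ℝ} (hx : 0 ≤ x) :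
    Real.log (1 + lam * (idApprox n x).toReal) ≤ Real.log (1 + lam * x) := by
  refine Real.log_le_log ?_ ?_
  · have := mul_nonneg hlam (ENNReal.toReal_nonneg (a := idApprox n x)); linarith
  · have := mul_le_mul_of_nonneg_left (toReal_idApprox_le n hx) hlam; linarith

lemma measurable_log_one_add_idApprox (lam : ℝ) (n : ℕ) :
    Measurable fun x => Real.log (1 + lam * (idApprox n x).toReal) :=
  Real.measurable_log.comp (measurable_const.add
    ((idApprox n).measurable.ennreal_toReal.const_mul lam))

section LogIntegrable

variable {F : Measure ℝ} (h0 : ∀ᵐ x ∂F, 0 ≤ x)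

include h0

lemma tendsto_integral_log_idApprox {lam : ℝ} (hlam : 0 ≤ lam)
    (hF : Integrable (fun x => Real.log (1 + lam * x)) F) :
    Tendsto (fun n => ∫ x, Real.log (1 + lam * (idApprox n x).toReal) ∂F) atTop
      (𝓝 (levyExponent F lam)) := by
  refine tendsto_integral_of_dominated_convergence _
    (fun n => (measurable_log_one_add_idApprox lam n).aestronglyMeasurable) hF (fun n => ?_) ?_
  · filter_upwards [h0] with x hx
    rw [Real.norm_eq_abs, abs_of_nonneg (log_one_add_idApprox_nonneg hlam n x)]
    exact log_one_add_idApprox_le hlam n hx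
  · filter_upwards [h0] with x hx
    have h1 := (ENNReal.tendsto_toReal ENNReal.ofReal_ne_top).comp (tendsto_idApprox x)
    rw [ENNReal.toReal_ofReal hx] at h1
    refine (Real.continuousAt_log ?_).tendsto.comp ((h1.const_mul lam).const_add 1)
    have := mul_nonneg hlam hx
    linarith

lemma integral_log_idApprox_le {lam : ℝ} (hlam : 0 ≤ lam)
    (hF : Integrable (fun x => Real.log (1 + lam * x)) F) (n : ℕ) :
    ∫ x, Real.log (1 + lam * (idApprox n x).toReal) ∂F ≤ levyExponent F lam := by
  refine integral_mono_of_nonneg (ae_of_all _ fun x => log_one_add_idApprox_nonneg hlam n x) hF ?_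
  filter_upwards [h0] with x hx using log_one_add_idApprox_le hlam n hx

/-- Dominated convergence under `log(1 + x)`. Behaviour at small `lam` controls mass at infinity: it
yields finiteness of the mean and, later, tightness. -/
lemma tendsto_levyExponent_zero (hF : ∀ lam : ℝ, 0 < lam →
      Integrable (fun x => Real.log (1 + lam * x)) F) {l : ℕ → ℝ} (hl : ∀ n, 0 < l n)
    (hl1 : ∀ n, l n ≤ 1) (hl0 : Tendsto l atTop (𝓝 0)) :
    Tendsto (fun n => levyExponent F (l n)) atTop (𝓝 0) := by
  have : Tendsto (fun n => levyExponent F (l n)) atTop (𝓝 (∫ x, (0 : ℝ) ∂F)) := by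
    refine tendsto_integral_of_dominated_convergence (fun x => Real.log (1 + 1 * x))
      (fun n => (hF _ (hl n)).aestronglyMeasurable) (hF 1 one_pos) (fun n => ?_) ?_
    · filter_upwards [h0] with x hx
      have h1 := mul_nonneg (hl n).le hx
      rw [Real.norm_eq_abs, abs_of_nonneg (Real.log_nonneg (by linarith))]
      refine Real.log_le_log (by linarith) ?_
      have := mul_le_mul_of_nonneg_right (hl1 n) hx
      linarith
    · filter_upwards [h0] with x hx
      have h2 : Tendsto (fun n => 1 + l n * x) atTop (𝓝 1) := by
        simpa using (hl0.mul_const x).const_add 1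
      have h3 := (Real.continuousAt_log one_ne_zero).tendsto.comp h2
      rw [Real.log_one] at h3
      exact h3
  simpa using this

end LogIntegrable

/-- `μ` is a law on `[0, ∞)` whose generalized Stieltjes transform of order `τ` is
`lam ↦ exp (-τ ψ_F(lam))`. -/
structure HasMarkovKrein (τ : ℝ) (F μ : Measure ℝ) : Prop where
  isProbabilityMeasure : IsProbabilityMeasure μ
  ae_nonneg : ∀ᵐ m ∂μ, 0 ≤ m
  integral_eq : ∀ lam : ℝ, 0 < lam →
    ∫ m, (1 + lam * m) ^ (-τ) ∂μ = Real.exp (-τ * levyExponent F lam)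

/-! ### The Markov–Krein identity for the mean of a Dirichlet process. -/

section DirichletProcess

variable {τ : ℝ} (hτ : 0 < τ) {F : Measure ℝ} {D : Measure (Measure ℝ)}

include hτ

/-- In the partition `{s, sᶜ}` the first parameter is `0`, and the gamma law of shape `0` is the
point mass at `0`. Applied to `Iio 0`, this makes the mean a nonnegative integral. -/
lemma IsDirichletProcessLaw.ae_null (hD : IsDirichletProcessLaw τ F D) {s : Set ℝ}
    (hs : MeasurableSet s) (h : F s = 0) : ∀ᵐ p ∂D, p s = 0 := by
  let B : Fin 2 → Set ℝ := ![s, sᶜ]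
  have hB : ∀ i, MeasurableSet (B i) := by
    intro i
    fin_cases i
    · exact hs
    · exact hs.compl
  have hm : Measurable (fun (p : Measure ℝ) (i : Fin 2) => p.real (B i)) := by
    rw [measurable_pi_iff]
    exact fun i => (Measure.measurable_coe (hB i)).ennreal_toReal
  have hmap := hD.map_partition 2 B hB (by
      intro i j hij
      fin_cases i <;> fin_cases j <;>
        simp_all [B, disjoint_compl_right, disjoint_compl_left]) (by
      ext x; simp [B, Fin.exists_fin_two, em])
  have hd : ∀ᵐ r ∂(dirichletLaw fun i => τ * F.real (B i)), r 0 = 0 := by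
    rw [dirichletLaw, ae_map_iff (by fun_prop) (measurableSet_eq_fun (by fun_prop) (by fun_prop))]
    have h0 : τ * F.real (B 0) = 0 := by
      simp [B, measureReal_def, h]
    have hg : ∀ᵐ x ∂(gammaLaw (τ * F.real (B 0))), x = 0 := by
      rw [h0, gammaLaw, if_pos rfl]
      exact (ae_dirac_iff (measurableSet_singleton 0)).2 rfl
    have : ∀ i, IsProbabilityMeasure (gammaLaw (τ * F.real (B i))) := fun i =>
      isProbabilityMeasure_gammaLaw (by positivity)
    have := (Measure.quasiMeasurePreserving_eval (fun i => gammaLaw (τ * F.real (B i))) 0).ae hg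
    filter_upwards [this] with x hx
    simp [show x 0 = 0 from hx]
  rw [← hmap, ae_map_iff hm.aemeasurable (measurableSet_eq_fun (by fun_prop) (by fun_prop))] at hd
  filter_upwards [hd, hD.ae_isProbabilityMeasure] with p hp hp'
  simpa [B, measureReal_def, ENNReal.toReal_eq_zero_iff] using hp

lemma IsDirichletProcessLaw.ae_integral_eq (hF_nonneg : F (Iio 0) = 0) (hD : IsDirichletProcessLaw τ F D) :
    ∀ᵐ p ∂D, ∫ x, x ∂p = (∫⁻ x, ENNReal.ofReal x ∂p).toReal := by
  filter_upwards [hD.ae_null hτ measurableSet_Iio hF_nonneg] with p h2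
  exact integral_eq_lintegral_of_nonneg_ae (ae_nonneg_of_Iio h2) measurable_id.aestronglyMeasurable

variable [IsProbabilityMeasure F] (hF_nonneg : F (Iio 0) = 0)
    (hF_log : ∀ lam : ℝ, 0 < lam → Integrable (fun x => Real.log (1 + lam * x)) F)

include hF_nonneg hF_log

/-- The identity for simple functions passes to the limit under the bound `1`. It is stated in
`ℝ≥0∞` because the mean is not yet known to be finite; an infinite mean contributes `∞ ^ (-τ) = 0`.
-/
lemma IsDirichletProcessLaw.lintegral_rpow (hD : IsDirichletProcessLaw τ F D) {lam : ℝ}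
    (hlam : 0 < lam) :
    ∫⁻ p, (1 + ENNReal.ofReal lam * ∫⁻ x, ENNReal.ofReal x ∂p) ^ (-τ) ∂D =
      ENNReal.ofReal (Real.exp (-τ * levyExponent F lam)) := by
  have := hD.isProbabilityMeasure
  have h0 := ae_nonneg_of_Iio hF_nonneg
  have hmI : ∀ n, Measurable fun p : Measure ℝ => ∫⁻ x, idApprox n x ∂p := fun n =>
    Measure.measurable_lintegral (idApprox n).measurable
  have hmT : ∀ n, Measurable fun p : Measure ℝ =>
      (1 + ENNReal.ofReal lam * ∫⁻ x, idApprox n x ∂p) ^ (-τ) := fun n =>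
    (((hmI n).const_mul _).const_add _).pow_const _
  have hlim : Tendsto (fun n => ∫⁻ p, (1 + ENNReal.ofReal lam * ∫⁻ x, idApprox n x ∂p) ^ (-τ) ∂D)
      atTop (𝓝 (∫⁻ p, (1 + ENNReal.ofReal lam * ∫⁻ x, ENNReal.ofReal x ∂p) ^ (-τ) ∂D)) := by
    refine tendsto_lintegral_of_dominated_convergence (fun _ => 1) hmT (fun n => ?_) (by simp) ?_
    · refine ae_of_all _ fun p => ?_
      beta_reduce
      rw [ENNReal.rpow_neg, ENNReal.inv_le_one]
      exact ENNReal.one_le_rpow le_self_add hτ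
    · refine ae_of_all _ fun p => ?_
      refine (ENNReal.continuous_rpow_const.tendsto _).comp ?_
      refine Tendsto.const_add 1 ?_
      exact ENNReal.Tendsto.const_mul (tendsto_lintegral_idApprox p) (Or.inr ENNReal.ofReal_ne_top)
  have hval : ∀ n, ∫⁻ p, (1 + ENNReal.ofReal lam * ∫⁻ x, idApprox n x ∂p) ^ (-τ) ∂D =
      ENNReal.ofReal (Real.exp (-τ * ∫ x, Real.log (1 + lam * (idApprox n x).toReal) ∂F)) := by
    intro n
    rw [← hD.integral_simpleFunc hτ (idApprox n) (idApprox_lt_top n) hlam.le,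
      ofReal_integral_eq_lintegral_ofReal]
    · refine lintegral_congr_ae ?_
      filter_upwards [hD.ae_isProbabilityMeasure] with p hp
      have hfin : ∫⁻ x, idApprox n x ∂p ≠ ∞ := by
        rw [SimpleFunc.lintegral_eq_lintegral, SimpleFunc.lintegral]
        refine ENNReal.sum_ne_top.2 fun y hy => ?_
        obtain ⟨x, rfl⟩ := SimpleFunc.mem_range.1 hy
        exact ENNReal.mul_ne_top (idApprox_lt_top n x).ne (measure_ne_top p _)
      have h1 : 0 ≤ lam * (∫⁻ x, idApprox n x ∂p).toReal := by positivity
      rw [← ENNReal.ofReal_rpow_of_pos (by linarith), ENNReal.ofReal_add one_pos.le h1,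
        ENNReal.ofReal_mul hlam.le, ENNReal.ofReal_toReal hfin, ENNReal.ofReal_one]
    · refine Integrable.of_bound (((hmI n).ennreal_toReal.const_mul _).const_add
        _ |>.pow_const _).aestronglyMeasurable 1 (ae_of_all _ fun p => ?_)
      have h1 : 0 ≤ lam * (∫⁻ x, idApprox n x ∂p).toReal := by positivity
      rw [Real.norm_eq_abs, abs_of_nonneg (by positivity)]
      exact Real.rpow_le_one_of_one_le_of_nonpos (by linarith) (by linarith)
    · exact ae_of_all _ fun p => by positivity
  refine tendsto_nhds_unique hlim ?_
  simp_rw [hval]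
  refine (ENNReal.continuous_ofReal.tendsto _).comp ((Real.continuous_exp.tendsto _).comp ?_)
  exact (tendsto_integral_log_idApprox h0 hlam.le (hF_log lam hlam)).const_mul _

/-- The integrand of `lintegral_rpow` is at most the indicator of a finite mean, so that event has
probability at least `exp(-τ ψ_F(lam))`, which tends to `1` as `lam → 0`. -/
lemma IsDirichletProcessLaw.ae_lintegral_lt_top (hD : IsDirichletProcessLaw τ F D) :
    ∀ᵐ p ∂D, ∫⁻ x, ENNReal.ofReal x ∂p < ∞ := by
  have := hD.isProbabilityMeasure
  have h0 := ae_nonneg_of_Iio hF_nonneg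
  have hmI : Measurable fun p : Measure ℝ => ∫⁻ x, ENNReal.ofReal x ∂p :=
    Measure.measurable_lintegral ENNReal.measurable_ofReal
  let l : ℕ → ℝ := fun n => 1 / ((n : ℝ) + 1)
  have hl : ∀ n, 0 < l n := fun n => by positivity
  have hl1 : ∀ n, l n ≤ 1 := fun n => by
    simp only [l]; rw [div_le_one (by positivity)]; linarith [Nat.cast_nonneg (α := ℝ) n]
  have hl0 : Tendsto l atTop (𝓝 0) := tendsto_one_div_add_atTop_nhds_zero_nat
  have hs : MeasurableSet {p : Measure ℝ | ∫⁻ x, ENNReal.ofReal x ∂p < ∞} :=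
    measurableSet_lt hmI measurable_const
  have hle : ∀ n, ENNReal.ofReal (Real.exp (-τ * levyExponent F (l n))) ≤
      D {p : Measure ℝ | ∫⁻ x, ENNReal.ofReal x ∂p < ∞} := by
    intro n
    rw [← hD.lintegral_rpow hτ hF_nonneg hF_log (hl n), ← lintegral_indicator_one hs]
    refine lintegral_mono fun p => ?_
    by_cases hp : ∫⁻ x, ENNReal.ofReal x ∂p < ∞
    · rw [indicator_of_mem (by exact hp), ENNReal.rpow_neg, Pi.one_apply, ENNReal.inv_le_one]
      exact ENNReal.one_le_rpow le_self_add hτ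
    · rw [not_lt, top_le_iff] at hp
      rw [hp, ENNReal.mul_top (by simpa using hl n)]
      simp [ENNReal.top_rpow_of_neg, hτ]
  have hlim : Tendsto (fun n => ENNReal.ofReal (Real.exp (-τ * levyExponent F (l n)))) atTop
      (𝓝 1) := by
    have := (tendsto_levyExponent_zero h0 hF_log hl hl1 hl0).const_mul (-τ)
    have := (ENNReal.continuous_ofReal.tendsto _).comp ((Real.continuous_exp.tendsto _).comp this)
    simpa [Function.comp_def] using this
  have h1 : D {p : Measure ℝ | ∫⁻ x, ENNReal.ofReal x ∂p < ∞} = 1 :=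
    le_antisymm prob_le_one (le_of_tendsto' hlim hle)
  exact (prob_compl_eq_zero_iff hs).2 h1

lemma IsDirichletProcessLaw.ae_integrable (hD : IsDirichletProcessLaw τ F D) :
    ∀ᵐ p ∂D, Integrable (fun x => x) p := by
  filter_upwards [hD.ae_lintegral_lt_top hτ hF_nonneg hF_log,
    hD.ae_null hτ measurableSet_Iio hF_nonneg] with p h1 h2
  refine ⟨measurable_id.aestronglyMeasurable, ?_⟩
  refine lt_of_le_of_lt (lintegral_mono_ae ?_) h1
  filter_upwards [ae_nonneg_of_Iio h2] with x hx
  rw [Real.enorm_eq_ofReal hx]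

/-- The law of the mean of a Dirichlet process satisfies the Markov–Krein identity. -/
theorem IsDirichletProcessLaw.hasMarkovKrein (hD : IsDirichletProcessLaw τ F D) :
    HasMarkovKrein τ F (meanLaw D) := by
  have := hD.isProbabilityMeasure
  have hmI : Measurable fun p : Measure ℝ => (∫⁻ x, ENNReal.ofReal x ∂p).toReal :=
    (Measure.measurable_lintegral ENNReal.measurable_ofReal).ennreal_toReal
  have hmap : meanLaw D = D.map fun p => (∫⁻ x, ENNReal.ofReal x ∂p).toReal :=
    Measure.map_congr (hD.ae_integral_eq hτ hF_nonneg)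
  rw [hmap]
  refine ⟨Measure.isProbabilityMeasure_map hmI.aemeasurable, ?_, fun lam hlam => ?_⟩
  · rw [ae_map_iff hmI.aemeasurable measurableSet_Ici]
    exact ae_of_all _ fun p => ENNReal.toReal_nonneg
  · rw [integral_map hmI.aemeasurable (by refine Measurable.aestronglyMeasurable ?_; fun_prop),
      integral_eq_lintegral_of_nonneg_ae (ae_of_all _ fun p => by positivity)
      ((hmI.const_mul _).const_add _ |>.pow_const _).aestronglyMeasurable]
    rw [← ENNReal.toReal_ofReal (Real.exp_pos (-τ * levyExponent F lam)).le,
      ← hD.lintegral_rpow hτ hF_nonneg hF_log hlam]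
    congr 1
    refine lintegral_congr_ae ?_
    filter_upwards [hD.ae_lintegral_lt_top hτ hF_nonneg hF_log] with p hp
    have h1 : 0 ≤ lam * (∫⁻ x, ENNReal.ofReal x ∂p).toReal := by positivity
    rw [← ENNReal.ofReal_rpow_of_pos (by linarith), ENNReal.ofReal_add one_pos.le h1,
      ENNReal.ofReal_mul hlam.le, ENNReal.ofReal_toReal hp.ne, ENNReal.ofReal_one]

end DirichletProcess

/-! ### Existence of a law satisfying the Markov–Krein identity of order one -/

/-- The function `m ↦ (1 + l m)⁻¹` on `[0, ∞)`. -/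
def stieltjesTest (l : ℝ≥0) : ℝ≥0 →ᵇ ℝ :=
  BoundedContinuousFunction.ofNormedAddCommGroup (fun m => (1 + (l : ℝ) * m)⁻¹)
    (Continuous.inv₀ (by fun_prop) fun x => by positivity) 1 (fun x => by
      rw [Real.norm_eq_abs, abs_of_nonneg (by positivity)]
      exact inv_le_one_of_one_le₀ (by have : (0 : ℝ) ≤ (l : ℝ) * x := by positivity
                                      linarith))

lemma stieltjesTest_apply (l m : ℝ≥0) : stieltjesTest l m = (1 + (l : ℝ) * m)⁻¹ := rfl

lemma isProbabilityMeasure_dirichletLaw {n : ℕ} {a : Fin n → ℝ} (ha : ∀ i, 0 ≤ a i) :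
    IsProbabilityMeasure (dirichletLaw a) := by
  have : ∀ i, IsProbabilityMeasure (gammaLaw (a i)) := fun i =>
    isProbabilityMeasure_gammaLaw (ha i)
  exact Measure.isProbabilityMeasure_map (by fun_prop)

lemma ae_nonneg_dirichletLaw {n : ℕ} {a : Fin n → ℝ} (ha : ∀ i, 0 ≤ a i) :
    ∀ᵐ r ∂(dirichletLaw a), ∀ i, 0 ≤ r i := by
  have : ∀ i, IsProbabilityMeasure (gammaLaw (a i)) := fun i =>
    isProbabilityMeasure_gammaLaw (ha i)
  rw [dirichletLaw, ae_map_iff (by fun_prop) (by measurability)]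
  filter_upwards [ae_nonneg_pi _ fun i => ae_nonneg_gammaLaw (a i)] with x hx i
  exact div_nonneg (hx i) (Finset.sum_nonneg fun i _ => hx i)

section Existence

variable {F : Measure ℝ} [IsProbabilityMeasure F]

variable (F) in
-- The law is that of `∑ c i r i` for a Dirichlet vector `r` with parameters `F(B i)` on the level
-- sets `B i`. These sum to `1`, so the order is one; no Dirichlet process is needed.
lemma exists_markovKrein_simpleFunc (g : SimpleFunc ℝ ℝ≥0∞) (hg : ∀ x, g x < ∞) :
    ∃ ν : ProbabilityMeasure ℝ≥0, ∀ l : ℝ≥0, ∫ m, stieltjesTest l m ∂(ν : Measure ℝ≥0) =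
      Real.exp (-∫ x, Real.log (1 + (l : ℝ) * (g x).toReal) ∂F) := by
  obtain ⟨n, B, c, hB, hd, hU, hc, hgc, -⟩ := exists_partition_of_simpleFunc g hg
  have hs := sum_real_partition (F := F) hB hd hU
  have ha : ∀ i, 0 ≤ F.real (B i) := fun i => by positivity
  have := isProbabilityMeasure_dirichletLaw ha
  let Y : (Fin n → ℝ) → ℝ≥0 := fun r => (∑ i, c i * r i).toNNReal
  have hY : Measurable Y := by fun_prop
  refine ⟨⟨(dirichletLaw fun i => F.real (B i)).map Y,
    Measure.isProbabilityMeasure_map hY.aemeasurable⟩, fun l => ?_⟩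
  have h3 := integral_dirichletLaw ha hc (NNReal.coe_nonneg l)
  rw [hs] at h3
  rw [ProbabilityMeasure.coe_mk, integral_map hY.aemeasurable
    (stieltjesTest l).continuous.measurable.aestronglyMeasurable,
    integral_log_partition hB hd hU (c := fun i => Real.log (1 + (l : ℝ) * c i))
      (fun i x hx => by rw [hgc i x hx]), ← prod_rpow_eq_exp hc (NNReal.coe_nonneg l)]
  refine Eq.trans ?_ h3
  refine integral_congr_ae ?_
  filter_upwards [ae_nonneg_dirichletLaw ha] with r hr
  have : 0 ≤ ∑ i, c i * r i := Finset.sum_nonneg fun i _ => mul_nonneg (hc i) (hr i)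
  rw [stieltjesTest_apply, Real.coe_toNNReal _ this, Real.rpow_neg_one]

variable (hF_nonneg : F (Iio 0) = 0)
    (hF_log : ∀ lam : ℝ, 0 < lam → Integrable (fun x => Real.log (1 + lam * x)) F)

include hF_nonneg hF_log

/-- Prokhorov: the laws belonging to the simple approximations of the identity are tight, and `m ↦
(1 + l m)⁻¹` is bounded and continuous, so a weak limit point inherits the identity. -/
theorem exists_hasMarkovKrein_one : ∃ μ : Measure ℝ, HasMarkovKrein 1 F μ := by
  have h0 := ae_nonneg_of_Iio hF_nonneg
  choose ν hν using fun n => exists_markovKrein_simpleFunc F (idApprox n) (idApprox_lt_top n)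
  have htight : IsTightMeasureSet
      {((μ : ProbabilityMeasure ℝ≥0) : Measure ℝ≥0) | μ ∈ range ν} := by
    rw [isTightMeasureSet_iff_exists_isCompact_measure_compl_le]
    intro ε hε
    let l : ℕ → ℝ := fun n => 1 / ((n : ℝ) + 1)
    have hl : ∀ n, 0 < l n := fun n => by positivity
    have hl1 : ∀ n, l n ≤ 1 := fun n => by
      simp only [l]; rw [div_le_one (by positivity)]; linarith [Nat.cast_nonneg (α := ℝ) n]
    have hl0 : Tendsto l atTop (𝓝 0) := tendsto_one_div_add_atTop_nhds_zero_nat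
    have hlim : Tendsto (fun n => ENNReal.ofReal (2 * (1 - Real.exp (-levyExponent F (l n)))))
        atTop (𝓝 0) := by
      have h1 := (tendsto_levyExponent_zero h0 hF_log hl hl1 hl0).neg
      have h2 := ((Real.continuous_exp.tendsto _).comp h1).const_sub 1 |>.const_mul 2
      have := (ENNReal.continuous_ofReal.tendsto _).comp h2
      simpa [Function.comp_def] using this
    obtain ⟨N, hN⟩ := (hlim.eventually (ge_mem_nhds hε)).exists
    let lam : ℝ≥0 := ⟨l N, (hl N).le⟩
    -- Beyond `lam⁻¹` one has `1 - (1 + lam m)⁻¹ ≥ 1/2`; Markov's inequality at level `1/2` produces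
    -- the factor `2` in `hlim`.
    refine ⟨Icc 0 (lam⁻¹), isCompact_Icc, ?_⟩
    rintro _ ⟨_, ⟨n, rfl⟩, rfl⟩
    refine le_trans ?_ hN
    have hint : Integrable (fun m => 1 - stieltjesTest lam m) (ν n : Measure ℝ≥0) :=
      (integrable_const 1).sub ((stieltjesTest lam).integrable _)
    have hmk := mul_meas_ge_le_integral_of_nonneg (μ := (ν n : Measure ℝ≥0))
      (f := fun m => 1 - stieltjesTest lam m) (ae_of_all _ fun m => by
        have : (0 : ℝ) ≤ (lam : ℝ) * m := by positivity
        simp only [stieltjesTest_apply, Pi.zero_apply, sub_nonneg]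
        exact inv_le_one_of_one_le₀ (by linarith)) hint (1 / 2)
    have hsub : (Icc 0 (lam⁻¹))ᶜ ⊆ {m | (1 / 2 : ℝ) ≤ 1 - stieltjesTest lam m} := by
      intro m hm
      simp only [mem_compl_iff, mem_Icc, zero_le, true_and, not_le] at hm
      have hlp : 0 < lam := hl N
      have h1 : 1 < lam * m := by
        rwa [inv_lt_iff_one_lt_mul₀ hlp, mul_comm] at hm
      have h1' : (1 : ℝ) < (lam : ℝ) * m := by exact_mod_cast h1
      rw [mem_ofPred_eq, stieltjesTest_apply]
      have : (1 + (lam : ℝ) * m)⁻¹ ≤ 2⁻¹ := by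
        apply inv_anti₀ <;> linarith
      linarith
    have hval : ∫ m, (1 - stieltjesTest lam m) ∂(ν n : Measure ℝ≥0) ≤
        1 - Real.exp (-levyExponent F (l N)) := by
      rw [integral_sub (integrable_const 1) ((stieltjesTest lam).integrable _), hν n lam]
      simp only [integral_const, probReal_univ, smul_eq_mul, mul_one]
      gcongr
      exact integral_log_idApprox_le h0 (hl N).le (hF_log _ (hl N)) n
    have h3 : (ν n : Measure ℝ≥0).real (Icc 0 (lam⁻¹))ᶜ ≤
        2 * (1 - Real.exp (-levyExponent F (l N))) := by
      have := measureReal_mono hsub (measure_ne_top (ν n : Measure ℝ≥0) _)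
      linarith
    rw [← ENNReal.ofReal_toReal (measure_ne_top (ν n : Measure ℝ≥0) (Icc 0 (lam⁻¹))ᶜ)]
    exact ENNReal.ofReal_le_ofReal h3
  obtain ⟨μ, -, φ, hφ, hμ⟩ := (isCompact_closure_of_isTightMeasureSet htight).isSeqCompact
    (fun n => subset_closure (mem_range_self n))
  rw [ProbabilityMeasure.tendsto_iff_forall_integral_tendsto] at hμ
  have hcoe : Measurable (fun x : ℝ≥0 => (x : ℝ)) := by fun_prop
  refine ⟨(μ : Measure ℝ≥0).map (fun x : ℝ≥0 => (x : ℝ)),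
    Measure.isProbabilityMeasure_map hcoe.aemeasurable, ?_, fun lam hlam => ?_⟩
  · rw [ae_map_iff hcoe.aemeasurable measurableSet_Ici]
    exact ae_of_all _ fun x => x.2
  · rw [integral_map hcoe.aemeasurable (by refine Measurable.aestronglyMeasurable ?_; fun_prop)]
    let l : ℝ≥0 := ⟨lam, hlam.le⟩
    have h1 : Tendsto (fun n => ∫ m, stieltjesTest l m ∂((ν ∘ φ) n : Measure ℝ≥0)) atTop
        (𝓝 (Real.exp (-levyExponent F lam))) := by
      simp only [Function.comp_apply, hν]
      refine (Real.continuous_exp.tendsto _).comp (Tendsto.neg ?_)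
      exact (tendsto_integral_log_idApprox h0 hlam.le (hF_log lam hlam)).comp hφ.tendsto_atTop
    have h2 := tendsto_nhds_unique (hμ (stieltjesTest l)) h1
    rw [neg_one_mul, ← h2]
    refine integral_congr_ae (ae_of_all _ fun m => ?_)
    change (1 + lam * (m : ℝ)) ^ (-1 : ℝ) = _
    rw [stieltjesTest_apply, Real.rpow_neg_one]
    rfl

end Existence

/-! ### The Markov–Krein identity on the slit plane -/

/-- Nonnegative translations preserve the slit plane, and a small `‖w + x‖` would put the point `-x`
of the cut too close to `w₀`. The bound is uniform in `x`, which permits differentiation under the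
integral. -/
lemma exists_ball_slitPlane {w₀ : ℂ} (h : w₀ ∈ Complex.slitPlane) :
    ∃ δ > 0, ∀ w ∈ Metric.ball w₀ δ, ∀ x : ℝ, 0 ≤ x →
      w + x ∈ Complex.slitPlane ∧ δ ≤ ‖w + x‖ := by
  obtain ⟨r, hr, hsub⟩ := Metric.isOpen_iff.1 Complex.isOpen_slitPlane w₀ h
  refine ⟨r / 2, by positivity, fun w hw x hx => ⟨?_, ?_⟩⟩
  · have hw' : w ∈ Complex.slitPlane := hsub (Metric.ball_subset_ball (by linarith) hw)
    rw [Complex.mem_slitPlane_iff] at hw' ⊢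
    simp only [Complex.add_re, Complex.ofReal_re, Complex.add_im, Complex.ofReal_im, add_zero]
    exact hw'.imp (fun h => by linarith) id
  · by_contra hcon
    push Not at hcon
    have hmem : (-(x : ℂ)) ∈ Metric.ball w₀ r := by
      rw [Metric.mem_ball, dist_eq_norm] at hw ⊢
      calc ‖-(x : ℂ) - w₀‖ = ‖(w - w₀) - (w + x)‖ := by ring_nf
        _ ≤ ‖w - w₀‖ + ‖w + x‖ := norm_sub_le _ _
        _ < r := by linarith
    have := hsub hmem
    rw [Complex.mem_slitPlane_iff] at this
    simp only [Complex.neg_re, Complex.ofReal_re, Complex.neg_im, Complex.ofReal_im] at this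
    rcases this with h | h
    · linarith
    · simp at h

lemma differentiableOn_integral_inv {μ : Measure ℝ} [IsProbabilityMeasure μ]
    (h0 : ∀ᵐ x ∂μ, 0 ≤ x) :
    DifferentiableOn ℂ (fun w : ℂ => ∫ m : ℝ, (w + m)⁻¹ ∂μ) Complex.slitPlane := by
  intro w₀ hw₀
  obtain ⟨δ, hδ, hball⟩ := exists_ball_slitPlane hw₀
  refine DifferentiableAt.differentiableWithinAt ?_
  have hmeas : ∀ w : ℂ, AEStronglyMeasurable (fun m : ℝ => (w + m)⁻¹) μ := fun w => by
    refine Measurable.aestronglyMeasurable ?_; fun_prop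
  refine (hasDerivAt_integral_of_dominated_loc_of_deriv_le (Metric.ball_mem_nhds w₀ hδ)
    (F' := fun w m => -((w + m) ^ 2)⁻¹) (bound := fun _ => (δ ^ 2)⁻¹)
    (Eventually.of_forall hmeas) ?_ ?_ ?_ (integrable_const _) ?_).2.differentiableAt
  · refine Integrable.of_bound (hmeas w₀) δ⁻¹ ?_
    filter_upwards [h0] with x hx
    rw [norm_inv]
    exact inv_anti₀ hδ (hball w₀ (Metric.mem_ball_self hδ) x hx).2
  · refine Measurable.aestronglyMeasurable ?_; fun_prop
  · filter_upwards [h0] with x hx w hw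
    rw [norm_neg, norm_inv, norm_pow]
    exact inv_anti₀ (by positivity) (pow_le_pow_left₀ hδ.le (hball w hw x hx).2 2)
  · filter_upwards [h0] with x hx w hw
    have hne : w + (x : ℂ) ≠ 0 := Complex.slitPlane_ne_zero (hball w hw x hx).1
    have : HasDerivAt (fun w : ℂ => (w + (x : ℂ))⁻¹) (-1 / (w + x) ^ 2) w :=
      ((hasDerivAt_id w).add_const (x : ℂ)).inv hne
    exact this.congr_deriv (by rw [neg_div, one_div])

section LogTransform

variable {F : Measure ℝ} [IsProbabilityMeasure F] (h0 : ∀ᵐ x ∂F, 0 ≤ x)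
    (hF_log : ∀ lam : ℝ, 0 < lam → Integrable (fun x => Real.log (1 + lam * x)) F)

include h0 hF_log

lemma integrable_log_add {w₀ : ℂ} (hw₀ : w₀ ∈ Complex.slitPlane) :
    Integrable (fun x : ℝ => Complex.log (w₀ + x)) F := by
  obtain ⟨δ, hδ, hball⟩ := exists_ball_slitPlane hw₀
  have hmeas : AEStronglyMeasurable (fun x : ℝ => Complex.log (w₀ + x)) F := by
    refine Measurable.aestronglyMeasurable ?_; fun_prop
  have hb : Integrable (fun x : ℝ => (|Real.log δ| + Real.log (‖w₀‖ + 1) + Real.pi) +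
      Real.log (1 + 1 * x)) F := (integrable_const _).add (hF_log 1 one_pos)
  refine hb.mono' hmeas ?_
  filter_upwards [h0] with x hx
  have h1 : δ ≤ ‖w₀ + x‖ := (hball w₀ (Metric.mem_ball_self hδ) x hx).2
  have hn := norm_nonneg w₀
  have h2 : ‖w₀ + x‖ ≤ (‖w₀‖ + 1) * (1 + 1 * x) := by
    refine (norm_add_le _ _).trans ?_
    rw [Complex.norm_real, Real.norm_eq_abs, abs_of_nonneg hx]
    nlinarith
  have h3 := Real.log_le_log (hδ.trans_le h1) h2
  rw [Real.log_mul (by positivity) (by positivity)] at h3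
  have h4 := Real.log_le_log hδ h1
  have h5 : 0 ≤ Real.log (‖w₀‖ + 1) := Real.log_nonneg (by linarith)
  have h6 : 0 ≤ Real.log (1 + 1 * x) := Real.log_nonneg (by linarith)
  have h7 : |Real.log ‖w₀ + x‖| ≤ |Real.log δ| + Real.log (‖w₀‖ + 1) + Real.log (1 + 1 * x) := by
    have := neg_abs_le (Real.log δ)
    have := abs_nonneg (Real.log δ)
    rw [abs_le]
    constructor <;> linarith
  have h8 := Complex.abs_arg_le_pi (w₀ + x)
  have h9 := Complex.norm_le_abs_re_add_abs_im (Complex.log (w₀ + x))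
  rw [Complex.log_re, Complex.log_im] at h9
  linarith

lemma differentiableOn_integral_log :
    DifferentiableOn ℂ (fun w : ℂ => ∫ x : ℝ, Complex.log (w + x) ∂F) Complex.slitPlane := by
  intro w₀ hw₀
  obtain ⟨δ, hδ, hball⟩ := exists_ball_slitPlane hw₀
  refine DifferentiableAt.differentiableWithinAt ?_
  refine (hasDerivAt_integral_of_dominated_loc_of_deriv_le (Metric.ball_mem_nhds w₀ hδ)
    (F := fun (w : ℂ) (x : ℝ) => Complex.log (w + x))
    (F' := fun w x => (w + x)⁻¹) (bound := fun _ => δ⁻¹)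
    (Eventually.of_forall fun w => ?_) (integrable_log_add h0 hF_log hw₀) ?_ ?_
    (integrable_const _) ?_).2.differentiableAt
  · refine Measurable.aestronglyMeasurable ?_; fun_prop
  · refine Measurable.aestronglyMeasurable ?_; fun_prop
  · filter_upwards [h0] with x hx w hw
    rw [norm_inv]
    exact inv_anti₀ hδ (hball w hw x hx).2
  · filter_upwards [h0] with x hx w hw
    have := ((hasDerivAt_id w).add_const (x : ℂ)).clog (hball w hw x hx).1
    simpa using this

/-- The Markov–Krein identity of order one, continued to the slit plane. -/
theorem HasMarkovKrein.integral_inv_eq {μ : Measure ℝ} (h : HasMarkovKrein 1 F μ) {w : ℂ}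
    (hw : w ∈ Complex.slitPlane) :
    ∫ m : ℝ, (w + m)⁻¹ ∂μ = Complex.exp (-∫ x : ℝ, Complex.log (w + x) ∂F) := by
  have := h.isProbabilityMeasure
  -- On the positive axis this is the given identity at `lam = r⁻¹`; the factor `r⁻¹` extracted from
  -- the kernel matches `exp(-log r)`.
  have hreal : ∀ r : ℝ, 0 < r →
      ∫ m : ℝ, ((r : ℂ) + m)⁻¹ ∂μ = Complex.exp (-∫ x : ℝ, Complex.log ((r : ℂ) + x) ∂F) := by
    intro r hr
    have h1 : ∫ m : ℝ, ((r : ℂ) + m)⁻¹ ∂μ = ((∫ m : ℝ, (r + m)⁻¹ ∂μ : ℝ) : ℂ) := by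
      rw [← integral_complex_ofReal]
      push_cast
      rfl
    have h2 : ∫ x : ℝ, Complex.log ((r : ℂ) + x) ∂F =
        ((∫ x : ℝ, Real.log (r + x) ∂F : ℝ) : ℂ) := by
      rw [← integral_complex_ofReal]
      refine integral_congr_ae ?_
      filter_upwards [h0] with x hx
      rw [Complex.ofReal_log (by linarith)]
      push_cast
      rfl
    rw [h1, h2, ← Complex.ofReal_neg, ← Complex.ofReal_exp]
    congr 1
    have h3 : ∫ m : ℝ, (r + m)⁻¹ ∂μ = r⁻¹ * ∫ m : ℝ, (1 + r⁻¹ * m) ^ (-1 : ℝ) ∂μ := by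
      rw [← integral_const_mul]
      refine integral_congr_ae ?_
      filter_upwards [h.ae_nonneg] with m hm
      rw [Real.rpow_neg_one, ← mul_inv]
      congr 1
      field_simp
    have h4 : ∫ x : ℝ, Real.log (r + x) ∂F = Real.log r + levyExponent F r⁻¹ := by
      have : ∫ x : ℝ, Real.log (r + x) ∂F =
          ∫ x : ℝ, (Real.log r + Real.log (1 + r⁻¹ * x)) ∂F := by
        refine integral_congr_ae ?_
        filter_upwards [h0] with x hx
        have : 0 < 1 + r⁻¹ * x := by positivity
        rw [← Real.log_mul hr.ne' this.ne']
        congr 1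
        field_simp
      rw [this, integral_add (integrable_const _) (hF_log _ (by positivity))]
      simp [levyExponent]
    rw [h3, h4, h.integral_eq _ (by positivity), neg_add, Real.exp_add, Real.exp_neg (Real.log r),
      Real.exp_log hr, neg_one_mul]
  have hA : AnalyticOnNhd ℂ (fun w : ℂ => ∫ m : ℝ, (w + m)⁻¹ ∂μ) Complex.slitPlane :=
    (differentiableOn_integral_inv h.ae_nonneg).analyticOnNhd Complex.isOpen_slitPlane
  have hB : AnalyticOnNhd ℂ (fun w : ℂ => Complex.exp (-∫ x : ℝ, Complex.log (w + x) ∂F))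
      Complex.slitPlane :=
    ((differentiableOn_integral_log h0 hF_log).neg.cexp).analyticOnNhd Complex.isOpen_slitPlane
  have hpre : IsPreconnected Complex.slitPlane :=
    (Complex.starConvex_one_slitPlane.isPathConnected
      Complex.one_mem_slitPlane).isConnected.isPreconnected
  refine hA.eqOn_of_preconnected_of_frequently_eq hB hpre Complex.one_mem_slitPlane ?_ hw
  -- The identity theorem needs equality only along points accumulating at `1`; positive reals
  -- supply them.
  have hseq : Tendsto (fun n : ℕ => ((1 + 1 / ((n : ℝ) + 1) : ℝ) : ℂ)) atTop (𝓝[≠] 1) := by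
    rw [tendsto_nhdsWithin_iff]
    refine ⟨?_, Eventually.of_forall fun n => ?_⟩
    · have h1 : Tendsto (fun n : ℕ => 1 + 1 / ((n : ℝ) + 1)) atTop (𝓝 1) := by
        simpa using tendsto_one_div_add_atTop_nhds_zero_nat.const_add (1 : ℝ)
      have := (Complex.continuous_ofReal.tendsto 1).comp h1
      simpa [Function.comp_def] using this
    · rw [mem_compl_iff, mem_singleton_iff, ← Complex.ofReal_one, Complex.ofReal_inj]
      have : 0 < 1 / ((n : ℝ) + 1) := by positivity
      linarith
  exact hseq.frequently (Frequently.of_forall fun n => hreal _ (by positivity))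

end LogTransform

/-! ### Stieltjes inversion -/

/-- This is `π` times the Poisson kernel of the half-plane; approaching `-t` from below makes it
positive. -/
lemma im_inv_sub (t m : ℝ) (ε : ℝ) :
    ((-(t : ℂ) - ε * Complex.I + m)⁻¹).im = ε / ((t - m) ^ 2 + ε ^ 2) := by
  rw [Complex.inv_im, Complex.normSq_apply]
  simp
  ring

/-- The Poisson integrals of a finite measure converge weakly to it. -/
theorem tendsto_integral_poisson {μ : Measure ℝ} [IsFiniteMeasure μ] {φ : ℝ → ℝ}
    (hφ : Continuous φ) (hsupp : HasCompactSupport φ) {ε : ℕ → ℝ} (hε : ∀ n, 0 < ε n)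
    (hε0 : Tendsto ε atTop (𝓝 0)) :
    Tendsto (fun n => ∫ t, φ t * (Real.pi⁻¹ *
      (∫ m : ℝ, (-(t : ℂ) - ε n * Complex.I + m)⁻¹ ∂μ).im)) atTop (𝓝 (∫ m, φ m ∂μ)) := by
  obtain ⟨M, hM⟩ := hφ.bounded_above_of_compact_support hsupp
  let K : ℝ → ℝ := fun u => Real.pi⁻¹ * (1 + u ^ 2)⁻¹
  have hK : Integrable K := integrable_inv_one_add_sq.const_mul _
  have hK1 : ∫ u, K u = 1 := by
    simp only [K]
    rw [integral_const_mul, integral_univ_inv_one_add_sq, inv_mul_cancel₀ Real.pi_ne_zero]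
  have hKpos : ∀ u, 0 ≤ K u := fun u => by positivity
  -- Fubini and the substitution `t = m + ε u` average `φ` against the fixed Cauchy density `K`; two
  -- dominated limits then finish.
  have hform : ∀ n, ∫ t, φ t * (Real.pi⁻¹ *
      (∫ m : ℝ, (-(t : ℂ) - ε n * Complex.I + m)⁻¹ ∂μ).im) =
      ∫ m, (∫ u, φ (m + ε n * u) * K u) ∂μ := by
    intro n
    have hn := hε n
    have hint : ∀ t : ℝ, Integrable (fun m : ℝ => (-(t : ℂ) - ε n * Complex.I + m)⁻¹) μ := by
      intro t
      refine Integrable.of_bound (by refine Measurable.aestronglyMeasurable ?_; fun_prop)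
        (ε n)⁻¹ (ae_of_all _ fun m => ?_)
      rw [norm_inv]
      refine inv_anti₀ hn ?_
      have := Complex.abs_im_le_norm (-(t : ℂ) - ε n * Complex.I + m)
      simpa [abs_of_pos hn] using this
    have h1 : ∀ t : ℝ, (∫ m : ℝ, (-(t : ℂ) - ε n * Complex.I + m)⁻¹ ∂μ).im =
        ∫ m : ℝ, ε n / ((t - m) ^ 2 + ε n ^ 2) ∂μ := by
      intro t
      have := integral_im (𝕜 := ℂ) (hint t)
      simp only [RCLike.im_to_complex, im_inv_sub] at this
      exact this.symm
    have h2 : ∀ t : ℝ, φ t * (Real.pi⁻¹ *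
        (∫ m : ℝ, (-(t : ℂ) - ε n * Complex.I + m)⁻¹ ∂μ).im) =
        ∫ m : ℝ, φ t * (Real.pi⁻¹ * (ε n / ((t - m) ^ 2 + ε n ^ 2))) ∂μ := by
      intro t
      rw [h1, integral_const_mul, integral_const_mul]
    simp_rw [h2]
    rw [integral_integral_swap]
    · refine integral_congr_ae (ae_of_all _ fun m => ?_)
      let g : ℝ → ℝ := fun t => φ (m + t) * (Real.pi⁻¹ * (ε n / (t ^ 2 + ε n ^ 2)))
      have h3 : ∫ u, g (ε n * u) = |(ε n)⁻¹| • ∫ t, g t := Measure.integral_comp_mul_left g (ε n)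
      have h4 : ∫ t, φ t * (Real.pi⁻¹ * (ε n / ((t - m) ^ 2 + ε n ^ 2))) = ∫ t, g t := by
        rw [← integral_add_left_eq_self _ m]
        simp [g]
      have h5 : ∀ u, φ (m + ε n * u) * K u = ε n * g (ε n * u) := by
        intro u
        simp only [g, K]
        have : (ε n * u) ^ 2 + ε n ^ 2 = ε n ^ 2 * (1 + u ^ 2) := by ring
        rw [this]
        have : 1 + u ^ 2 ≠ 0 := by positivity
        field_simp
      simp_rw [h5, h4]
      rw [integral_const_mul, h3, abs_of_pos (inv_pos.2 hn), smul_eq_mul, ← mul_assoc,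
        mul_inv_cancel₀ hn.ne', one_mul]
    · have hφi : Integrable φ := hφ.integrable_of_hasCompactSupport hsupp
      have hb : Integrable (fun z : ℝ × ℝ => ‖φ z.1‖ * (Real.pi⁻¹ * (ε n)⁻¹)) (volume.prod μ) :=
        hφi.norm.mul_prod (integrable_const (Real.pi⁻¹ * (ε n)⁻¹))
      refine hb.mono' ?_ (ae_of_all _ fun z => ?_)
      · refine Measurable.aestronglyMeasurable ?_
        have := hφ.measurable
        simp only [Function.uncurry_def]
        fun_prop
      · simp only [Function.uncurry_def]
        rw [norm_mul]
        refine mul_le_mul_of_nonneg_left ?_ (norm_nonneg _)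
        rw [Real.norm_eq_abs, abs_of_nonneg (by positivity)]
        refine mul_le_mul_of_nonneg_left ?_ (by positivity)
        rw [div_le_iff₀ (by positivity), inv_mul_eq_div, le_div_iff₀ hn]
        nlinarith [sq_nonneg (z.1 - z.2)]
  simp_rw [hform]
  have hcont : ∀ n, Continuous fun z : ℝ × ℝ => φ (z.1 + ε n * z.2) * K z.2 := fun n => by
    refine (hφ.comp (by fun_prop)).mul ?_
    exact continuous_const.mul (Continuous.inv₀ (by fun_prop) fun z => by positivity)
  have hdom : ∀ n m u, ‖φ (m + ε n * u) * K u‖ ≤ M * K u := by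
    intro n m u
    rw [norm_mul, Real.norm_eq_abs (K u), abs_of_nonneg (hKpos u)]
    exact mul_le_mul_of_nonneg_right (hM _) (hKpos u)
  refine tendsto_integral_of_dominated_convergence (fun _ => M) (fun n => ?_) (integrable_const _)
    (fun n => ae_of_all _ fun m => ?_) (ae_of_all _ fun m => ?_)
  · exact (hcont n).stronglyMeasurable.integral_prod_right.aestronglyMeasurable
  · refine (norm_integral_le_of_norm_le (hK.const_mul M) (ae_of_all _ (hdom n m))).trans ?_
    rw [integral_const_mul, hK1, mul_one]
  · have h1 : Tendsto (fun n => ∫ u, φ (m + ε n * u) * K u) atTop (𝓝 (∫ u, φ m * K u)) := by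
      refine tendsto_integral_of_dominated_convergence (fun u => M * K u) (fun n => ?_)
        (hK.const_mul M) (fun n => ae_of_all _ (hdom n m)) (ae_of_all _ fun u => ?_)
      · exact ((hcont n).comp (by fun_prop : Continuous fun u : ℝ => (m, u))).aestronglyMeasurable
      · refine Tendsto.mul_const _ ((hφ.tendsto m).comp ?_)
        simpa using (hε0.mul_const u).const_add m
    rwa [integral_const_mul, hK1, mul_one] at h1

lemma tendsto_one_div_succ : Tendsto (fun n : ℕ => 1 / ((n : ℝ) + 1)) atTop (𝓝 0) :=
  tendsto_one_div_add_atTop_nhds_zero_nat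

lemma neg_sub_I_mem_slitPlane (t : ℝ) {ε : ℝ} (hε : 0 < ε) :
    (-(t : ℂ) - ε * Complex.I) ∈ Complex.slitPlane := by
  rw [Complex.mem_slitPlane_iff]
  right
  simpa using hε.ne'

/-- A law on `[0, ∞)` is determined by the Markov–Krein identity of order one. -/
theorem HasMarkovKrein.unique {F : Measure ℝ} [IsProbabilityMeasure F] (h0 : ∀ᵐ x ∂F, 0 ≤ x)
    (hF_log : ∀ lam : ℝ, 0 < lam → Integrable (fun x => Real.log (1 + lam * x)) F)
    {μ ν : Measure ℝ} (hμ : HasMarkovKrein 1 F μ) (hν : HasMarkovKrein 1 F ν) : μ = ν := by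
  have := hμ.isProbabilityMeasure
  have := hν.isProbabilityMeasure
  refine Measure.ext_of_integral_eq_on_compactlySupported fun φ => ?_
  have hε : ∀ n : ℕ, 0 < 1 / ((n : ℝ) + 1) := fun n => by positivity
  refine tendsto_nhds_unique
    (tendsto_integral_poisson (μ := μ) φ.continuous φ.hasCompactSupport hε tendsto_one_div_succ) ?_
  have h2 := tendsto_integral_poisson (μ := ν) φ.continuous φ.hasCompactSupport hε
    tendsto_one_div_succ
  -- Both Stieltjes transforms equal the same function off the real axis, so the Poisson integrals
  -- agree for every `ε`.
  refine h2.congr fun n => ?_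
  congr 1 with t
  have hmem := neg_sub_I_mem_slitPlane t (hε n)
  rw [hμ.integral_inv_eq h0 hF_log hmem, hν.integral_inv_eq h0 hF_log hmem]

/-! ### Integrability of the logarithmic kernel -/

/-- For `u ≠ 0` the integrand is `|u| ^ (-m)`, integrable at zero as `m < 1`. The exponential form
suits comparison with `exp(-Φ)`. -/
lemma integrableOn_exp_neg_mul_log {m : ℝ} (hm : m < 1) :
    IntegrableOn (fun u : ℝ => Real.exp (-m * Real.log |u|)) (Icc (-1) 1) := by
  have h1 : IntervalIntegrable (fun u : ℝ => Real.exp (-m * Real.log |u|)) volume 0 1 := by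
    refine (intervalIntegral.intervalIntegrable_rpow' (r := -m) (a := 0) (b := 1)
      (by linarith)).congr fun x hx => ?_
    rw [uIoc_of_le zero_le_one] at hx
    rw [abs_of_pos hx.1, Real.rpow_def_of_pos hx.1, mul_comm]
  have h2 : IntervalIntegrable (fun u : ℝ => Real.exp (-m * Real.log |u|)) volume (-1) 0 := by
    have := (IntervalIntegrable.iff_comp_neg (a := 0) (b := 1)).1 h1
    simp only [abs_neg, neg_zero] at this
    exact this.symm
  have h3 := h2.trans h1
  rwa [intervalIntegrable_iff_integrableOn_Icc_of_le (by norm_num)] at h3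

/-- Within distance one of `x` the kernel is a translate of an integrable function, and farther away
it is at most `1`; translation invariance makes the bound uniform in `x`. -/
lemma exists_lintegral_exp_neg_mul_log_le {m : ℝ} (hm0 : 0 ≤ m) (hm : m < 1) (R : ℝ) :
    ∃ K : ℝ≥0∞, K ≠ ∞ ∧ ∀ x : ℝ,
      ∫⁻ t in Icc (-R) R, ENNReal.ofReal (Real.exp (-m * Real.log |t - x|)) ≤ K := by
  let k : ℝ → ℝ≥0∞ := (Icc (-1) 1).indicator
    fun u => ENNReal.ofReal (Real.exp (-m * Real.log |u|))
  have hk : ∫⁻ u, k u ≠ ∞ := by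
    rw [lintegral_indicator measurableSet_Icc]
    exact (integrableOn_exp_neg_mul_log hm).lintegral_lt_top.ne
  have hkm : Measurable k := by
    refine Measurable.indicator ?_ measurableSet_Icc
    fun_prop
  refine ⟨(∫⁻ u, k u) + volume (Icc (-R) R), ENNReal.add_ne_top.2 ⟨hk, by simp⟩, fun x => ?_⟩
  have hle : ∀ t : ℝ, ENNReal.ofReal (Real.exp (-m * Real.log |t - x|)) ≤ k (t - x) + 1 := by
    intro t
    by_cases h : |t - x| ≤ 1
    · simp only [k]
      rw [indicator_of_mem (show t - x ∈ Icc (-1) 1 from abs_le.1 h)]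
      exact le_self_add
    · refine le_add_left ?_
      rw [ENNReal.ofReal_le_one, Real.exp_le_one_iff]
      have := Real.log_nonneg (not_le.1 h).le
      nlinarith
  calc ∫⁻ t in Icc (-R) R, ENNReal.ofReal (Real.exp (-m * Real.log |t - x|))
      ≤ ∫⁻ t in Icc (-R) R, (k (t - x) + 1) := lintegral_mono hle
    _ = (∫⁻ t in Icc (-R) R, k (t - x)) + volume (Icc (-R) R) := by
        rw [lintegral_add_right _ measurable_const]
        simp
    _ ≤ (∫⁻ t, k (t - x)) + volume (Icc (-R) R) := by
        gcongr
        exact Measure.restrict_le_self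
    _ = _ := by rw [lintegral_sub_right_eq_self k x]

lemma measurable_exp_neg_mul_log (m : ℝ) : Measurable fun z : ℝ × ℝ =>
    ENNReal.ofReal (Real.exp (-m * Real.log |z.1 - z.2|)) := by fun_prop

lemma lintegral_lintegral_exp_neg_mul_log_ne_top {F : Measure ℝ} [IsProbabilityMeasure F] {m : ℝ}
    (hm0 : 0 ≤ m) (hm : m < 1) (R : ℝ) :
    ∫⁻ t in Icc (-R) R, ∫⁻ x, ENNReal.ofReal (Real.exp (-m * Real.log |t - x|)) ∂F ≠ ∞ := by
  obtain ⟨K, hK, hle⟩ := exists_lintegral_exp_neg_mul_log_le hm0 hm R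
  rw [lintegral_lintegral_swap (measurable_exp_neg_mul_log m).aemeasurable]
  refine ne_top_of_le_ne_top (b := ∫⁻ _, K ∂F) ?_ (lintegral_mono hle)
  simpa using hK

lemma ae_lintegral_exp_neg_mul_log_ne_top {F : Measure ℝ} [IsProbabilityMeasure F] {m : ℝ}
    (hm0 : 0 ≤ m) (hm : m < 1) :
    ∀ᵐ t : ℝ, ∫⁻ x, ENNReal.ofReal (Real.exp (-m * Real.log |t - x|)) ∂F ≠ ∞ := by
  have h1 : ∀ n : ℕ, ∀ᵐ t : ℝ, t ∈ Icc (-(n : ℝ)) n →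
      ∫⁻ x, ENNReal.ofReal (Real.exp (-m * Real.log |t - x|)) ∂F ≠ ∞ := by
    intro n
    rw [← ae_restrict_iff' measurableSet_Icc]
    have := ae_lt_top' (measurable_exp_neg_mul_log m).lintegral_prod_right'.aemeasurable
      (lintegral_lintegral_exp_neg_mul_log_ne_top (F := F) hm0 hm n)
    filter_upwards [this] with t ht using ht.ne
  filter_upwards [ae_all_iff.2 h1] with t ht
  obtain ⟨n, hn⟩ := exists_nat_ge |t|
  exact ht n (abs_le.1 hn)

lemma integrable_exp_neg_mul_log_of_ne_top {F : Measure ℝ} {m t : ℝ}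
    (h : ∫⁻ x, ENNReal.ofReal (Real.exp (-m * Real.log |t - x|)) ∂F ≠ ∞) :
    Integrable (fun x => Real.exp (-m * Real.log |t - x|)) F := by
  refine ⟨by refine Measurable.aestronglyMeasurable ?_; fun_prop, ?_⟩
  rw [hasFiniteIntegral_iff_ofReal (ae_of_all _ fun x => (Real.exp_pos _).le)]
  exact h.lt_top

/-! ### The logarithmic potential and local integrability of its exponential. -/

section LogPotential

variable {F : Measure ℝ} [IsProbabilityMeasure F]

omit [IsProbabilityMeasure F] in
-- The convention `Real.log 0 = 0` makes the indicator redundant.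
lemma logPotential_eq (t : ℝ) : logPotential F t = ∫ x, Real.log |t - x| ∂F := by
  rw [logPotential]
  congr 1 with x
  by_cases h : x = t
  · simp [h]
  · rw [indicator_of_mem (by simpa using h)]

lemma measurable_logPotential : Measurable (logPotential F) := by
  have : logPotential F = fun t => ∫ x, Real.log |t - x| ∂F := funext logPotential_eq
  rw [this]
  have : Measurable fun z : ℝ × ℝ => Real.log |z.1 - z.2| := by fun_prop
  exact this.stronglyMeasurable.integral_prod_right'.measurable

/-- The negative part of the logarithm is at most `2 |t - x| ^ (-1/2)`, which is `F`-integrable for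
almost every `t`; the positive part is at most `log(1 + |t|) + log(1 + x)`. -/
lemma ae_integrable_log_abs_sub (h0 : ∀ᵐ x ∂F, 0 ≤ x)
    (hF_log : ∀ lam : ℝ, 0 < lam → Integrable (fun x => Real.log (1 + lam * x)) F) :
    ∀ᵐ t : ℝ, Integrable (fun x => Real.log |t - x|) F := by
  filter_upwards [ae_lintegral_exp_neg_mul_log_ne_top (F := F) (m := 1 / 2) (by norm_num)
    (by norm_num)] with t ht
  have h1 := integrable_exp_neg_mul_log_of_ne_top ht
  refine (((h1.const_mul 2).add (integrable_const (Real.log (1 + |t|)))).add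
    (hF_log 1 one_pos)).mono' (by refine Measurable.aestronglyMeasurable ?_; fun_prop) ?_
  filter_upwards [h0] with x hx
  simp only [Pi.add_apply]
  have ht0 := abs_nonneg t
  have h2 : 0 ≤ Real.log (1 + |t|) := Real.log_nonneg (by linarith)
  have h3 : 0 ≤ Real.log (1 + 1 * x) := Real.log_nonneg (by linarith)
  have h4 : Real.log |t - x| ≤ Real.log (1 + |t|) + Real.log (1 + 1 * x) := by
    rcases eq_or_ne (t - x) 0 with h | h
    · rw [h, abs_zero, Real.log_zero]; linarith
    · rw [← Real.log_mul (by positivity) (by positivity)]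
      refine Real.log_le_log (abs_pos.2 h) ?_
      have := abs_sub t x
      rw [abs_of_nonneg hx] at this
      nlinarith
  have h5 := Real.add_one_le_exp (-(1 / 2) * Real.log |t - x|)
  have h6 := Real.exp_pos (-(1 / 2) * Real.log |t - x|)
  rw [Real.norm_eq_abs, abs_le]
  constructor <;> linarith

/-- If `F` has no atom of mass one then `exp (-Φ_F)` is locally integrable. -/
theorem locallyIntegrable_exp_neg_logPotential (h0 : ∀ᵐ x ∂F, 0 ≤ x)
    (hF_log : ∀ lam : ℝ, 0 < lam → Integrable (fun x => Real.log (1 + lam * x)) F)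
    (hatom : ∀ x, F {x} < 1) : LocallyIntegrable (fun t => Real.exp (-logPotential F t)) := by
  intro t₀
  have hmeas : Measurable fun t => Real.exp (-logPotential F t) :=
    measurable_logPotential.neg.exp
  -- Outer regularity turns the atom condition into a ball around `t₀` of mass `p < 1`. The kernel
  -- `|t - x| ^ (-p)` is then locally integrable in `t`.
  obtain ⟨U, hU, hUo, hUF⟩ := Set.exists_isOpen_lt_of_lt {t₀} 1 (hatom t₀)
  obtain ⟨r, hr, hball⟩ := Metric.isOpen_iff.1 hUo t₀ (hU rfl)
  set δ := r / 2 with hδdef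
  have hδ : 0 < δ := by positivity
  set B := Metric.ball t₀ r with hB
  have hBm : MeasurableSet B := Metric.isOpen_ball.measurableSet
  set p := F.real B with hp
  have hp0 : 0 ≤ p := measureReal_nonneg
  have hp1 : p < 1 := by
    have : F B < 1 := (measure_mono hball).trans_lt hUF
    rw [hp, measureReal_def]
    have := (ENNReal.toReal_lt_toReal this.ne_top ENNReal.one_ne_top).2 this
    simpa using this
  refine ⟨Metric.ball t₀ δ, Metric.ball_mem_nhds t₀ hδ, ?_⟩
  set R := |t₀| + δ with hR
  have hsub : Metric.ball t₀ δ ⊆ Icc (-R) R := by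
    intro t ht
    rw [Metric.mem_ball, Real.dist_eq] at ht
    rw [mem_Icc, ← abs_le]
    have := abs_sub_abs_le_abs_sub t t₀
    linarith
  let J : ℝ → ℝ := fun t =>
    (∫⁻ x, ENNReal.ofReal (Real.exp (-p * Real.log |t - x|)) ∂F).toReal
  have hJ : IntegrableOn J (Metric.ball t₀ δ) := by
    refine IntegrableOn.mono_set ?_ hsub
    exact integrable_toReal_of_lintegral_ne_top
      (measurable_exp_neg_mul_log p).lintegral_prod_right'.aemeasurable
      (lintegral_lintegral_exp_neg_mul_log_ne_top (F := F) hp0 hp1 R)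
  have hbound : IntegrableOn (fun t => Real.exp |Real.log δ| * (1 + p⁻¹ * J t))
      (Metric.ball t₀ δ) :=
    (Integrable.add (integrableOn_const measure_ball_lt_top.ne) (hJ.const_mul p⁻¹)).const_mul _
  refine hbound.mono' hmeas.aestronglyMeasurable ?_
  rw [ae_restrict_iff' Metric.isOpen_ball.measurableSet]
  filter_upwards [ae_integrable_log_abs_sub h0 hF_log,
    ae_lintegral_exp_neg_mul_log_ne_top (F := F) hp0 hp1] with t hlog hker ht
  have hkint := integrable_exp_neg_mul_log_of_ne_top hker
  have hJt : J t = ∫ x, Real.exp (-p * Real.log |t - x|) ∂F := by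
    rw [integral_eq_lintegral_of_nonneg_ae (ae_of_all _ fun x => (Real.exp_pos _).le)
      hkint.aestronglyMeasurable]
  have hJ0 : 0 ≤ J t := ENNReal.toReal_nonneg
  rw [Metric.mem_ball, Real.dist_eq] at ht
  rw [Real.norm_eq_abs, abs_of_pos (Real.exp_pos _), logPotential_eq,
    ← integral_add_compl hBm hlog, neg_add, add_comm, Real.exp_add]
  -- Points outside `B` lie at distance at least `r - δ = δ` from `t`.
  have hout : Real.exp (-∫ x in Bᶜ, Real.log |t - x| ∂F) ≤ Real.exp |Real.log δ| := by
    refine Real.exp_le_exp.2 ?_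
    have h1 : ∫ x in Bᶜ, Real.log δ ∂F ≤ ∫ x in Bᶜ, Real.log |t - x| ∂F := by
      refine setIntegral_mono_on (integrableOn_const (measure_ne_top _ _)) hlog.integrableOn
        hBm.compl fun x hx => ?_
      refine Real.log_le_log hδ ?_
      rw [mem_compl_iff, hB, Metric.mem_ball, Real.dist_eq, not_lt] at hx
      have := abs_sub_le x t t₀
      rw [abs_sub_comm x t] at this
      linarith
    rw [setIntegral_const, smul_eq_mul] at h1
    have h2 : F.real Bᶜ ≤ 1 := measureReal_le_one
    have h3 : 0 ≤ F.real Bᶜ := measureReal_nonneg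
    have h4 := neg_abs_le (Real.log δ)
    have h5 := abs_nonneg (Real.log δ)
    nlinarith
  -- Jensen's inequality for the normalised restriction of `F` to `B`; the summand `1` covers `p =
  -- 0`.
  have hin : Real.exp (-∫ x in B, Real.log |t - x| ∂F) ≤ 1 + p⁻¹ * J t := by
    set c := -∫ x in B, Real.log |t - x| ∂F with hc
    rcases hp0.eq_or_lt with hp' | hp'
    · have : F B = 0 := by
        have := hp'.symm
        rwa [hp, measureReal_eq_zero_iff] at this
      have : c = 0 := by rw [hc, setIntegral_measure_zero _ this, neg_zero]
      rw [this, Real.exp_zero]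
      have : 0 ≤ p⁻¹ * J t := by positivity
      linarith
    -- Jensen through the tangent line of `exp` at `c`; its integral over `B` is exactly `p * exp
    -- c`.
    · have h1 : ∫ x in B, Real.exp c * (1 - c + -p * Real.log |t - x|) ∂F ≤
          ∫ x in B, Real.exp (-p * Real.log |t - x|) ∂F := by
        refine setIntegral_mono_on ?_ hkint.integrableOn hBm fun x _ => ?_
        · exact ((integrableOn_const (measure_ne_top _ _)).add
            (hlog.integrableOn.const_mul _)).const_mul _
        · have := Real.add_one_le_exp (-p * Real.log |t - x| - c)
          calc Real.exp c * (1 - c + -p * Real.log |t - x|)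
              ≤ Real.exp c * Real.exp (-p * Real.log |t - x| - c) := by
                refine mul_le_mul_of_nonneg_left ?_ (Real.exp_pos _).le
                linarith
            _ = _ := by rw [← Real.exp_add]; ring_nf
      have h2 : ∫ x in B, Real.exp c * (1 - c + -p * Real.log |t - x|) ∂F = Real.exp c * p := by
        rw [integral_const_mul, integral_add (integrable_const _)
          (hlog.integrableOn.const_mul _), setIntegral_const, integral_const_mul, smul_eq_mul]
        have : ∫ x in B, Real.log |t - x| ∂F = -c := by rw [hc, neg_neg]
        rw [this, ← hp]
        ring
      have h3 : ∫ x in B, Real.exp (-p * Real.log |t - x|) ∂F ≤ J t := by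
        rw [hJt]
        exact setIntegral_le_integral hkint (ae_of_all _ fun x => (Real.exp_pos _).le)
      rw [h2] at h1
      have h4 : Real.exp c ≤ p⁻¹ * J t := by
        rw [inv_mul_eq_div, le_div_iff₀ hp']
        linarith
      linarith
  exact mul_le_mul hout hin (Real.exp_pos _).le (Real.exp_pos _).le

end LogPotential

/-! ### The density of a law satisfying the Markov–Krein identity of order one -/

lemma ae_measure_singleton_eq_zero (F : Measure ℝ) [IsFiniteMeasure F] : ∀ᵐ t : ℝ, F {t} = 0 := by
  have hc : {t : ℝ | 0 < F {t}}.Countable := by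
    refine Measure.countable_meas_pos_of_disjoint_iUnion (μ := F)
      (fun t => measurableSet_singleton t) ?_
    intro s t hst
    simpa [Function.onFun] using hst
  have := hc.measure_zero volume
  filter_upwards [compl_mem_ae_iff.2 this] with t ht
  simpa [pos_iff_ne_zero] using ht

/-- The density `π⁻¹ sin (π F(t)) exp (-Φ_F(t))`. -/
def sineDensity (F : Measure ℝ) (t : ℝ) : ℝ :=
  Real.pi⁻¹ * (Real.sin (Real.pi * cdf F t) * Real.exp (-logPotential F t))

lemma sin_pi_mul_cdf_nonneg (F : Measure ℝ) (t : ℝ) : 0 ≤ Real.sin (Real.pi * cdf F t) := by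
  refine Real.sin_nonneg_of_nonneg_of_le_pi (mul_nonneg Real.pi_pos.le (cdf_nonneg F t)) ?_
  have := cdf_le_one F t
  nlinarith [Real.pi_pos]

lemma sineDensity_nonneg (F : Measure ℝ) (t : ℝ) : 0 ≤ sineDensity F t :=
  mul_nonneg (inv_nonneg.2 Real.pi_pos.le)
    (mul_nonneg (sin_pi_mul_cdf_nonneg F t) (Real.exp_pos _).le)

section Density

variable {F : Measure ℝ} [IsProbabilityMeasure F]

lemma measurable_sineDensity : Measurable (sineDensity F) := by
  have h1 : Measurable fun t => cdf F t := (monotone_cdf F).measurable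
  have h2 : Measurable (logPotential F) := measurable_logPotential
  unfold sineDensity
  fun_prop

omit [IsProbabilityMeasure F] in
lemma sineDensity_le (t : ℝ) : sineDensity F t ≤ Real.pi⁻¹ * Real.exp (-logPotential F t) := by
  refine mul_le_mul_of_nonneg_left ?_ (inv_nonneg.2 Real.pi_pos.le)
  exact mul_le_of_le_one_left (Real.exp_pos _).le (Real.sin_le_one _)

/-- The angular boundary function of `x ↦ log (x - t - i 0)`. -/
lemma tendsto_log_boundary {t x : ℝ} (hx : x ≠ t) {ε : ℕ → ℝ} (hε : ∀ n, 0 < ε n)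
    (hε0 : Tendsto ε atTop (𝓝 0)) :
    Tendsto (fun n => Complex.log (-(t : ℂ) - ε n * Complex.I + x)) atTop
      (𝓝 ((Real.log |t - x| : ℝ) - (Iio t).indicator (fun _ => (Real.pi : ℂ) * Complex.I) x)) := by
  have hlim : Tendsto (fun n => -(t : ℂ) - ε n * Complex.I + x) atTop (𝓝 ((x - t : ℝ) : ℂ)) := by
    have h1 : Tendsto (fun n => (ε n : ℂ)) atTop (𝓝 ((0 : ℝ) : ℂ)) :=
      (Complex.continuous_ofReal.tendsto 0).comp hε0
    have h2 := ((h1.mul_const Complex.I).const_sub (-(t : ℂ))).add_const (x : ℂ)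
    convert h2 using 2
    push_cast
    ring
  rcases lt_or_gt_of_ne hx with h | h
  · rw [indicator_of_mem (mem_Iio.2 h)]
    have h2 := Complex.tendsto_log_nhdsWithin_im_neg_of_re_neg_of_im_zero
      (z := ((x - t : ℝ) : ℂ)) (by rw [Complex.ofReal_re]; linarith) (Complex.ofReal_im _)
    rw [Complex.norm_real, Real.norm_eq_abs, abs_sub_comm] at h2
    refine h2.comp (tendsto_nhdsWithin_iff.2 ⟨hlim, Eventually.of_forall fun n => ?_⟩)
    simpa using hε n
  · rw [indicator_of_notMem (by simpa using h.le), sub_zero]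
    have hmem : ((x - t : ℝ) : ℂ) ∈ Complex.slitPlane :=
      Complex.ofReal_mem_slitPlane.2 (by linarith)
    have h2 := (continuousAt_clog hmem).tendsto.comp hlim
    rw [← Complex.ofReal_log (by linarith)] at h2
    rw [abs_sub_comm, abs_of_pos (by linarith : 0 < x - t)]
    exact h2

lemma abs_sub_le_norm (t x ε : ℝ) : |t - x| ≤ ‖-(t : ℂ) - ε * Complex.I + x‖ := by
  have := Complex.abs_re_le_norm (-(t : ℂ) - ε * Complex.I + x)
  simp only [Complex.add_re, Complex.sub_re, Complex.neg_re, Complex.ofReal_re, Complex.mul_re,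
    Complex.I_re, mul_zero, Complex.ofReal_im, Complex.I_im, mul_one, sub_self, sub_zero] at this
  rwa [show -t + x = -(t - x) by ring, abs_neg] at this

variable (h0 : ∀ᵐ x ∂F, 0 ≤ x)
    (hF_log : ∀ lam : ℝ, 0 < lam → Integrable (fun x => Real.log (1 + lam * x)) F)

omit [IsProbabilityMeasure F] in
lemma ae_ne_of_measure_singleton {t : ℝ} (ht : F {t} = 0) : ∀ᵐ x ∂F, x ≠ t := by
  rw [ae_iff]
  simpa using ht

include h0 hF_log

/-- From below the cut, `log(x - t - i0)` is `log |t - x|` minus `iπ` when `x < t`. The absence of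
an atom at `t` lets `F(Iio t)` be replaced by the distribution function. -/
lemma tendsto_integral_log_boundary {t : ℝ} (ht : F {t} = 0)
    (hlog : Integrable (fun x => Real.log |t - x|) F) {ε : ℕ → ℝ} (hε : ∀ n, 0 < ε n)
    (hε1 : ∀ n, ε n ≤ 1) (hε0 : Tendsto ε atTop (𝓝 0)) :
    Tendsto (fun n => ∫ x : ℝ, Complex.log (-(t : ℂ) - ε n * Complex.I + x) ∂F) atTop
      (𝓝 ((logPotential F t : ℂ) - Real.pi * cdf F t * Complex.I)) := by
  have hval : ∫ x, (((Real.log |t - x| : ℝ) : ℂ) -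
      (Iio t).indicator (fun _ => (Real.pi : ℂ) * Complex.I) x) ∂F =
      (logPotential F t : ℂ) - Real.pi * cdf F t * Complex.I := by
    rw [integral_sub hlog.ofReal ((integrable_const _).indicator measurableSet_Iio),
      integral_complex_ofReal, ← logPotential_eq, integral_indicator measurableSet_Iio,
      setIntegral_const, cdf_eq_real]
    have : F.real (Iio t) = F.real (Iic t) := by
      rw [measureReal_def, measureReal_def, ← Iio_union_right,
        measure_union (by simp) (measurableSet_singleton t), ht, add_zero]
    rw [this, Complex.real_smul]
    ring
  rw [← hval]
  refine tendsto_integral_of_dominated_convergence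
    (fun x => |(Real.log |t - x|)| + (Real.log (|t| + 2) + Real.pi) + Real.log (1 + 1 * x))
    (fun n => by refine Measurable.aestronglyMeasurable ?_; fun_prop)
    ((hlog.abs.add (integrable_const _)).add (hF_log 1 one_pos)) (fun n => ?_) ?_
  · filter_upwards [h0, ae_ne_of_measure_singleton ht] with x hx hxt
    set z : ℂ := -(t : ℂ) - ε n * Complex.I + x with hz
    have h1 : |t - x| ≤ ‖z‖ := abs_sub_le_norm t x (ε n)
    have h1' : 0 < |t - x| := abs_pos.2 (sub_ne_zero.2 hxt.symm)
    have ht0 := abs_nonneg t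
    have h2 : ‖z‖ ≤ (|t| + 2) * (1 + 1 * x) := by
      have h3 : ‖z‖ ≤ |t| + ε n + x := by
        refine (norm_add_le _ _).trans ?_
        rw [Complex.norm_real, Real.norm_eq_abs, abs_of_nonneg hx]
        gcongr
        refine (norm_sub_le _ _).trans ?_
        simp [abs_of_pos (hε n)]
      have := hε1 n
      nlinarith
    have h3 := Real.log_le_log (h1'.trans_le h1) h2
    rw [Real.log_mul (by positivity) (by positivity)] at h3
    have h4 := Real.log_le_log h1' h1
    have h5 : 0 ≤ Real.log (|t| + 2) := Real.log_nonneg (by linarith)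
    have h6 : 0 ≤ Real.log (1 + 1 * x) := Real.log_nonneg (by linarith)
    have h7 : |Real.log ‖z‖| ≤ |(Real.log |t - x|)| + Real.log (|t| + 2) + Real.log (1 + 1 * x) := by
      have := neg_abs_le (Real.log |t - x|)
      have := abs_nonneg (Real.log |t - x|)
      rw [abs_le]
      constructor <;> linarith
    have h8 := Complex.abs_arg_le_pi z
    have h9 := Complex.norm_le_abs_re_add_abs_im (Complex.log z)
    rw [Complex.log_re, Complex.log_im] at h9
    linarith
  · filter_upwards [ae_ne_of_measure_singleton ht] with x hxt
    exact tendsto_log_boundary hxt hε hε0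

/-- Leaving the real axis only increases the modulus inside the logarithm. This bound, uniform in
`ε`, dominates the limit in the inversion. -/
lemma norm_exp_neg_integral_log_le {t : ℝ} (ht : F {t} = 0)
    (hlog : Integrable (fun x => Real.log |t - x|) F) {ε : ℝ} (hε : 0 < ε) :
    ‖Complex.exp (-∫ x : ℝ, Complex.log (-(t : ℂ) - ε * Complex.I + x) ∂F)‖ ≤
      Real.exp (-logPotential F t) := by
  have hint := integrable_log_add h0 hF_log (neg_sub_I_mem_slitPlane t hε)
  rw [Complex.norm_exp, Complex.neg_re, Real.exp_le_exp, neg_le_neg_iff, logPotential_eq]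
  have h1 := integral_re (𝕜 := ℂ) hint
  simp only [RCLike.re_to_complex] at h1
  rw [← h1]
  refine integral_mono_ae hlog hint.re ?_
  filter_upwards [ae_ne_of_measure_singleton ht] with x hxt
  simp only [Complex.log_re]
  exact Real.log_le_log (abs_pos.2 (sub_ne_zero.2 hxt.symm)) (abs_sub_le_norm t x ε)

/-- A law that satisfies the Markov–Krein identity of order one for a law `F` with no atom of
mass one has the density `π⁻¹ sin (π F(t)) exp (-Φ_F(t))`. -/
theorem HasMarkovKrein.eq_withDensity_sineDensity (hatom : ∀ x, F {x} < 1) {μ : Measure ℝ}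
    (hμ : HasMarkovKrein 1 F μ) :
    μ = volume.withDensity fun t => ENNReal.ofReal (sineDensity F t) := by
  have := hμ.isProbabilityMeasure
  have hloc := locallyIntegrable_exp_neg_logPotential h0 hF_log hatom
  have hlocs : LocallyIntegrable (sineDensity F) := by
    refine (hloc.smul (Real.pi⁻¹)).mono measurable_sineDensity.aestronglyMeasurable
      (ae_of_all _ fun t => ?_)
    rw [Real.norm_eq_abs, abs_of_nonneg (sineDensity_nonneg F t)]
    refine (sineDensity_le t).trans ?_
    rw [Pi.smul_apply, smul_eq_mul]
    exact le_abs_self _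
  have hdm : Measurable fun t => ENNReal.ofReal (sineDensity F t) :=
    measurable_sineDensity.ennreal_ofReal
  -- Test functions of compact support identify the candidate only if it is locally finite; local
  -- integrability of `exp(-Φ)` provides this.
  have : IsLocallyFiniteMeasure
      (volume.withDensity fun t => ENNReal.ofReal (sineDensity F t)) := by
    refine ⟨fun t => ?_⟩
    obtain ⟨s, hs, hsi⟩ := hlocs t
    obtain ⟨u, hus, huo, htu⟩ := mem_nhds_iff.1 hs
    refine ⟨u, huo.mem_nhds htu, ?_⟩
    rw [withDensity_apply _ huo.measurableSet]
    exact (hsi.mono_set hus).lintegral_lt_top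
  refine Measure.ext_of_integral_eq_on_compactlySupported fun φ => ?_
  have hε : ∀ n : ℕ, 0 < 1 / ((n : ℝ) + 1) := fun n => by positivity
  have hε1 : ∀ n : ℕ, 1 / ((n : ℝ) + 1) ≤ 1 := fun n => by
    rw [div_le_one (by positivity)]; linarith [Nat.cast_nonneg (α := ℝ) n]
  have hlim := tendsto_integral_poisson (μ := μ) φ.continuous φ.hasCompactSupport hε
    tendsto_one_div_succ
  refine tendsto_nhds_unique hlim ?_
  rw [integral_withDensity_eq_integral_toReal_smul hdm (ae_of_all _ fun _ => by simp)]
  refine tendsto_integral_of_dominated_convergence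
    (fun t => ‖φ t‖ * (Real.pi⁻¹ * Real.exp (-logPotential F t))) (fun n => ?_) ?_ (fun n => ?_) ?_
  · refine Measurable.aestronglyMeasurable ?_
    refine φ.continuous.measurable.mul (Measurable.const_mul ?_ _)
    refine Complex.measurable_im.comp ?_
    have : Measurable fun z : ℝ × ℝ =>
        (-(z.1 : ℂ) - (1 / ((n : ℝ) + 1) : ℝ) * Complex.I + z.2)⁻¹ := by fun_prop
    exact this.stronglyMeasurable.integral_prod_right'.measurable
  · have h1 := (hloc.smul (Real.pi⁻¹)).integrable_smul_left_of_hasCompactSupport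
      (g := fun t => ‖φ t‖) φ.continuous.norm φ.hasCompactSupport.norm
    simpa only [smul_eq_mul, Pi.smul_apply] using h1
  · filter_upwards [ae_integrable_log_abs_sub h0 hF_log, ae_measure_singleton_eq_zero F]
      with t hlog ht
    rw [norm_mul, norm_mul]
    refine mul_le_mul_of_nonneg_left ?_ (norm_nonneg _)
    rw [Real.norm_eq_abs, abs_of_pos (inv_pos.2 Real.pi_pos)]
    refine mul_le_mul_of_nonneg_left ?_ (inv_nonneg.2 Real.pi_pos.le)
    rw [hμ.integral_inv_eq h0 hF_log (neg_sub_I_mem_slitPlane t (hε n)), Real.norm_eq_abs]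
    exact (Complex.abs_im_le_norm _).trans (norm_exp_neg_integral_log_le h0 hF_log ht hlog (hε n))
  · filter_upwards [ae_integrable_log_abs_sub h0 hF_log, ae_measure_singleton_eq_zero F]
      with t hlog ht
    have h1 := tendsto_integral_log_boundary h0 hF_log ht hlog hε hε1 tendsto_one_div_succ
    have h2 := (Complex.continuous_im.tendsto _).comp
      ((Complex.continuous_exp.tendsto _).comp h1.neg)
    -- The sine is the imaginary part of the boundary value `exp(-Φ + iπF)`.
    have h3 : (Complex.exp (-((logPotential F t : ℂ) - Real.pi * cdf F t * Complex.I))).im =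
        Real.sin (Real.pi * cdf F t) * Real.exp (-logPotential F t) := by
      rw [Complex.exp_im]
      simp [mul_comm]
    rw [h3] at h2
    rw [ENNReal.toReal_ofReal (sineDensity_nonneg F t), smul_eq_mul, mul_comm]
    refine Tendsto.const_mul _ (Tendsto.const_mul _ (h2.congr fun n => ?_))
    rw [hμ.integral_inv_eq h0 hF_log (neg_sub_I_mem_slitPlane t (hε n))]
    rfl

end Density

/-! ### The random measure of a subordinator -/

lemma clamp_mem_Icc {T : ℝ} (hT : 0 ≤ T) (t : ℝ) : max 0 (min t T) ∈ Icc 0 T :=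
  ⟨le_max_left _ _, max_le hT (min_le_right _ _)⟩

lemma clampExtend_of_mem {T t : ℝ} (ht : t ∈ Icc 0 T) (f : ℝ → ℝ) : clampExtend T f t = f t := by
  rw [clampExtend, min_eq_left ht.2, max_eq_right ht.1]

lemma monotone_clampExtend {T : ℝ} (hT : 0 ≤ T) {f : ℝ → ℝ} (hf : MonotoneOn f (Icc 0 T)) :
    Monotone (clampExtend T f) := fun _ _ h =>
  hf (clamp_mem_Icc hT _) (clamp_mem_Icc hT _) (max_le_max le_rfl (min_le_min h le_rfl))

lemma continuousWithinAt_clampExtend {T : ℝ} (hT : 0 ≤ T) {f : ℝ → ℝ}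
    (hf : ∀ t ∈ Icc 0 T, ContinuousWithinAt f (Icc t T) t) (x : ℝ) :
    ContinuousWithinAt (clampExtend T f) (Ici x) x := by
  have hc : ContinuousWithinAt (fun t : ℝ => max 0 (min t T)) (Ici x) x :=
    (by fun_prop : Continuous fun t : ℝ => max 0 (min t T)).continuousWithinAt
  refine ContinuousWithinAt.comp (f := fun t : ℝ => max 0 (min t T)) (g := f)
    (t := Icc (max 0 (min x T)) T) (hf _ (clamp_mem_Icc hT x)) hc fun y hy => ?_
  exact ⟨max_le_max le_rfl (min_le_min hy le_rfl), (clamp_mem_Icc hT y).2⟩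

/-- The Lebesgue–Stieltjes measure of a nondecreasing right-continuous function on `[0, T]`. -/
lemma stieltjesOn_properties {T : ℝ} (hT : 0 ≤ T) {f : ℝ → ℝ} (hf : MonotoneOn f (Icc 0 T))
    (hr : ∀ t ∈ Icc 0 T, ContinuousWithinAt f (Icc t T) t) :
    (∀ a b, stieltjesOn T f (Ioc a b) = ENNReal.ofReal (clampExtend T f b - clampExtend T f a)) ∧
      stieltjesOn T f univ = ENNReal.ofReal (f T - f 0) := by
  have h : Monotone (clampExtend T f) ∧
      ∀ x, ContinuousWithinAt (clampExtend T f) (Ici x) x :=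
    ⟨monotone_clampExtend hT hf, continuousWithinAt_clampExtend hT hr⟩
  rw [stieltjesOn, dif_pos h]
  refine ⟨fun a b => StieltjesFunction.measure_Ioc _ a b, ?_⟩
  refine StieltjesFunction.measure_univ _ ?_ ?_
  · refine tendsto_const_nhds.congr' ?_
    filter_upwards [eventually_le_atBot 0] with x hx
    rw [clampExtend, max_eq_left ((min_le_left _ _).trans hx)]
  · refine tendsto_const_nhds.congr' ?_
    filter_upwards [eventually_ge_atTop T] with x hx
    rw [clampExtend, min_eq_right hx, max_eq_right hT]

section Subordinator

variable {Ω : Type*} [MeasurableSpace Ω] {P : Measure Ω} {T θ : ℝ} {F : Measure ℝ}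
  {ζ : ℝ → Ω → ℝ}

/-- `κ` is a measurable version of the random Lebesgue–Stieltjes measure of `ζ` on `[0, T]`. -/
structure IsStieltjesVersion (P : Measure Ω) (T : ℝ) (ζ : ℝ → Ω → ℝ) (κ : Ω → Measure ℝ) :
    Prop where
  measurable : Measurable κ
  isFiniteMeasure : ∀ ω, IsFiniteMeasure (κ ω)
  eq : ∀ᵐ ω ∂P, κ ω = stieltjesOn T fun t => ζ t ω
  apply_Ioc : ∀ᵐ ω ∂P, ∀ a ∈ Icc 0 T, ∀ b ∈ Icc 0 T, a ≤ b →
    (κ ω).real (Ioc a b) = ζ b ω - ζ a ω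
  compl : ∀ᵐ ω ∂P, κ ω (Ioc 0 T)ᶜ = 0

/-- The set of irregular paths need not be measurable, so the measure is set to zero on a measurable
null set `N` containing it. Measurability then follows from the π-system of half-open intervals. -/
lemma IsGGCSubordinator.exists_version (hT : 0 ≤ T) (hζ : IsGGCSubordinator P T θ F ζ) :
    ∃ κ, IsStieltjesVersion P T ζ κ := by
  classical
  let G : Set Ω := {ω | MonotoneOn (fun t => ζ t ω) (Icc 0 T) ∧
    ∀ t ∈ Icc 0 T, ContinuousWithinAt (fun t => ζ t ω) (Icc t T) t}
  have hG : ∀ᵐ ω ∂P, ω ∈ G := by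
    filter_upwards [hζ.monotone, hζ.rightContinuous] with ω h1 h2 using ⟨h1, h2⟩
  let N := toMeasurable P Gᶜ
  have hNm : MeasurableSet N := measurableSet_toMeasurable _ _
  have hN0 : P N = 0 := by
    rw [measure_toMeasurable]
    exact hG
  have hNG : ∀ ω, ω ∉ N → ω ∈ G := fun ω hω => by
    by_contra hcon
    exact hω (subset_toMeasurable P Gᶜ hcon)
  have hNae : ∀ᵐ ω ∂P, ω ∉ N := compl_mem_ae_iff.2 hN0
  let κ : Ω → Measure ℝ := fun ω => if ω ∈ N then 0 else stieltjesOn T fun t => ζ t ω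
  have hκ : ∀ ω, ω ∉ N → κ ω = stieltjesOn T fun t => ζ t ω := fun ω hω => if_neg hω
  have hprop := fun ω (hω : ω ∉ N) => stieltjesOn_properties hT (hNG ω hω).1 (hNG ω hω).2
  have hfin : ∀ ω, IsFiniteMeasure (κ ω) := by
    intro ω
    by_cases hω : ω ∈ N
    · simp only [κ, if_pos hω]
      infer_instance
    · refine ⟨?_⟩
      rw [hκ ω hω, (hprop ω hω).2]
      exact ENNReal.ofReal_lt_top
  have hcl : ∀ t, Measurable fun ω => clampExtend T (fun t => ζ t ω) t := fun t =>
    hζ.measurable _ (clamp_mem_Icc hT t)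
  refine ⟨κ, ?_, hfin, ?_, ?_, ?_⟩
  · refine Measurable.measure_of_isPiSystem
      (S := {S : Set ℝ | ∃ l ∈ (univ : Set ℝ), ∃ u ∈ (univ : Set ℝ), l < u ∧ Ioc l u = S})
      ?_ (isPiSystem_Ioc_mem _ _) ?_ ?_
    · rw [BorelSpace.measurable_eq (α := ℝ)]
      exact dense_univ.borel_eq_generateFrom_Ioc_mem
    · rintro _ ⟨a, -, b, -, -, rfl⟩
      have : (fun ω => κ ω (Ioc a b)) = fun ω => if ω ∈ N then 0 else
          ENNReal.ofReal (clampExtend T (fun t => ζ t ω) b - clampExtend T (fun t => ζ t ω) a) := by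
        ext ω
        by_cases hω : ω ∈ N
        · simp [κ, hω]
        · rw [hκ ω hω, (hprop ω hω).1, if_neg hω]
      rw [this]
      exact Measurable.ite hNm measurable_const ((hcl b).sub (hcl a)).ennreal_ofReal
    · have : (fun ω => κ ω univ) = fun ω => if ω ∈ N then 0 else
          ENNReal.ofReal (ζ T ω - ζ 0 ω) := by
        ext ω
        by_cases hω : ω ∈ N
        · simp [κ, hω]
        · rw [hκ ω hω, (hprop ω hω).2, if_neg hω]
      rw [this]
      exact Measurable.ite hNm measurable_const ((hζ.measurable T ⟨hT, le_rfl⟩).sub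
        (hζ.measurable 0 ⟨le_rfl, hT⟩)).ennreal_ofReal
  · filter_upwards [hNae] with ω hω using hκ ω hω
  · filter_upwards [hNae] with ω hω a ha b hb hab
    rw [measureReal_def, hκ ω hω, (hprop ω hω).1, clampExtend_of_mem ha, clampExtend_of_mem hb,
      ENNReal.toReal_ofReal (sub_nonneg.2 ((hNG ω hω).1 ha hb hab))]
  -- The total mass `ζ T - ζ 0` is already carried by `(0, T]`.
  · filter_upwards [hNae] with ω hω
    have := hfin ω
    rw [measure_compl measurableSet_Ioc (measure_ne_top _ _), hκ ω hω, (hprop ω hω).1,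
      (hprop ω hω).2, clampExtend_of_mem ⟨le_rfl, hT⟩, clampExtend_of_mem ⟨hT, le_rfl⟩,
      tsub_self]

/-! ### Continuity of the Laplace exponent -/

lemma tendsto_levyExponent (h0 : ∀ᵐ x ∂F, 0 ≤ x)
    (hF_log : ∀ lam : ℝ, 0 < lam → Integrable (fun x => Real.log (1 + lam * x)) F) {M : ℝ}
    {l : ℕ → ℝ} (hl : ∀ n, 0 ≤ l n) (hlM : ∀ n, l n ≤ M) {c : ℝ} (hc : 0 ≤ c)
    (hlc : Tendsto l atTop (𝓝 c)) :
    Tendsto (fun n => levyExponent F (l n)) atTop (𝓝 (levyExponent F c)) := by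
  have hM : 0 < max M 1 := by positivity
  refine tendsto_integral_of_dominated_convergence (fun x => Real.log (1 + max M 1 * x))
    (fun n => by refine Measurable.aestronglyMeasurable ?_; fun_prop) (hF_log _ hM) (fun n => ?_) ?_
  · filter_upwards [h0] with x hx
    have h1 := mul_nonneg (hl n) hx
    rw [Real.norm_eq_abs, abs_of_nonneg (Real.log_nonneg (by linarith))]
    refine Real.log_le_log (by linarith) ?_
    have := mul_le_mul_of_nonneg_right ((hlM n).trans (le_max_left M 1)) hx
    linarith
  · filter_upwards [h0] with x hx
    refine (Real.continuousAt_log ?_).tendsto.comp ((hlc.mul_const x).const_add 1)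
    have := mul_nonneg hc hx
    linarith

lemma levyExponent_mono (h0 : ∀ᵐ x ∂F, 0 ≤ x)
    (hF_log : ∀ lam : ℝ, 0 < lam → Integrable (fun x => Real.log (1 + lam * x)) F) {a b : ℝ}
    (ha : 0 ≤ a) (hb : 0 < b) (hab : a ≤ b) : levyExponent F a ≤ levyExponent F b := by
  refine integral_mono_of_nonneg ?_ (hF_log b hb) ?_
  · filter_upwards [h0] with x hx
    exact Real.log_nonneg (by have := mul_nonneg ha hx; linarith)
  · filter_upwards [h0] with x hx
    refine Real.log_le_log (by have := mul_nonneg ha hx; linarith) ?_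
    have := mul_le_mul_of_nonneg_right hab hx
    linarith

@[simp] lemma levyExponent_zero : levyExponent F 0 = 0 := by simp [levyExponent]

lemma measurable_levyExponent [SFinite F] : Measurable (levyExponent F) := by
  have : Measurable fun z : ℝ × ℝ => Real.log (1 + z.1 * z.2) := by fun_prop
  exact this.stronglyMeasurable.integral_prod_right'.measurable

/-! ### Step functions -/

/-- The right end point of the interval of the partition of `(0, T]` into `n` equal intervals
that contains `s`. -/
def gridRight (T : ℝ) (n : ℕ) (s : ℝ) : ℝ := T * ⌈n * s / T⌉₊ / n

lemma abs_gridRight_sub_le (hT : 0 < T) {n : ℕ} (hn : 0 < n) {s : ℝ} (hs : 0 ≤ s) :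
    |gridRight T n s - s| ≤ T / n := by
  have hn' : (0 : ℝ) < n := by exact_mod_cast hn
  have h1 := Nat.le_ceil (n * s / T)
  have h2 := Nat.ceil_lt_add_one (a := n * s / T) (by positivity)
  have h3 : s = T * (n * s / T) / n := by field_simp
  have h4 : gridRight T n s - s = T / n * (⌈n * s / T⌉₊ - n * s / T) := by
    rw [gridRight]
    field_simp
  rw [h4, abs_mul, abs_of_pos (by positivity : 0 < T / n), abs_of_nonneg (by linarith)]
  have : 0 < T / n := by positivity
  nlinarith

lemma tendsto_gridRight (hT : 0 < T) {s : ℝ} (hs : 0 ≤ s) :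
    Tendsto (fun n : ℕ => gridRight T (n + 1) s) atTop (𝓝 s) := by
  rw [tendsto_iff_norm_sub_tendsto_zero]
  refine squeeze_zero (fun n => norm_nonneg _) (fun n => ?_)
    (g := fun n : ℕ => T * (1 / ((n : ℝ) + 1))) ?_
  · rw [Real.norm_eq_abs]
    refine (abs_gridRight_sub_le hT n.succ_pos hs).trans (le_of_eq ?_)
    push_cast
    ring
  · simpa using tendsto_one_div_add_atTop_nhds_zero_nat.const_mul T

lemma measurable_gridRight (T : ℝ) (n : ℕ) : Measurable (gridRight T n) := by
  unfold gridRight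
  have : Measurable fun s : ℝ => ⌈n * s / T⌉₊ := Nat.measurable_ceil.comp (by fun_prop)
  have h2 : Measurable fun s : ℝ => ((⌈n * s / T⌉₊ : ℕ) : ℝ) :=
    (measurable_from_top (f := fun k : ℕ => (k : ℝ))).comp this
  fun_prop

/-- The points of the partition of `[0, T]` into `n` equal intervals. -/
def gridPoint (T : ℝ) (n : ℕ) (j : ℕ) : ℝ := T * j / n

lemma gridRight_of_mem (hT : 0 < T) {n : ℕ} (hn : 0 < n) {j : ℕ} {s : ℝ}
    (hs : s ∈ Ioc (gridPoint T n j) (gridPoint T n (j + 1))) :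
    gridRight T n s = gridPoint T n (j + 1) := by
  have hn' : (0 : ℝ) < n := by exact_mod_cast hn
  obtain ⟨h1, h2⟩ := hs
  rw [gridPoint, div_lt_iff₀ hn'] at h1
  rw [gridPoint, le_div_iff₀ hn'] at h2
  have : ⌈n * s / T⌉₊ = j + 1 := by
    rw [Nat.ceil_eq_iff (by omega)]
    constructor
    · rw [lt_div_iff₀ hT]
      simp only [Nat.add_sub_cancel]
      linarith
    · rw [div_le_iff₀ hT]
      linarith
  rw [gridRight, this, gridPoint]

lemma monotone_gridPoint (hT : 0 < T) (n : ℕ) : Monotone (gridPoint T n) := by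
  intro i j hij
  unfold gridPoint
  gcongr

lemma gridPoint_mem (hT : 0 < T) {n j : ℕ} (hj : j ≤ n) : gridPoint T n j ∈ Icc 0 T := by
  refine ⟨by unfold gridPoint; positivity, ?_⟩
  unfold gridPoint
  refine div_le_of_le_mul₀ (by positivity) hT.le ?_
  gcongr

/-- The integrand is constant on each cell. With the random measure for `ρ` the weights are
increments of `ζ`; with Lebesgue measure they are cell lengths. -/
lemma setIntegral_comp_gridRight (hT : 0 < T) {n : ℕ} (hn : 0 < n) (ρ : Measure ℝ)
    (hρ : ρ (Ioc 0 T) ≠ ∞) (h : ℝ → ℝ) :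
    ∫ s in Ioc 0 T, h (gridRight T n s) ∂ρ =
      ∑ j : Fin n, ρ.real (Ioc (gridPoint T n j) (gridPoint T n (j + 1))) *
        h (gridPoint T n (j + 1)) := by
  have hn' : (0 : ℝ) < n := by exact_mod_cast hn
  have hmono := monotone_gridPoint hT n
  have hU : Ioc 0 T = ⋃ j : Fin n, Ioc (gridPoint T n j) (gridPoint T n (j + 1)) := by
    have h1 := hmono.biUnion_Ico_Ioc_map_succ 0 n
    have e0 : gridPoint T n 0 = 0 := by simp [gridPoint]
    have en : gridPoint T n n = T := by simp [gridPoint, hn'.ne']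
    rw [e0, en] at h1
    rw [← h1]
    ext s
    simp only [mem_iUnion, exists_prop, mem_Ico, zero_le, true_and, Nat.succ_eq_succ,
      Nat.succ_eq_add_one]
    constructor
    · rintro ⟨i, hi, hs⟩
      exact ⟨⟨i, hi⟩, hs⟩
    · rintro ⟨i, hs⟩
      exact ⟨i, i.2, hs⟩
  have hd : Pairwise fun i j : Fin n =>
      Disjoint (Ioc (gridPoint T n i) (gridPoint T n (i + 1)))
        (Ioc (gridPoint T n j) (gridPoint T n (j + 1))) := by
    intro i j hij
    exact hmono.pairwise_disjoint_on_Ioc_succ (fun h => hij (Fin.ext h))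
  have hval : ∀ j : Fin n, ∀ s ∈ Ioc (gridPoint T n j) (gridPoint T n (j + 1)),
      h (gridRight T n s) = h (gridPoint T n (j + 1)) := fun j s hs => by
    rw [gridRight_of_mem hT hn hs]
  have hfin : ∀ j : Fin n, ρ (Ioc (gridPoint T n j) (gridPoint T n (j + 1))) ≠ ∞ := fun j =>
    ne_top_of_le_ne_top hρ (measure_mono (hU ▸ subset_iUnion
      (fun j : Fin n => Ioc (gridPoint T n j) (gridPoint T n (j + 1))) j))
  rw [hU, integral_iUnion_fintype (fun _ => measurableSet_Ioc) hd fun j =>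
    (integrableOn_const (hfin j)).congr_fun (fun s hs => (hval j s hs).symm) measurableSet_Ioc]
  refine Finset.sum_congr rfl fun j _ => ?_
  rw [setIntegral_congr_fun measurableSet_Ioc (hval j), setIntegral_const, smul_eq_mul]

end Subordinator

/-! ### The Laplace functional of a subordinator -/

section LaplaceFunctional

variable {Ω : Type*} [MeasurableSpace Ω] {P : Measure Ω} [IsProbabilityMeasure P] {T θ : ℝ}
  {F : Measure ℝ} {ζ : ℝ → Ω → ℝ} {κ : Ω → Measure ℝ}

omit [IsProbabilityMeasure P] in
lemma IsGGCSubordinator.integral_exp_increment (hζ : IsGGCSubordinator P T θ F ζ) {s t : ℝ}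
    (hs : 0 ≤ s) (hst : s ≤ t) (ht : t ≤ T) {lam : ℝ} (hlam : 0 ≤ lam) :
    ∫ ω, Real.exp (-lam * (ζ t ω - ζ s ω)) ∂P =
      Real.exp (-(t - s) * θ * levyExponent F lam) := by
  rw [← hζ.laplace (t - s) ⟨by linarith, by linarith⟩ lam hlam]
  have h := (hζ.stationaryIncrements s t hs hst ht).comp
    (u := fun x => Real.exp (-lam * x)) (by fun_prop)
  exact h.integral_eq

omit [IsProbabilityMeasure P] in
-- Increments over the cells are independent, and each contributes `exp(-(length) θ ψ_F(h))`; the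
-- exponents add up to the integral of a step function.
lemma IsGGCSubordinator.integral_exp_grid (hT : 0 < T) (hζ : IsGGCSubordinator P T θ F ζ)
    {n : ℕ} (hn : 0 < n) {h : ℝ → ℝ} (hh : ∀ s, 0 ≤ h s) :
    ∫ ω, Real.exp (-∑ j : Fin n, (ζ (gridPoint T n (j + 1)) ω - ζ (gridPoint T n j) ω) *
        h (gridPoint T n (j + 1))) ∂P =
      Real.exp (-θ * ∫ s in Ioc 0 T, levyExponent F (h (gridRight T n s))) := by
  have hind := hζ.indepIncrements n (fun j => ⟨gridPoint T n j, gridPoint_mem hT (by omega)⟩)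
    (fun i j hij => monotone_gridPoint hT n (by exact_mod_cast hij))
  have hmeas : ∀ j : Fin n, Measurable fun ω => ζ (gridPoint T n (j + 1)) ω -
      ζ (gridPoint T n j) ω := fun j =>
    (hζ.measurable _ (gridPoint_mem hT (by omega))).sub
      (hζ.measurable _ (gridPoint_mem hT (by omega)))
  have hprod := hind.integral_fun_prod_comp (𝕜 := ℝ)
    (f := fun (j : Fin n) x => Real.exp (-h (gridPoint T n (j + 1)) * x))
    (fun j => (hmeas j).aemeasurable)
    (fun j => by refine Measurable.aestronglyMeasurable ?_; fun_prop)
  have h1 : ∀ ω, Real.exp (-∑ j : Fin n, (ζ (gridPoint T n (j + 1)) ω - ζ (gridPoint T n j) ω) *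
      h (gridPoint T n (j + 1))) = ∏ j : Fin n, Real.exp (-h (gridPoint T n (j + 1)) *
        (ζ (gridPoint T n (j + 1)) ω - ζ (gridPoint T n j) ω)) := by
    intro ω
    rw [← Real.exp_sum, ← Finset.sum_neg_distrib]
    congr 1
    refine Finset.sum_congr rfl fun j _ => ?_
    ring
  simp_rw [h1]
  refine hprod.trans ?_
  rw [setIntegral_comp_gridRight hT hn volume (by simp) fun x => levyExponent F (h x),
    Finset.mul_sum, Real.exp_sum]
  refine Finset.prod_congr rfl fun j _ => ?_
  have hle : gridPoint T n j ≤ gridPoint T n (j + 1) := monotone_gridPoint hT n (Nat.le_succ _)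
  refine (hζ.integral_exp_increment (gridPoint_mem hT (by omega)).1 hle
    (gridPoint_mem hT (by omega)).2 (hh _)).trans ?_
  rw [Real.volume_real_Ioc_of_le hle]
  congr 1
  ring

variable (hκ : IsStieltjesVersion P T ζ κ)

include hκ

omit [IsProbabilityMeasure P] in
lemma IsStieltjesVersion.measurable_integral {g : ℝ → ℝ} (hg : Measurable g)
    (hg0 : ∀ s, 0 ≤ g s) : Measurable fun ω => ∫ s in Ioc 0 T, g s ∂(κ ω) := by
  have : (fun ω => ∫ s in Ioc 0 T, g s ∂(κ ω)) = fun ω =>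
      (∫⁻ s, (Ioc 0 T).indicator (fun s => ENNReal.ofReal (g s)) s ∂(κ ω)).toReal := by
    ext ω
    rw [integral_eq_lintegral_of_nonneg_ae (ae_of_all _ hg0) hg.aestronglyMeasurable,
      lintegral_indicator measurableSet_Ioc]
  rw [this]
  exact ((Measure.measurable_lintegral (hg.ennreal_ofReal.indicator measurableSet_Ioc)).comp
    hκ.measurable).ennreal_toReal

/-- Both sides are stable under bounded pointwise limits. Convergence is required almost everywhere
for Lebesgue measure and, for almost every path, for the random measure. -/
lemma IsStieltjesVersion.laplace_of_tendsto (h0 : ∀ᵐ x ∂F, 0 ≤ x)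
    (hF_log : ∀ lam : ℝ, 0 < lam → Integrable (fun x => Real.log (1 + lam * x)) F)
    [SFinite F] {M : ℝ} {g : ℕ → ℝ → ℝ} {g' : ℝ → ℝ} (hg : ∀ n, Measurable (g n))
    (hg0 : ∀ n s, 0 ≤ g n s) (hgM : ∀ n s, g n s ≤ M)
    (hvol : ∀ᵐ s ∂(volume.restrict (Ioc 0 T)), Tendsto (fun n => g n s) atTop (𝓝 (g' s)))
    (hP : ∀ᵐ ω ∂P, ∀ᵐ s ∂((κ ω).restrict (Ioc 0 T)),
      Tendsto (fun n => g n s) atTop (𝓝 (g' s)))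
    (heq : ∀ n, ∫ ω, Real.exp (-∫ s in Ioc 0 T, g n s ∂(κ ω)) ∂P =
      Real.exp (-θ * ∫ s in Ioc 0 T, levyExponent F (g n s))) :
    ∫ ω, Real.exp (-∫ s in Ioc 0 T, g' s ∂(κ ω)) ∂P =
      Real.exp (-θ * ∫ s in Ioc 0 T, levyExponent F (g' s)) := by
  have hfin := hκ.isFiniteMeasure
  have hM : 0 ≤ M := (hg0 0 0).trans (hgM 0 0)
  have h1 : Tendsto (fun n => ∫ ω, Real.exp (-∫ s in Ioc 0 T, g n s ∂(κ ω)) ∂P) atTop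
      (𝓝 (∫ ω, Real.exp (-∫ s in Ioc 0 T, g' s ∂(κ ω)) ∂P)) := by
    refine tendsto_integral_of_dominated_convergence (fun _ => 1)
      (fun n => (hκ.measurable_integral (hg n) (hg0 n)).neg.exp.aestronglyMeasurable)
      (integrable_const _) (fun n => ae_of_all _ fun ω => ?_) ?_
    · rw [Real.norm_eq_abs, abs_of_pos (Real.exp_pos _), Real.exp_le_one_iff, neg_nonpos]
      exact integral_nonneg (hg0 n)
    · filter_upwards [hP] with ω hω
      refine (Real.continuous_exp.tendsto _).comp (Tendsto.neg ?_)
      refine tendsto_integral_of_dominated_convergence (fun _ => M)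
        (fun n => (hg n).aestronglyMeasurable) (integrable_const _)
        (fun n => ae_of_all _ fun s => ?_) hω
      rw [Real.norm_eq_abs, abs_of_nonneg (hg0 n s)]
      exact hgM n s
  have h2 : Tendsto (fun n => Real.exp (-θ * ∫ s in Ioc 0 T, levyExponent F (g n s))) atTop
      (𝓝 (Real.exp (-θ * ∫ s in Ioc 0 T, levyExponent F (g' s)))) := by
    refine (Real.continuous_exp.tendsto _).comp (Tendsto.const_mul _ ?_)
    refine tendsto_integral_of_dominated_convergence (fun _ => levyExponent F (max M 1))
      (fun n => (measurable_levyExponent.comp (hg n)).aestronglyMeasurable)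
      (integrable_const _) (fun n => ae_of_all _ fun s => ?_) ?_
    · rw [Real.norm_eq_abs, abs_of_nonneg (levyExponent_nonneg h0 (hg0 n s))]
      exact levyExponent_mono h0 hF_log (hg0 n s) (by positivity)
        ((hgM n s).trans (le_max_left _ _))
    · filter_upwards [hvol] with s hs
      exact tendsto_levyExponent h0 hF_log (fun n => hg0 n s) (fun n => hgM n s)
        (ge_of_tendsto' hs fun n => hg0 n s) hs
  refine tendsto_nhds_unique h1 ?_
  simp_rw [heq]
  exact h2

lemma IsStieltjesVersion.laplace_continuous (hT : 0 < T) (hζ : IsGGCSubordinator P T θ F ζ)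
    (h0 : ∀ᵐ x ∂F, 0 ≤ x)
    (hF_log : ∀ lam : ℝ, 0 < lam → Integrable (fun x => Real.log (1 + lam * x)) F)
    [SFinite F] {M : ℝ} {g : ℝ → ℝ} (hg : Continuous g)
    (hg0 : ∀ s, 0 ≤ g s) (hgM : ∀ s, g s ≤ M) :
    ∫ ω, Real.exp (-∫ s in Ioc 0 T, g s ∂(κ ω)) ∂P =
      Real.exp (-θ * ∫ s in Ioc 0 T, levyExponent F (g s)) := by
  have hfin := hκ.isFiniteMeasure
  have hlim : ∀ ρ : Measure ℝ, ∀ᵐ s ∂(ρ.restrict (Ioc 0 T)),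
      Tendsto (fun n : ℕ => g (gridRight T (n + 1) s)) atTop (𝓝 (g s)) := fun ρ =>
    ae_restrict_of_forall_mem measurableSet_Ioc fun s hs =>
      (hg.tendsto s).comp (tendsto_gridRight hT hs.1.le)
  refine hκ.laplace_of_tendsto h0 hF_log (M := M)
    (g := fun n s => g (gridRight T (n + 1) s))
    (fun n => hg.measurable.comp (measurable_gridRight T _)) (fun n s => hg0 _)
    (fun n s => hgM _) (hlim _) (ae_of_all _ fun ω => hlim _) fun n => ?_
  rw [← hζ.integral_exp_grid hT n.succ_pos hg0]
  refine integral_congr_ae ?_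
  filter_upwards [hκ.apply_Ioc] with ω hω
  rw [setIntegral_comp_gridRight hT n.succ_pos (κ ω) (measure_ne_top _ _)]
  congr 2
  refine Finset.sum_congr rfl fun j _ => ?_
  rw [hω _ (gridPoint_mem hT (by omega)) _ (gridPoint_mem hT (by omega))
    (monotone_gridPoint hT _ (Nat.le_succ _))]

/-- The Laplace functional of a subordinator at a bounded measurable function. -/
theorem IsStieltjesVersion.laplace_measurable (hT : 0 < T) (hζ : IsGGCSubordinator P T θ F ζ)
    (h0 : ∀ᵐ x ∂F, 0 ≤ x)
    (hF_log : ∀ lam : ℝ, 0 < lam → Integrable (fun x => Real.log (1 + lam * x)) F)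
    [SFinite F] {M : ℝ} {g : ℝ → ℝ} (hg : Measurable g)
    (hg0 : ∀ s, 0 ≤ g s) (hgM : ∀ s, g s ≤ M) :
    ∫ ω, Real.exp (-∫ s in Ioc 0 T, g s ∂(κ ω)) ∂P =
      Real.exp (-θ * ∫ s in Ioc 0 T, levyExponent F (g s)) := by
  have hfin := hκ.isFiniteMeasure
  have hM : 0 ≤ M := (hg0 0).trans (hgM 0)
  -- One sequence must converge almost everywhere under almost every `κ ω`, so it is chosen for the
  -- averaged measure `ν`. The total mass may lack an expectation; the weight `w` keeps `ν` finite.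
  let w : Ω → ℝ≥0∞ := fun ω => (1 + κ ω univ)⁻¹
  have hw : Measurable w :=
    ((Measure.measurable_coe MeasurableSet.univ).comp hκ.measurable |>.const_add 1).inv
  let ν : Measure ℝ := ((P.withDensity w).map κ).join
  have hν : IsFiniteMeasure ν := by
    refine ⟨?_⟩
    rw [Measure.join_apply MeasurableSet.univ,
      lintegral_map (Measure.measurable_coe MeasurableSet.univ) hκ.measurable,
      lintegral_withDensity_eq_lintegral_mul _ hw (g := fun ω => κ ω univ)
        ((Measure.measurable_coe MeasurableSet.univ).comp hκ.measurable)]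
    refine lt_of_le_of_lt (b := ∫⁻ _, 1 ∂P) (lintegral_mono fun ω => ?_) (by simp)
    simp only [Pi.mul_apply, w]
    rw [mul_comm, ← div_eq_mul_inv]
    exact ENNReal.div_le_of_le_mul (by rw [one_mul]; exact le_add_self)
  let m : Measure ℝ := volume.restrict (Ioc 0 T) + ν
  have hgint : MemLp g 1 m := by
    rw [memLp_one_iff_integrable]
    exact Integrable.of_bound hg.aestronglyMeasurable M (ae_of_all _ fun s => by
      rw [Real.norm_eq_abs, abs_of_nonneg (hg0 s)]; exact hgM s)
  choose f hf _ using fun n : ℕ => hgint.exists_boundedContinuous_eLpNorm_sub_le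
    ENNReal.one_ne_top (ε := ENNReal.ofReal (1 / ((n : ℝ) + 1)))
    (by rw [Ne, ENNReal.ofReal_eq_zero, not_le]; positivity)
  have htm : TendstoInMeasure m (fun n => (f n : ℝ → ℝ)) atTop g := by
    refine tendstoInMeasure_of_tendsto_eLpNorm (p := 1) one_ne_zero
      (fun n => (f n).continuous.aestronglyMeasurable) hg.aestronglyMeasurable ?_
    refine tendsto_of_tendsto_of_tendsto_of_le_of_le tendsto_const_nhds ?_
      (fun n => zero_le) fun n => (eLpNorm_sub_comm _ _ _ _).trans_le (hf n)
    have := (ENNReal.continuous_ofReal.tendsto 0).comp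
      (tendsto_one_div_add_atTop_nhds_zero_nat (𝕜 := ℝ))
    simpa [Function.comp_def] using this
  obtain ⟨ns, -, hns⟩ := htm.exists_seq_tendsto_ae
  -- Clipping to `[0, M]` preserves continuity and the limit, and supplies the uniform bounds.
  let g' : ℕ → ℝ → ℝ := fun n s => max 0 (min (f (ns n) s) M)
  have hg'c : ∀ n, Continuous (g' n) := fun n =>
    continuous_const.max ((f (ns n)).continuous.min continuous_const)
  have hg'0 : ∀ n s, 0 ≤ g' n s := fun n s => le_max_left _ _
  have hg'M : ∀ n s, g' n s ≤ M := fun n s => max_le hM (min_le_right _ _)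
  have hlim : ∀ᵐ s ∂m, Tendsto (fun n => g' n s) atTop (𝓝 (g s)) := by
    filter_upwards [hns] with s hs
    have := tendsto_const_nhds (x := (0 : ℝ)).max (hs.min (tendsto_const_nhds (x := M)))
    rwa [min_eq_left (hgM s), max_eq_right (hg0 s)] at this
  rw [ae_add_measure_iff] at hlim
  refine hκ.laplace_of_tendsto h0 hF_log (fun n => (hg'c n).measurable) hg'0 hg'M hlim.1 ?_
    fun n => hκ.laplace_continuous hT hζ h0 hF_log (hg'c n) (hg'0 n) (hg'M n)
  -- A `ν`-null set is `κ ω`-null for almost every `ω`, because `w` never vanishes.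
  have h1 := ae_of_ae_map hκ.measurable.aemeasurable (Measure.ae_ae_of_ae_join hlim.2)
  rw [ae_withDensity_iff hw] at h1
  filter_upwards [h1] with ω hω
  refine ae_restrict_of_ae (hω ?_)
  simp only [w]
  exact ENNReal.inv_ne_zero.2 (ENNReal.add_ne_top.2 ⟨ENNReal.one_ne_top, measure_ne_top _ _⟩)

/-- The joint Laplace transform of the masses that a subordinator gives to disjoint sets. -/
theorem IsStieltjesVersion.laplace_sets (hT : 0 < T) (hζ : IsGGCSubordinator P T θ F ζ)
    (h0 : ∀ᵐ x ∂F, 0 ≤ x)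
    (hF_log : ∀ lam : ℝ, 0 < lam → Integrable (fun x => Real.log (1 + lam * x)) F)
    [SFinite F] {ι : Type*} [Fintype ι] {C : ι → Set ℝ} (hC : ∀ i, MeasurableSet (C i))
    (hd : Pairwise fun i j => Disjoint (C i) (C j)) (hCT : ∀ i, C i ⊆ Icc 0 T)
    {u : ι → ℝ} (hu : ∀ i, 0 ≤ u i) :
    ∫ ω, Real.exp (-∑ i, u i * (κ ω).real (C i)) ∂P =
      ∏ i, Real.exp (-(θ * volume.real (C i)) * levyExponent F (u i)) := by
  have hfin := hκ.isFiniteMeasure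
  let g : ℝ → ℝ := fun s => ∑ i, (C i).indicator (fun _ => u i) s
  have hg : Measurable g := Finset.measurable_fun_sum _ fun i _ =>
    measurable_const.indicator (hC i)
  have hg0 : ∀ s, 0 ≤ g s := fun s => Finset.sum_nonneg fun i _ =>
    indicator_nonneg (fun _ _ => hu i) s
  have hgM : ∀ s, g s ≤ ∑ i, u i := fun s => Finset.sum_le_sum fun i _ =>
    indicator_le_self' (fun _ _ => hu i) s
  have hL := hκ.laplace_measurable hT hζ h0 hF_log hg hg0 hgM
  have hI : ∀ ρ : Measure ℝ, IsFiniteMeasure ρ → ∀ v : ι → ℝ,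
      ∫ s, ∑ i, (C i).indicator (fun _ => v i) s ∂ρ = ∑ i, v i * ρ.real (C i) := by
    intro ρ hρ v
    rw [integral_finsetSum _ fun i _ => (integrable_const _).indicator (hC i)]
    refine Finset.sum_congr rfl fun i _ => ?_
    rw [integral_indicator (hC i), setIntegral_const, smul_eq_mul, mul_comm]
  -- The sets lie in `[0, T]` but the integral runs over `(0, T]`; the random measure has no mass at
  -- `0`.
  have h1 : ∀ᵐ ω ∂P, ∫ s in Ioc 0 T, g s ∂(κ ω) = ∑ i, u i * (κ ω).real (C i) := by
    filter_upwards [hκ.compl] with ω hω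
    rw [hI _ inferInstance]
    refine Finset.sum_congr rfl fun i _ => ?_
    rw [measureReal_restrict_apply (hC i), measureReal_def, measureReal_def]
    congr 2
    refine le_antisymm (measure_mono inter_subset_left) ?_
    calc κ ω (C i) ≤ κ ω (C i ∩ Ioc 0 T) + κ ω (C i \ Ioc 0 T) := measure_le_inter_add_sdiff _ _ _
      _ ≤ κ ω (C i ∩ Ioc 0 T) + 0 := by
          gcongr
          exact (measure_mono_null (sdiff_subset_compl _ _) hω).le
      _ = _ := add_zero _
  -- Disjointness leaves at most one nonzero term, and `ψ_F(0) = 0` handles points outside every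
  -- set.
  have hψ : ∀ s, levyExponent F (g s) =
      ∑ i, (C i).indicator (fun _ => levyExponent F (u i)) s := by
    intro s
    by_cases hs : ∃ i, s ∈ C i
    · obtain ⟨i, hi⟩ := hs
      have hne : ∀ j, j ≠ i → s ∉ C j := fun j hj hsj =>
        Set.disjoint_left.1 (hd hj) hsj hi
      simp only [g]
      rw [Finset.sum_eq_single i (fun j _ hj => indicator_of_notMem (hne j hj) _) (by simp),
        Finset.sum_eq_single i (fun j _ hj => indicator_of_notMem (hne j hj) _) (by simp),
        indicator_of_mem hi, indicator_of_mem hi]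
    · push Not at hs
      simp only [g]
      rw [Finset.sum_eq_zero fun j _ => indicator_of_notMem (hs j) _,
        Finset.sum_eq_zero fun j _ => indicator_of_notMem (hs j) _, levyExponent_zero]
  have h2 : ∫ s in Ioc 0 T, levyExponent F (g s) =
      ∑ i, levyExponent F (u i) * volume.real (C i) := by
    simp_rw [hψ]
    rw [hI _ inferInstance]
    refine Finset.sum_congr rfl fun i _ => ?_
    rw [measureReal_restrict_apply (hC i), measureReal_def, measureReal_def]
    congr 2
    refine measure_congr ?_
    have : (C i ∩ Ioc 0 T : Set ℝ) =ᵐ[volume] (C i ∩ Icc 0 T : Set ℝ) :=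
      (ae_eq_refl _).inter Ioc_ae_eq_Icc
    rwa [inter_eq_left.2 (hCT i)] at this
  rw [h2] at hL
  rw [← Real.exp_sum]
  refine Eq.trans ?_ (hL.trans ?_)
  · refine integral_congr_ae ?_
    filter_upwards [h1] with ω hω
    rw [hω]
  · rw [Finset.mul_sum]
    congr 1
    refine Finset.sum_congr rfl fun i _ => ?_
    ring

end LaplaceFunctional

/-! ### The law of `X Y_σ` -/

section BernoulliScaled

variable {F : Measure ℝ} [IsProbabilityMeasure F] {σ : ℝ} (hσ : 0 < σ) (hσ1 : σ ≤ 1)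

include hσ hσ1

lemma isProbabilityMeasure_bernoulliScaled : IsProbabilityMeasure (bernoulliScaled F σ) := by
  refine ⟨?_⟩
  simp only [bernoulliScaled, Measure.add_apply, Measure.smul_apply, measure_univ, smul_eq_mul,
    mul_one]
  rw [← ENNReal.ofReal_add hσ.le (by linarith)]
  simp

omit [IsProbabilityMeasure F] hσ hσ1 in
lemma bernoulliScaled_Iio (hF : F (Iio 0) = 0) : bernoulliScaled F σ (Iio 0) = 0 := by
  simp [bernoulliScaled, hF]

omit [IsProbabilityMeasure F] hσ hσ1 in
lemma integrable_bernoulliScaled {f : ℝ → ℝ} (hf : Integrable f F) :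
    Integrable f (bernoulliScaled F σ) :=
  (hf.smul_measure ENNReal.ofReal_ne_top).add_measure
    ((integrable_dirac (by simp)).smul_measure ENNReal.ofReal_ne_top)

omit [IsProbabilityMeasure F] in
lemma integral_bernoulliScaled {f : ℝ → ℝ} (hf : Integrable f F) :
    ∫ x, f x ∂bernoulliScaled F σ = σ * ∫ x, f x ∂F + (1 - σ) * f 0 := by
  rw [bernoulliScaled, integral_add_measure (hf.smul_measure ENNReal.ofReal_ne_top)
    ((integrable_dirac (by simp)).smul_measure ENNReal.ofReal_ne_top), integral_smul_measure,
    integral_smul_measure, integral_dirac, ENNReal.toReal_ofReal hσ.le,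
    ENNReal.toReal_ofReal (by linarith), smul_eq_mul, smul_eq_mul]

omit [IsProbabilityMeasure F] in
-- The atom at `0` contributes `log 1 = 0`, so thinning multiplies the exponent by `σ`.
lemma levyExponent_bernoulliScaled
    (hF_log : ∀ lam : ℝ, 0 < lam → Integrable (fun x => Real.log (1 + lam * x)) F)
    {lam : ℝ} (hlam : 0 < lam) :
    levyExponent (bernoulliScaled F σ) lam = σ * levyExponent F lam := by
  rw [levyExponent, integral_bernoulliScaled hσ hσ1 (hF_log lam hlam)]
  simp [levyExponent]

/-- The atom of mass `1 - σ` at `0` adds `(1 - σ) log t` to the potential, which becomes the factor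
`t ^ (σ - 1)`; for `t < 0` the distribution function, hence the sine, is zero. -/
lemma sineDensity_bernoulliScaled_ae_eq (hF_nonneg : F (Iio 0) = 0)
    (hF_log : ∀ lam : ℝ, 0 < lam → Integrable (fun x => Real.log (1 + lam * x)) F) :
    sineDensity (bernoulliScaled F σ) =ᵐ[volume] meanDensity F σ := by
  have := isProbabilityMeasure_bernoulliScaled (F := F) hσ hσ1
  have h0 : ∀ᵐ t : ℝ, t ≠ 0 := by simp [ae_iff, measure_singleton]
  filter_upwards [ae_integrable_log_abs_sub (ae_nonneg_of_Iio hF_nonneg) hF_log, h0] with t ht ht0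
  rcases lt_or_gt_of_ne ht0 with h | h
  · rw [meanDensity, if_neg h.le.not_gt, sineDensity, cdf_eq_real, measureReal_def,
      measure_mono_null (Iic_subset_Iio.2 h) (bernoulliScaled_Iio hF_nonneg)]
    simp
  · rw [meanDensity, if_pos h, sineDensity, logPotential_eq,
      integral_bernoulliScaled hσ hσ1 ht, ← logPotential_eq, sub_zero, abs_of_pos h,
      Real.rpow_def_of_pos h, neg_add, Real.exp_add, neg_mul_eq_neg_mul,
      show -((1 - σ) * Real.log t) = Real.log t * (σ - 1) by ring]
    ring

end BernoulliScaled

/-! ### Products with an independent factor -/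

lemma integral_mconv_right {μ ν : Measure ℝ} [SFinite μ] [SFinite ν] {f : ℝ → ℝ}
    (hf : Integrable f (μ.mconv ν)) :
    ∫ z, f z ∂μ.mconv ν = ∫ y, ∫ x, f (x * y) ∂μ ∂ν := by
  rw [Measure.mconv_comm] at hf ⊢
  rw [integral_mconv hf]
  simp_rw [mul_comm]

lemma ae_nonneg_mconv {μ ν : Measure ℝ} [SFinite μ] [SFinite ν] (hμ : ∀ᵐ x ∂μ, 0 ≤ x)
    (hν : ∀ᵐ x ∂ν, 0 ≤ x) : ∀ᵐ z ∂μ.mconv ν, 0 ≤ z := by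
  rw [Measure.mconv, ae_map_iff (by fun_prop) measurableSet_Ici]
  filter_upwards [Measure.quasiMeasurePreserving_fst.ae hμ,
    Measure.quasiMeasurePreserving_snd.ae hν] with z h1 h2 using mul_nonneg h1 h2

lemma integrable_of_ae_mem_Icc {μ : Measure ℝ} [IsFiniteMeasure μ] {f : ℝ → ℝ}
    (hf : Measurable f) (h : ∀ᵐ x ∂μ, f x ∈ Icc 0 1) : Integrable f μ := by
  refine (integrable_const (1 : ℝ)).mono' hf.aestronglyMeasurable ?_
  filter_upwards [h] with x hx
  rw [Real.norm_eq_abs, abs_of_nonneg hx.1]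
  exact hx.2

/-- Given the second factor `m`, the exponential variable has transform `(1 + u m)⁻¹`. Thus the
Markov–Krein transform of order one is a Laplace transform. -/
lemma integral_exp_neg_gamma_mconv {μ : Measure ℝ} [IsProbabilityMeasure μ]
    (hμ : ∀ᵐ x ∂μ, 0 ≤ x) {u : ℝ} (hu : 0 ≤ u) :
    ∫ x, Real.exp (-u * x) ∂(gammaMeasure 1 1).mconv μ = ∫ m, (1 + u * m)⁻¹ ∂μ := by
  rw [integral_mconv_right]
  · refine integral_congr_ae ?_
    filter_upwards [hμ] with m hm
    have h := integral_exp_neg_gammaMeasure (a := 1) (u := u * m) one_pos (by positivity)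
    rw [Real.rpow_neg_one] at h
    rw [← h]
    congr 1 with x
    ring_nf
  · refine integrable_of_ae_mem_Icc (by fun_prop) ?_
    filter_upwards [ae_nonneg_mconv (ae_nonneg_gammaMeasure 1 1) hμ] with x hx
    exact ⟨(Real.exp_pos _).le, Real.exp_le_one_iff.2 (by nlinarith)⟩

lemma HasMarkovKrein.integral_inv {F μ : Measure ℝ} (h : HasMarkovKrein 1 F μ) {u : ℝ}
    (hu : 0 ≤ u) : ∫ m, (1 + u * m)⁻¹ ∂μ = Real.exp (-levyExponent F u) := by
  have := h.isProbabilityMeasure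
  rcases hu.eq_or_lt with rfl | hu
  · simp [levyExponent_zero]
  · simpa [Real.rpow_neg_one] using h.integral_eq u hu

/-! ### Beta laws -/

lemma integral_Ioi_rpow_mul_inv_one_add_mul (σ : ℝ) {c : ℝ} (hc : 0 < c) :
    ∫ v in Ioi (0 : ℝ), v ^ (σ - 1) * (1 + c * v)⁻¹ =
      c ^ (-σ) * ∫ v in Ioi (0 : ℝ), v ^ (σ - 1) * (1 + v)⁻¹ := by
  have h := integral_comp_mul_left_Ioi (fun v : ℝ => v ^ (σ - 1) * (1 + v)⁻¹) 0 hc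
  rw [mul_zero, smul_eq_mul] at h
  have h2 : ∫ v in Ioi (0 : ℝ), (c * v) ^ (σ - 1) * (1 + c * v)⁻¹ =
      c ^ (σ - 1) * ∫ v in Ioi (0 : ℝ), v ^ (σ - 1) * (1 + c * v)⁻¹ := by
    rw [← integral_const_mul]
    refine setIntegral_congr_fun measurableSet_Ioi fun v hv => ?_
    rw [Real.mul_rpow hc.le (mem_Ioi.1 hv).le, mul_assoc]
  rw [h2] at h
  have hc' : c ^ (σ - 1) ≠ 0 := (Real.rpow_pos_of_pos hc _).ne'
  rw [← mul_right_inj' hc', h, ← mul_assoc, ← Real.rpow_add hc]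
  rw [show σ - 1 + -σ = -1 by ring, Real.rpow_neg_one]

lemma image_div_one_add_Ioi : (fun v : ℝ => v / (1 + v)) '' Ioi 0 = Ioo 0 1 := by
  ext x
  constructor
  · rintro ⟨v, hv, rfl⟩
    have hv : 0 < v := hv
    exact ⟨by positivity, (div_lt_one (by positivity)).2 (by linarith)⟩
  · rintro ⟨h0, h1⟩
    refine ⟨x / (1 - x), div_pos h0 (by linarith), ?_⟩
    have : 1 - x ≠ 0 := by linarith
    field_simp
    ring

/-- Substitution `x = v / (1 + v)`, after which `s` enters only by scaling `v`. -/
lemma integral_Ioo_beta_kernel (σ s : ℝ) (hs : 0 ≤ s) :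
    ∫ x in Ioo (0 : ℝ) 1, x ^ (σ - 1) * (1 - x) ^ (-σ) * (1 + s * x)⁻¹ =
      ∫ v in Ioi (0 : ℝ), v ^ (σ - 1) * (1 + (1 + s) * v)⁻¹ := by
  have hd : ∀ v ∈ Ioi (0 : ℝ), HasDerivWithinAt (fun v : ℝ => v / (1 + v)) ((1 + v) ^ 2)⁻¹
      (Ioi 0) v := by
    intro v hv
    have hv : 0 < v := hv
    have h := ((hasDerivAt_id v).div ((hasDerivAt_id v).const_add 1)
      (by simp only [id]; positivity)).hasDerivWithinAt (s := Ioi 0)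
    refine h.congr_deriv ?_
    simp
  have hinj : InjOn (fun v : ℝ => v / (1 + v)) (Ioi 0) := by
    intro v hv w hw h
    have hv : 0 < v := hv
    have hw : 0 < w := hw
    dsimp only at h
    rw [div_eq_div_iff (by positivity) (by positivity)] at h
    linarith
  rw [← image_div_one_add_Ioi,
    integral_image_eq_integral_abs_deriv_smul measurableSet_Ioi hd hinj]
  refine setIntegral_congr_fun measurableSet_Ioi fun v hv => ?_
  have hv : 0 < v := hv
  have h1 : 0 < 1 + v := by positivity
  simp only [smul_eq_mul]
  rw [abs_of_pos (by positivity), show 1 - v / (1 + v) = (1 + v)⁻¹ by field_simp; ring,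
    Real.div_rpow hv.le h1.le, Real.inv_rpow h1.le, ← Real.rpow_neg h1.le, neg_neg,
    show (1 + v) ^ (σ - 1) = (1 + v) ^ σ / (1 + v) by rw [Real.rpow_sub_one h1.ne']]
  have h2 : (1 + v) ^ σ ≠ 0 := (Real.rpow_pos_of_pos h1 _).ne'
  have h3 : 1 + (1 + s) * v ≠ 0 := by positivity
  rw [show 1 + s * (v / (1 + v)) = (1 + (1 + s) * v) / (1 + v) by field_simp; ring]
  field_simp

lemma measurable_betaPDF (a b : ℝ) : Measurable (betaPDF a b) :=
  (measurable_betaPDFReal a b).ennreal_ofReal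

lemma isProbabilityMeasure_betaLaw {σ : ℝ} (hσ : 0 < σ) (hσ1 : σ ≤ 1) :
    IsProbabilityMeasure (betaLaw σ (1 - σ)) := by
  rw [betaLaw]
  split_ifs with h
  · infer_instance
  · exact isProbabilityMeasureBeta hσ (lt_of_le_of_ne (by linarith) (Ne.symm h))

lemma ae_betaLaw_nonneg (a b : ℝ) : ∀ᵐ x ∂betaLaw a b, 0 ≤ x := by
  rw [betaLaw]
  split_ifs with h
  · simp
  · rw [betaMeasure, ae_withDensity_iff (measurable_betaPDF a b)]
    refine ae_of_all _ fun x hx => ?_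
    by_contra hlt
    exact hx (betaPDF_eq_zero_of_nonpos (not_le.1 hlt).le)

/-- After substitution and scaling, `s` appears only in `(1 + s) ^ (-σ)`. The remaining constant is
`1`, as the case `s = 0` of a probability law shows, so it need not be computed. -/
lemma integral_inv_betaLaw {σ : ℝ} (hσ : 0 < σ) (hσ1 : σ ≤ 1) {s : ℝ} (hs : 0 ≤ s) :
    ∫ x, (1 + s * x)⁻¹ ∂betaLaw σ (1 - σ) = (1 + s) ^ (-σ) := by
  have hprob := isProbabilityMeasure_betaLaw hσ hσ1
  rw [betaLaw] at hprob ⊢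
  split_ifs at hprob ⊢ with h
  · have : σ = 1 := by linarith
    simp [this, Real.rpow_neg_one]
  have key : ∀ s : ℝ, 0 ≤ s → ∫ x, (1 + s * x)⁻¹ ∂betaMeasure σ (1 - σ) =
      1 / beta σ (1 - σ) * ((1 + s) ^ (-σ) *
        ∫ v in Ioi (0 : ℝ), v ^ (σ - 1) * (1 + v)⁻¹) := by
    intro s hs
    rw [← integral_Ioi_rpow_mul_inv_one_add_mul σ (by positivity),
      ← integral_Ioo_beta_kernel σ s hs, betaMeasure,
      integral_withDensity_eq_integral_toReal_smul (measurable_betaPDF _ _)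
        (ae_of_all _ fun _ => ENNReal.ofReal_lt_top), ← integral_const_mul,
      ← integral_indicator measurableSet_Ioo]
    congr 1 with x
    by_cases hx : x ∈ Ioo (0 : ℝ) 1
    · rw [indicator_of_mem hx, betaPDF, ENNReal.toReal_ofReal (betaPDFReal_pos hx.1 hx.2 hσ
        (lt_of_le_of_ne (by linarith) (Ne.symm h))).le, betaPDFReal, if_pos (mem_Ioo.1 hx), smul_eq_mul,
        show 1 - σ - 1 = -σ by ring]
      ring
    · rw [indicator_of_notMem hx, betaPDF, betaPDFReal, if_neg (mt mem_Ioo.2 hx)]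
      simp
  have h1 := key 0 le_rfl
  simp only [zero_mul, add_zero, inv_one, integral_const, probReal_univ, Real.one_rpow, one_mul,
    smul_eq_mul] at h1
  rw [key s hs, mul_left_comm, ← h1, mul_one]

/-- If `μ` has the Markov–Krein transform of order `σ` of `F`, then its product with an
independent beta`(σ, 1 - σ)` factor has the one of order `1` of the law of `X Y_σ`. -/
lemma HasMarkovKrein.betaLaw_mconv {F μ : Measure ℝ} {σ : ℝ} (hσ : 0 < σ) (hσ1 : σ ≤ 1)
    (hF_log : ∀ lam : ℝ, 0 < lam → Integrable (fun x => Real.log (1 + lam * x)) F)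
    (h : HasMarkovKrein σ F μ) :
    HasMarkovKrein 1 (bernoulliScaled F σ) ((betaLaw σ (1 - σ)).mconv μ) := by
  have := h.isProbabilityMeasure
  have := isProbabilityMeasure_betaLaw hσ hσ1
  have hpos := ae_nonneg_mconv (ae_betaLaw_nonneg σ (1 - σ)) h.ae_nonneg
  refine ⟨inferInstance, hpos, fun lam hlam => ?_⟩
  simp_rw [Real.rpow_neg_one]
  rw [integral_mconv_right, levyExponent_bernoulliScaled hσ hσ1 hF_log hlam, neg_mul, one_mul,
    ← neg_mul, ← h.integral_eq lam hlam]
  -- Given the second factor `m`, the beta factor turns the order-one kernel into `(1 + lam m) ^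
  -- (-σ)`.
  · refine integral_congr_ae ?_
    filter_upwards [h.ae_nonneg] with m hm
    rw [← integral_inv_betaLaw hσ hσ1 (by positivity : 0 ≤ lam * m)]
    congr 1 with x
    ring_nf
  · refine integrable_of_ae_mem_Icc (by fun_prop) ?_
    filter_upwards [hpos] with x hx
    have : 0 ≤ lam * x := by positivity
    exact ⟨by positivity, inv_le_one_of_one_le₀ (by linarith)⟩

/-! ### Products of a standard exponential variable with an independent factor -/

lemma lintegral_exp_mul_exp_div {u y : ℝ} (hu : 0 ≤ u) (hy : 0 < y) :
    ∫⁻ x in Ioi (0 : ℝ), ENNReal.ofReal (Real.exp (-u * x) * (Real.exp (-x / y) * y⁻¹)) =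
      ENNReal.ofReal (1 + u * y)⁻¹ := by
  have hneg : -(u + y⁻¹) < 0 := by have := inv_pos.2 hy; linarith
  have heq : ∀ x, Real.exp (-u * x) * (Real.exp (-x / y) * y⁻¹) =
      Real.exp (-(u + y⁻¹) * x) * y⁻¹ := by
    intro x
    rw [← mul_assoc, ← Real.exp_add]
    congr 2
    field_simp
    ring
  simp_rw [heq]
  rw [← ofReal_integral_eq_lintegral_ofReal ((integrableOn_exp_mul_Ioi hneg 0).mul_const _)
    (ae_of_all _ fun x => by positivity), integral_mul_const, integral_exp_mul_Ioi hneg]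
  congr 1
  have : u + y⁻¹ ≠ 0 := by linarith
  have : 1 + u * y ≠ 0 := by positivity
  rw [mul_zero, Real.exp_zero]
  field_simp
  ring

/-- From `1 + x / y ≤ exp(x / y)`. The bound does not depend on `y`, so the mixed exponential
density is finite for every mixing law on `(0, ∞)`. -/
lemma exp_neg_div_mul_inv_le {x y : ℝ} (hx : 0 < x) (hy : 0 < y) :
    Real.exp (-x / y) * y⁻¹ ≤ x⁻¹ := by
  have h := Real.add_one_le_exp (x / y)
  rw [neg_div, Real.exp_neg, ← mul_inv]
  refine inv_anti₀ hx ?_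
  have : x = x / y * y := by field_simp
  nlinarith

section Density

variable {F : Measure ℝ} {σ : ℝ}

lemma meanDensity_nonneg (x : ℝ) : 0 ≤ meanDensity F σ x := by
  rw [meanDensity]
  split_ifs with h
  · have := sin_pi_mul_cdf_nonneg (bernoulliScaled F σ) x
    have := Real.pi_pos
    positivity
  · rfl

lemma ggcDensity_of_nonpos {x : ℝ} (hx : x ≤ 0) : ggcDensity F σ x = 0 := if_neg hx.not_gt

lemma ggcDensity_nonneg (x : ℝ) : 0 ≤ ggcDensity F σ x := by
  rw [ggcDensity]
  split_ifs with h
  · refine mul_nonneg (by have := Real.pi_pos; positivity)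
      (setIntegral_nonneg measurableSet_Ioi fun y hy => ?_)
    have := sin_pi_mul_cdf_nonneg (bernoulliScaled F σ) y
    have : 0 < y := hy
    positivity
  · rfl

variable [IsProbabilityMeasure F]

lemma measurable_meanDensity : Measurable (meanDensity F σ) := by
  have := measurable_logPotential (F := F)
  have : Measurable fun x => cdf (bernoulliScaled F σ) x := (monotone_cdf _).measurable
  unfold meanDensity
  exact Measurable.ite measurableSet_Ioi (by fun_prop) measurable_const

/-- Given `M = y`, the product `G₁ M` has density `y⁻¹ exp(-x / y)`; the factor `y⁻¹` accounts for
the exponent `σ - 2` in place of `σ - 1`. -/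
lemma ggcDensity_eq_integral {x : ℝ} (hx : 0 < x) : ggcDensity F σ x =
    ∫ y, Real.exp (-x / y) * y⁻¹
      ∂volume.withDensity fun y => ENNReal.ofReal (meanDensity F σ y) := by
  rw [ggcDensity, if_pos hx, ← integral_const_mul,
    integral_withDensity_eq_integral_toReal_smul measurable_meanDensity.ennreal_ofReal
      (ae_of_all _ fun _ => ENNReal.ofReal_lt_top), ← integral_indicator measurableSet_Ioi]
  congr 1 with y
  rw [ENNReal.toReal_ofReal (meanDensity_nonneg y), meanDensity]
  by_cases hy : 0 < y
  · rw [indicator_of_mem (mem_Ioi.2 hy), if_pos hy, smul_eq_mul,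
      show σ - 2 = σ - 1 - 1 by ring, Real.rpow_sub_one hy.ne']
    ring
  · rw [indicator_of_notMem (by simpa using hy), if_neg hy, zero_smul]

omit [IsProbabilityMeasure F] in
lemma ae_pos_withDensity_meanDensity (hm : Measurable (meanDensity F σ)) :
    ∀ᵐ y ∂volume.withDensity fun y => ENNReal.ofReal (meanDensity F σ y), 0 < y := by
  rw [ae_withDensity_iff hm.ennreal_ofReal]
  refine ae_of_all _ fun y hy => ?_
  by_contra h
  exact hy (by rw [meanDensity, if_neg h, ENNReal.ofReal_zero])

lemma measurable_ggcDensity : Measurable (ggcDensity F σ) := by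
  have heq : ggcDensity F σ = fun x => if 0 < x then ∫ y, Real.exp (-x / y) * y⁻¹
      ∂volume.withDensity fun y => ENNReal.ofReal (meanDensity F σ y) else 0 := by
    ext x
    split_ifs with hx
    · exact ggcDensity_eq_integral hx
    · exact ggcDensity_of_nonpos (not_lt.1 hx)
  rw [heq]
  refine Measurable.ite measurableSet_Ioi ?_ measurable_const
  have : Measurable fun z : ℝ × ℝ => Real.exp (-z.1 / z.2) * z.2⁻¹ := by fun_prop
  exact this.stronglyMeasurable.integral_prod_right'.measurable

variable (hprob : IsProbabilityMeasure
  (volume.withDensity fun y => ENNReal.ofReal (meanDensity F σ y)))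

include hprob

/-- Tonelli over the mixture of exponentials. Working with `∫⁻` gives integrability of the density
as a consequence. -/
lemma lintegral_exp_mul_ggcDensity {u : ℝ} (hu : 0 ≤ u) :
    ∫⁻ x, ENNReal.ofReal (Real.exp (-u * x) * ggcDensity F σ x) =
      ENNReal.ofReal (∫ y, (1 + u * y)⁻¹
        ∂volume.withDensity fun y => ENNReal.ofReal (meanDensity F σ y)) := by
  set ρ := volume.withDensity fun y => ENNReal.ofReal (meanDensity F σ y) with hρ
  have hpos : ∀ᵐ y ∂ρ, 0 < y := ae_pos_withDensity_meanDensity measurable_meanDensity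
  calc ∫⁻ x, ENNReal.ofReal (Real.exp (-u * x) * ggcDensity F σ x)
      = ∫⁻ x in Ioi 0, ENNReal.ofReal (Real.exp (-u * x) * ggcDensity F σ x) := by
        rw [← lintegral_indicator measurableSet_Ioi]
        congr 1 with x
        by_cases hx : 0 < x
        · rw [indicator_of_mem (mem_Ioi.2 hx)]
        · rw [indicator_of_notMem (by simpa using hx), ggcDensity_of_nonpos (not_lt.1 hx),
            mul_zero, ENNReal.ofReal_zero]
    _ = ∫⁻ x in Ioi 0, ∫⁻ y, ENNReal.ofReal
          (Real.exp (-u * x) * (Real.exp (-x / y) * y⁻¹)) ∂ρ := by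
        refine setLIntegral_congr_fun measurableSet_Ioi fun x hx => ?_
        have hx : 0 < x := hx
        rw [ggcDensity_eq_integral hx, ← integral_const_mul]
        refine ofReal_integral_eq_lintegral_ofReal (Integrable.const_mul ?_ _) ?_
        · refine (integrable_const x⁻¹).mono' (by
            refine Measurable.aestronglyMeasurable ?_; fun_prop) ?_
          filter_upwards [hpos] with y hy
          rw [Real.norm_eq_abs, abs_of_nonneg (by positivity)]
          exact exp_neg_div_mul_inv_le hx hy
        · filter_upwards [hpos] with y hy
          simp only [Pi.zero_apply]
          positivity
    _ = ∫⁻ y, (∫⁻ x in Ioi 0, ENNReal.ofReal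
          (Real.exp (-u * x) * (Real.exp (-x / y) * y⁻¹))) ∂ρ :=
        lintegral_lintegral_swap (by
          refine Measurable.aemeasurable ?_
          simp only [Function.uncurry_def]
          fun_prop)
    _ = ∫⁻ y, ENNReal.ofReal (1 + u * y)⁻¹ ∂ρ := by
        refine lintegral_congr_ae ?_
        filter_upwards [hpos] with y hy using lintegral_exp_mul_exp_div hu hy
    _ = ENNReal.ofReal (∫ y, (1 + u * y)⁻¹ ∂ρ) := by
        refine (ofReal_integral_eq_lintegral_ofReal
          (integrable_of_ae_mem_Icc (by fun_prop) ?_) ?_).symm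
        · filter_upwards [hpos] with y hy
          have : 0 ≤ u * y := by positivity
          exact ⟨by positivity, inv_le_one_of_one_le₀ (by linarith)⟩
        · filter_upwards [hpos] with y hy
          simp only [Pi.zero_apply]
          positivity

lemma integrable_exp_mul_ggcDensity {u : ℝ} (hu : 0 ≤ u) :
    Integrable fun x => Real.exp (-u * x) * ggcDensity F σ x := by
  have := measurable_ggcDensity (F := F) (σ := σ)
  refine ⟨by refine Measurable.aestronglyMeasurable ?_; fun_prop, ?_⟩
  rw [hasFiniteIntegral_iff_ofReal
    (ae_of_all _ fun x => mul_nonneg (Real.exp_pos _).le (ggcDensity_nonneg x)),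
    lintegral_exp_mul_ggcDensity hprob hu]
  exact ENNReal.ofReal_lt_top

lemma integral_exp_mul_ggcDensity {u : ℝ} (hu : 0 ≤ u) :
    ∫ x, Real.exp (-u * x) * ggcDensity F σ x = ∫ y, (1 + u * y)⁻¹
        ∂volume.withDensity fun y => ENNReal.ofReal (meanDensity F σ y) := by
  rw [integral_eq_lintegral_of_nonneg_ae
    (ae_of_all _ fun x => mul_nonneg (Real.exp_pos _).le (ggcDensity_nonneg x))
    (integrable_exp_mul_ggcDensity hprob hu).aestronglyMeasurable,
    lintegral_exp_mul_ggcDensity hprob hu, ENNReal.toReal_ofReal]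
  refine integral_nonneg_of_ae ?_
  filter_upwards [ae_pos_withDensity_meanDensity measurable_meanDensity] with y hy
  simp only [Pi.zero_apply]
  positivity

end Density

/-- Under the hypothesis on atoms, a measure with the Markov–Krein transform of order `1` of the
law of `X Y_σ` has the density `meanDensity`. -/
lemma HasMarkovKrein.eq_withDensity_meanDensity {F μ : Measure ℝ} [IsProbabilityMeasure F] {σ : ℝ}
    (hσ : 0 < σ) (hσ1 : σ ≤ 1) (hF_nonneg : F (Iio 0) = 0)
    (hF_log : ∀ lam : ℝ, 0 < lam → Integrable (fun x => Real.log (1 + lam * x)) F)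
    (hatom : ∀ x, bernoulliScaled F σ {x} < 1) (h : HasMarkovKrein 1 (bernoulliScaled F σ) μ) :
    μ = volume.withDensity fun x => ENNReal.ofReal (meanDensity F σ x) := by
  have := isProbabilityMeasure_bernoulliScaled (F := F) hσ hσ1
  rw [h.eq_withDensity_sineDensity (ae_nonneg_of_Iio (bernoulliScaled_Iio hF_nonneg))
    (fun lam hlam => integrable_bernoulliScaled (hF_log lam hlam)) hatom]
  refine withDensity_congr_ae ?_
  filter_upwards [sineDensity_bernoulliScaled_ae_eq hσ hσ1 hF_nonneg hF_log] with x hx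
  rw [hx]

/-- The law with Laplace transform `exp (-ψ)`, where `ψ` is the exponent of the law of `X Y_σ`,
has the density `ggcDensity`. -/
lemma eq_withDensity_ggcDensity {F : Measure ℝ} [IsProbabilityMeasure F] {σ : ℝ} (hσ : 0 < σ)
    (hσ1 : σ ≤ 1) (hF_nonneg : F (Iio 0) = 0)
    (hF_log : ∀ lam : ℝ, 0 < lam → Integrable (fun x => Real.log (1 + lam * x)) F)
    (hatom : ∀ x, bernoulliScaled F σ {x} < 1) {μ : Measure ℝ} [IsFiniteMeasure μ]
    (hμ : ∀ᵐ x ∂μ, 0 ≤ x)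
    (h : ∀ u : ℝ, 0 ≤ u → ∫ x, Real.exp (-u * x) ∂μ =
      Real.exp (-levyExponent (bernoulliScaled F σ) u)) :
    μ = volume.withDensity fun x => ENNReal.ofReal (ggcDensity F σ x) := by
  have := isProbabilityMeasure_bernoulliScaled (F := F) hσ hσ1
  -- An abstract law with the order-one transform replaces the Dirichlet mean; it also shows that
  -- `meanDensity` integrates to one.
  obtain ⟨ρ, hρ⟩ := exists_hasMarkovKrein_one (F := bernoulliScaled F σ)
    (bernoulliScaled_Iio hF_nonneg) fun lam hlam => integrable_bernoulliScaled (hF_log lam hlam)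
  have hρ_eq := hρ.eq_withDensity_meanDensity hσ hσ1 hF_nonneg hF_log hatom
  have hprob : IsProbabilityMeasure
      (volume.withDensity fun y => ENNReal.ofReal (meanDensity F σ y)) :=
    hρ_eq ▸ hρ.isProbabilityMeasure
  have hg := (measurable_ggcDensity (F := F) (σ := σ)).ennreal_ofReal
  have hint : Integrable (ggcDensity F σ) := by
    simpa using integrable_exp_mul_ggcDensity hprob le_rfl
  have hfin : IsFiniteMeasure (volume.withDensity fun x => ENNReal.ofReal (ggcDensity F σ x)) :=
    isFiniteMeasure_withDensity_ofReal hint.2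
  refine ext_of_laplace hμ ?_ fun u hu => ?_
  · rw [ae_withDensity_iff hg]
    refine ae_of_all _ fun x hx => ?_
    by_contra hlt
    exact hx (by rw [ggcDensity_of_nonpos (not_le.1 hlt).le, ENNReal.ofReal_zero])
  · rw [h u hu, integral_withDensity_eq_integral_toReal_smul hg
      (ae_of_all _ fun _ => ENNReal.ofReal_lt_top), ← hρ.integral_inv hu, hρ_eq,
      ← integral_exp_mul_ggcDensity hprob hu]
    congr 1 with x
    rw [ENNReal.toReal_ofReal (ggcDensity_nonneg x), smul_eq_mul, mul_comm]

/-- A random vector with nonnegative coordinates, whose Laplace transform is the product of those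
of independent variables with densities `ggcDensity`, has the product density. -/
lemma eq_withDensity_prod_ggcDensity {ι : Type*} [Fintype ι] {F : Measure ℝ}
    [IsProbabilityMeasure F] {σ : ι → ℝ} (hσ : ∀ i, 0 < σ i) (hσ1 : ∀ i, σ i ≤ 1)
    (hF_nonneg : F (Iio 0) = 0)
    (hF_log : ∀ lam : ℝ, 0 < lam → Integrable (fun x => Real.log (1 + lam * x)) F)
    (hatom : ∀ i x, bernoulliScaled F (σ i) {x} < 1) {μ : Measure (ι → ℝ)} [IsFiniteMeasure μ]
    (hμ : ∀ᵐ x ∂μ, ∀ i, 0 ≤ x i)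
    (h : ∀ u : ι → ℝ, (∀ i, 0 ≤ u i) → ∫ x, Real.exp (-∑ i, u i * x i) ∂μ =
      ∏ i, Real.exp (-levyExponent (bernoulliScaled F (σ i)) (u i))) :
    μ = volume.withDensity fun x => ENNReal.ofReal (∏ i, ggcDensity F (σ i) (x i)) := by
  have hex : ∀ i, ∃ ρ, HasMarkovKrein 1 (bernoulliScaled F (σ i)) ρ := fun i =>
    have := isProbabilityMeasure_bernoulliScaled (F := F) (hσ i) (hσ1 i)
    exists_hasMarkovKrein_one (bernoulliScaled_Iio hF_nonneg)
      fun lam hlam => integrable_bernoulliScaled (hF_log lam hlam)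
  choose ρ hρ using hex
  have hρ_eq := fun i => (hρ i).eq_withDensity_meanDensity (hσ i) (hσ1 i) hF_nonneg hF_log (hatom i)
  have hprob : ∀ i, IsProbabilityMeasure
      (volume.withDensity fun y => ENNReal.ofReal (meanDensity F (σ i) y)) := fun i =>
    hρ_eq i ▸ (hρ i).isProbabilityMeasure
  have hg : ∀ i, Measurable (ggcDensity F (σ i)) := fun i => measurable_ggcDensity
  have hprod : Measurable fun x : ι → ℝ => ∏ i, ggcDensity F (σ i) (x i) :=
    Finset.measurable_fun_prod _ fun i _ => (hg i).comp (measurable_pi_apply i)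
  have hprod0 : ∀ x : ι → ℝ, 0 ≤ ∏ i, ggcDensity F (σ i) (x i) := fun x =>
    Finset.prod_nonneg fun i _ => ggcDensity_nonneg _
  have hint : Integrable fun x : ι → ℝ => ∏ i, ggcDensity F (σ i) (x i) :=
    Integrable.fintype_prod fun i => by
      simpa using integrable_exp_mul_ggcDensity (hprob i) le_rfl
  have hfin : IsFiniteMeasure
      (volume.withDensity fun x : ι → ℝ => ENNReal.ofReal (∏ i, ggcDensity F (σ i) (x i))) :=
    isFiniteMeasure_withDensity_ofReal hint.2
  refine ext_of_laplace_pi hμ ?_ fun u hu => ?_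
  · rw [ae_withDensity_iff hprod.ennreal_ofReal]
    refine ae_of_all _ fun x hx i => ?_
    by_contra hlt
    refine hx ?_
    rw [Finset.prod_eq_zero (Finset.mem_univ i) (ggcDensity_of_nonpos (not_le.1 hlt).le),
      ENNReal.ofReal_zero]
  · rw [h u hu, integral_withDensity_eq_integral_toReal_smul hprod.ennreal_ofReal
      (ae_of_all _ fun _ => ENNReal.ofReal_lt_top)]
    have heq : ∀ x : ι → ℝ, (ENNReal.ofReal (∏ i, ggcDensity F (σ i) (x i))).toReal •
        Real.exp (-∑ i, u i * x i) = ∏ i, Real.exp (-u i * x i) * ggcDensity F (σ i) (x i) := by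
      intro x
      rw [ENNReal.toReal_ofReal (hprod0 x), smul_eq_mul, Finset.prod_mul_distrib, mul_comm,
        ← Real.exp_sum, ← Finset.sum_neg_distrib]
      simp_rw [neg_mul]
    simp_rw [heq]
    rw [integral_fintype_prod_volume_eq_prod
      fun i x => Real.exp (-u i * x) * ggcDensity F (σ i) x]
    refine Finset.prod_congr rfl fun i _ => ?_
    rw [integral_exp_mul_ggcDensity (hprob i) (hu i), ← hρ_eq i, (hρ i).integral_inv (hu i)]

/-! ### Masses of a subordinator -/

section Mass

variable {Ω : Type*} [MeasurableSpace Ω] {P : Measure Ω} [IsProbabilityMeasure P] {T θ : ℝ}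
  {F : Measure ℝ} {ζ : ℝ → Ω → ℝ}

omit [IsProbabilityMeasure P] in
lemma IsGGCSubordinator.aemeasurable_processMass (hT : 0 < T) (hζ : IsGGCSubordinator P T θ F ζ)
    {C : Set ℝ} (hC : MeasurableSet C) : AEMeasurable (processMass T ζ C) P := by
  obtain ⟨κ, hκ⟩ := hζ.exists_version hT.le
  refine ⟨fun ω => (κ ω).real C,
    ((Measure.measurable_coe hC).comp hκ.measurable).ennreal_toReal, ?_⟩
  filter_upwards [hκ.eq] with ω hω
  rw [processMass, hω]

lemma IsGGCSubordinator.laplace_processMass (hT : 0 < T) (hζ : IsGGCSubordinator P T θ F ζ)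
    (h0 : ∀ᵐ x ∂F, 0 ≤ x)
    (hF_log : ∀ lam : ℝ, 0 < lam → Integrable (fun x => Real.log (1 + lam * x)) F)
    [SFinite F] {ι : Type*} [Fintype ι] {C : ι → Set ℝ} (hC : ∀ i, MeasurableSet (C i))
    (hd : Pairwise fun i j => Disjoint (C i) (C j)) (hCT : ∀ i, C i ⊆ Icc 0 T)
    {u : ι → ℝ} (hu : ∀ i, 0 ≤ u i) :
    ∫ x, Real.exp (-∑ i, u i * x i) ∂P.map (fun ω i => processMass T ζ (C i) ω) =
      ∏ i, Real.exp (-(θ * volume.real (C i)) * levyExponent F (u i)) := by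
  obtain ⟨κ, hκ⟩ := hζ.exists_version hT.le
  rw [integral_map (aemeasurable_pi_lambda _ fun i => hζ.aemeasurable_processMass hT (hC i))
    (by refine Measurable.aestronglyMeasurable ?_; fun_prop),
    ← hκ.laplace_sets hT hζ h0 hF_log hC hd hCT hu]
  refine integral_congr_ae ?_
  filter_upwards [hκ.eq] with ω hω
  simp only [processMass, hω]

lemma IsGGCSubordinator.laplace_processMass_single (hT : 0 < T)
    (hζ : IsGGCSubordinator P T θ F ζ) (h0 : ∀ᵐ x ∂F, 0 ≤ x)
    (hF_log : ∀ lam : ℝ, 0 < lam → Integrable (fun x => Real.log (1 + lam * x)) F)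
    [SFinite F] {C : Set ℝ} (hC : MeasurableSet C) (hCT : C ⊆ Icc 0 T) {u : ℝ} (hu : 0 ≤ u) :
    ∫ x, Real.exp (-u * x) ∂P.map (processMass T ζ C) =
      Real.exp (-(θ * volume.real C) * levyExponent F u) := by
  have h := hζ.laplace_processMass hT h0 hF_log (ι := Unit) (C := fun _ => C) (fun _ => hC)
    (fun i j hij => absurd (Subsingleton.elim i j) hij) (fun _ => hCT) (u := fun _ => u)
    (fun _ => hu)
  rw [integral_map (aemeasurable_pi_lambda _ fun i => hζ.aemeasurable_processMass hT hC)
    (by refine Measurable.aestronglyMeasurable ?_; fun_prop)] at h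
  rw [integral_map (hζ.aemeasurable_processMass hT hC)
    (by refine Measurable.aestronglyMeasurable ?_; fun_prop)]
  simpa using h

omit [IsProbabilityMeasure P] in
lemma IsGGCSubordinator.ae_nonneg_map_processMass (hT : 0 < T)
    (hζ : IsGGCSubordinator P T θ F ζ) {C : Set ℝ} (hC : MeasurableSet C) :
    ∀ᵐ x ∂P.map (processMass T ζ C), 0 ≤ x := by
  rw [ae_map_iff (hζ.aemeasurable_processMass hT hC) measurableSet_Ici]
  exact ae_of_all _ fun ω => measureReal_nonneg

end Mass

end

/-! ### Proof of the proposition. -/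

theorem proposition2p1
    {Ω : Type*} [MeasurableSpace Ω] (P : Measure Ω) [IsProbabilityMeasure P]
    (θ : ℝ) (hθ : 0 < θ)
    (F : Measure ℝ) [IsProbabilityMeasure F]
    (hF_nonneg : F (Iio 0) = 0)
    (hF_log : ∀ lam : ℝ, 0 < lam → Integrable (fun x => Real.log (1 + lam * x)) F)
    (ζ : ℝ → Ω → ℝ) (hζ : IsGGCSubordinator P (1 / θ) θ F ζ)
    (k : ℕ) (C : Fin k → Set ℝ)
    (hC_meas : ∀ i, MeasurableSet (C i))
    (hC_disj : Pairwise fun i j => Disjoint (C i) (C j))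
    (hC_union : ⋃ i, C i = Icc 0 (1 / θ))
    (σ : Fin k → ℝ) (hσ : ∀ i, σ i = θ * (volume : Measure ℝ).real (C i))
    (hσ_pos : ∀ i, 0 < σ i) :
    ∑ i, σ i = 1 ∧
    -- the increments are independent
    iIndepFun (fun i => processMass (1 / θ) ζ (C i)) P ∧
    -- `ζ(C i)` has the law of `G₁ M₁(F_{X Y_σ})`
    (∀ i, ∀ D : Measure (Measure ℝ),
      IsDirichletProcessLaw 1 (bernoulliScaled F (σ i)) D →
      (∀ᵐ p ∂D, Integrable (fun x => x) p) ∧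
      P.map (processMass (1 / θ) ζ (C i)) = (gammaMeasure 1 1).mconv (meanLaw D)) ∧
    -- `M₁(F_{X Y_σ})` has the law of `β_{σ, 1 - σ} M_σ(F_X)`
    (∀ i, ∀ D D' : Measure (Measure ℝ),
      IsDirichletProcessLaw 1 (bernoulliScaled F (σ i)) D →
      IsDirichletProcessLaw (σ i) F D' →
      (∀ᵐ p ∂D', Integrable (fun x => x) p) ∧
      meanLaw D = (betaLaw (σ i) (1 - σ i)).mconv (meanLaw D')) ∧
    -- the densities, if no `F_{X Y_σ}` has a jump of size one
    ((∀ i x, bernoulliScaled F (σ i) {x} < 1) →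
      P.map (fun ω i => processMass (1 / θ) ζ (C i) ω) =
        (volume : Measure (Fin k → ℝ)).withDensity
          (fun x => ENNReal.ofReal (∏ i, ggcDensity F (σ i) (x i))) ∧
      (∀ i, P.map (processMass (1 / θ) ζ (C i)) =
        (volume : Measure ℝ).withDensity (fun x => ENNReal.ofReal (ggcDensity F (σ i) x))) ∧
      (∀ i, ∀ D : Measure (Measure ℝ),
        IsDirichletProcessLaw 1 (bernoulliScaled F (σ i)) D →
        meanLaw D =
          (volume : Measure ℝ).withDensity
            (fun x => ENNReal.ofReal (meanDensity F (σ i) x)))) := by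
  have hT : 0 < 1 / θ := by positivity
  have h0 := ae_nonneg_of_Iio hF_nonneg
  have hCT : ∀ i, C i ⊆ Icc 0 (1 / θ) := fun i => hC_union ▸ subset_iUnion C i
  have hsum : ∑ i, σ i = 1 := by
    simp_rw [hσ]
    rw [← Finset.mul_sum, ← measureReal_iUnion_fintype hC_disj hC_meas
      fun i => measure_ne_top_of_subset (hCT i) (by simp), hC_union, Real.volume_real_Icc_of_le hT.le]
    field_simp
    ring
  have hσ1 : ∀ i, σ i ≤ 1 := fun i => hsum ▸
    Finset.single_le_sum (fun j _ => (hσ_pos j).le) (Finset.mem_univ i)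
  have hmeas : ∀ i, AEMeasurable (processMass (1 / θ) ζ (C i)) P := fun i =>
    hζ.aemeasurable_processMass hT (hC_meas i)
  have hprobP : ∀ i, IsProbabilityMeasure (P.map (processMass (1 / θ) ζ (C i))) := fun i =>
    Measure.isProbabilityMeasure_map (hmeas i)
  have hmeas' : AEMeasurable (fun ω i => processMass (1 / θ) ζ (C i) ω) P :=
    aemeasurable_pi_lambda _ hmeas
  have hprobP' : IsProbabilityMeasure (P.map fun ω i => processMass (1 / θ) ζ (C i) ω) :=
    Measure.isProbabilityMeasure_map hmeas'
  have hnonneg := fun i => hζ.ae_nonneg_map_processMass hT (hC_meas i)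
  have hnonneg' : ∀ᵐ x ∂P.map (fun ω i => processMass (1 / θ) ζ (C i) ω), ∀ i, 0 ≤ x i := by
    rw [ae_map_iff hmeas' (by measurability)]
    exact ae_of_all _ fun ω i => measureReal_nonneg
  have hbern_prob := fun i => isProbabilityMeasure_bernoulliScaled (F := F) (hσ_pos i) (hσ1 i)
  have hbern_nonneg : ∀ i, bernoulliScaled F (σ i) (Iio 0) = 0 := fun i =>
    bernoulliScaled_Iio hF_nonneg
  have hbern_log : ∀ i, ∀ lam : ℝ, 0 < lam →
      Integrable (fun x => Real.log (1 + lam * x)) (bernoulliScaled F (σ i)) :=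
    fun i lam hlam => integrable_bernoulliScaled (hF_log lam hlam)
  have hexp : ∀ i, ∀ u : ℝ, 0 ≤ u → -(θ * (volume : Measure ℝ).real (C i)) * levyExponent F u =
      -levyExponent (bernoulliScaled F (σ i)) u := by
    intro i u hu
    rw [← hσ]
    rcases hu.eq_or_lt with rfl | hu
    · simp [levyExponent_zero]
    · rw [levyExponent_bernoulliScaled (hσ_pos i) (hσ1 i) hF_log hu, neg_mul]
  have hjoint : ∀ u : Fin k → ℝ, (∀ i, 0 ≤ u i) →
      ∫ x, Real.exp (-∑ i, u i * x i) ∂P.map (fun ω i => processMass (1 / θ) ζ (C i) ω) =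
        ∏ i, Real.exp (-levyExponent (bernoulliScaled F (σ i)) (u i)) := by
    intro u hu
    rw [hζ.laplace_processMass hT h0 hF_log hC_meas hC_disj hCT hu]
    exact Finset.prod_congr rfl fun i _ => by rw [hexp i _ (hu i)]
  have hsingle : ∀ i, ∀ u : ℝ, 0 ≤ u →
      ∫ x, Real.exp (-u * x) ∂P.map (processMass (1 / θ) ζ (C i)) =
        Real.exp (-levyExponent (bernoulliScaled F (σ i)) u) := by
    intro i u hu
    rw [hζ.laplace_processMass_single hT h0 hF_log (hC_meas i) (hCT i) hu, hexp i u hu]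
  -- Independence: the joint Laplace transform is the product of the marginal ones.
  have hpi : P.map (fun ω i => processMass (1 / θ) ζ (C i) ω) =
      Measure.pi fun i => P.map (processMass (1 / θ) ζ (C i)) := by
    refine ext_of_laplace_pi hnonneg' (ae_nonneg_pi _ hnonneg) fun u hu => ?_
    rw [hjoint u hu, integral_exp_neg_pi]
    exact Finset.prod_congr rfl fun i _ => (hsingle i _ (hu i)).symm
  refine ⟨hsum, (iIndepFun_iff_map_fun_eq_pi_map hmeas).2 hpi, ?_, ?_, fun hatom => ⟨?_, ?_, ?_⟩⟩
  · intro i D hD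
    have hmk := hD.hasMarkovKrein one_pos (hbern_nonneg i) (hbern_log i)
    have := hmk.isProbabilityMeasure
    refine ⟨hD.ae_integrable one_pos (hbern_nonneg i) (hbern_log i), ?_⟩
    refine ext_of_laplace (hnonneg i)
      (ae_nonneg_mconv (ae_nonneg_gammaMeasure 1 1) hmk.ae_nonneg) fun u hu => ?_
    rw [hsingle i u hu, integral_exp_neg_gamma_mconv hmk.ae_nonneg hu, hmk.integral_inv hu]
  · intro i D D' hD hD'
    refine ⟨hD'.ae_integrable (hσ_pos i) hF_nonneg hF_log, ?_⟩
    -- Both laws have the order-one transform of `X Y_σ`, the second through its beta factor.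
    exact (hD.hasMarkovKrein one_pos (hbern_nonneg i) (hbern_log i)).unique
      (ae_nonneg_of_Iio (hbern_nonneg i)) (hbern_log i)
      ((hD'.hasMarkovKrein (hσ_pos i) hF_nonneg hF_log).betaLaw_mconv (hσ_pos i) (hσ1 i) hF_log)
  · exact eq_withDensity_prod_ggcDensity hσ_pos hσ1 hF_nonneg hF_log hatom hnonneg' hjoint
  · intro i
    exact eq_withDensity_ggcDensity (hσ_pos i) (hσ1 i) hF_nonneg hF_log (hatom i) (hnonneg i)
      (hsingle i)
  · intro i D hD
    exact (hD.hasMarkovKrein one_pos (hbern_nonneg i) (hbern_log i)).eq_withDensity_meanDensity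
      (hσ_pos i) (hσ1 i) hF_nonneg hF_log (hatom i)
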